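/- Let $1\le k_{max}\le N$ be integers, $b(z)=\frac{z}{z-2/N}$, $c(z)=\frac{-2/N}{z-2/N}$, and let $\psi,\tau$ be meromorphic functions on $\mathbb C$ with $$b(z)\,\psi(z)=\psi(z-2),\qquad \frac{\tau(z)}{b(z)}=\frac{\tau(z-2)}{b(2-z)}$$ (for example $\psi(z)=\Gamma(1-\frac1N+\frac z2)/\Gamma(1+\frac z2)$ and $\tau(z)=z\,\Gamma(\frac1N+\frac z2)/\Gamma(1-\frac1N+\frac z2)$). **Notation.** For $k=0,1,\dots$ let $n_k\ge0$ be integers with $n_k=0$ for $k\ge k_{max}$, put $n=n_0$, and let $V^{(k)}=(\mathbb C^{N-k})^{\otimes n_k}$ with basis vectors $|\alpha_1\dots\alpha_{n_k}\rangle$, $k<\alpha_i\le N$. On every such space let $R_{ij}(z)=b(z)\mathbf 1+c(z)P_{ij}$, where $P_{ij}$ permutes the tensor factors $i$ and $j$. For $x\in\mathbb C^{n_k}$ and $u\in\mathbb C$ let $T(x,u)=R_{10}(x_1-u)R_{20}(x_2-u)\cdots R_{n_k0}(x_{n_k}-u)$, with one additional (auxiliary) factor $0$, a copy of $\mathbb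 C^{N-k}$. For $k+1<\beta\le N$ let $B^{(k)}_\beta(x,u)\in\mathrm{End}(V^{(k)})$ be the matrix element of $T(x,u)$ that sends the auxiliary basis vector $|\beta\rangle$ to $|k+1\rangle$. Let $\Omega^{(k)}=|k+1,\dots,k+1\rangle\in V^{(k)}$. **The nested Bethe Ansatz.** Fix arbitrary constants $\tilde x^{(k)}\in\mathbb C^{n_k}$, $k\ge1$. Define functions $f^{(k)}:\mathbb C^{n_k}\to V^{(k)}$, $0\le k<k_{max}$, by downward recursion. The iteration starts with $$f^{(k_{max}-1)}=\Omega^{(k_{max}-1)}=|k_{max}\dots k_{max}\rangle .$$ For $1\le k<k_{max}$, $$f^{(k-1)}(x)=\sum_{u\in\tilde x^{(k)}-2\mathbb Z^{n_k}}\ \sum_{\beta_1,\dots,\beta_{n_k}=k+1}^N B^{(k-1)}_{\beta_{n_k}}(x,u_{n_k})\cdots B^{(k-1)}_{\beta_1}(x,u_1)\,\Omega^{(k-1)}\,g^{(k-1)}(x,u)^{\beta_1\dots\beta_{n_k}},$$ $$g^{(k-1)}(x,u)=\prod_{i=1}^{n_{k-1}}\prod_{j=1}^{n_k}\psi(x_i-u_j)\prod_{1\le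 i<j\le n_k}\tau(u_i-u_j)\;f^{(k)}(u).$$ **Regularity and convergence.** We call $f^{(k-1)}$ *convergent* at $x$ if for all $\beta_1,\dots,\beta_{n_k}$ $$\sum_{l\in\mathbb Z^{n_k}}\bigl|g^{(k-1)}(x,\tilde x^{(k)}-2l)^{\beta_1\dots\beta_{n_k}}\bigr|\prod_{j=1}^{n_k}\frac1{1+|l_j|}<\infty$$ (on the lattice the matrix elements of $B^{(k-1)}_\beta(x,u_j)$ are of order $1/(1+|l_j|)$, so this is absolute convergence of the sum for $f^{(k-1)}(x)$). Let $x\in\mathbb C^n$ and assume: 1. for all $i,j$, no point of $x_i-\tilde x^{(1)}_j+2\mathbb Z$, and for $k\ge1$ no point of $\tilde x^{(k)}_i-\tilde x^{(k+1)}_j+2\mathbb Z$, is a pole of $\psi$ or equal to $2/N$ (values of $\psi$, $\tau$ being taken at points where they are analytic); 2. for $k\ge1$, no point of $\tilde x^{(k)}_i-\tilde x^{(k)}_j+2\mathbb Z$ is equal to $2/N$ (for $i\ne j$) or a pole of $\tau$ (for $i<j$); 3. for $1\le k<k_{max}-1$, $f^{(k)}$ is convergent at every point of the lattice $\tilde x^{(k)}-2\mathbb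 Z^{n_k}$. **Claim.** The function $f=f^{(0)}$ solves the system of $SU(N)$ matrix difference equations at $x$: for every $i=1,\dots,n$ such that $f^{(0)}$ is convergent (when $k_{max}\ge2$) at $x$ and at $(x_1,\dots,x_i+2,\dots,x_n)$, and such that the R-matrices below have no pole, $$f(x_1,\dots,x_i+2,\dots,x_n)=Q(x;i)\,f(x_1,\dots,x_i,\dots,x_n),$$ $$Q(x;i)=R_{i+1,i}(x_{i+1}-x_i')\cdots R_{n,i}(x_n-x_i')\,R_{1,i}(x_1-x_i)\cdots R_{i-1,i}(x_{i-1}-x_i),\qquad x_i'=x_i+2 .$$ -/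

import Mathlib

open scoped BigOperators

noncomputable section

/-- The function `b(z) = z / (z - 2/N)` of the rational `SU(N)` R-matrix. -/
def rb (N : ℕ) (z : ℂ) : ℂ := z / (z - 2 / N)

/-- The function `c(z) = (-2/N) / (z - 2/N)` of the rational `SU(N)` R-matrix. -/
def rc (N : ℕ) (z : ℂ) : ℂ := (-2 / N) / (z - 2 / N)

/-- The space `(ℂ^d)^{⊗ n}`; a vector is given by its components `v^{α_1 … α_n}` with respect to the
canonical basis `|α_1 … α_n⟩`. The colours are numbered by `Fin d`; for `d = N - k` the element `a`
of `Fin d` stands for the colour `k + 1 + a`, so the colours of level `k` are `k + 1, …, N`. -/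
abbrev TensorSpace (d n : ℕ) : Type := (Fin n → Fin d) → ℂ

/-- The permutation operator `P_{ij}`, which exchanges the tensor factors `i` and `j`. -/
def permSites {d n : ℕ} (i j : Fin n) : Module.End ℂ (TensorSpace d n) :=
  LinearMap.funLeft ℂ ℂ (fun α : Fin n → Fin d => α ∘ Equiv.swap i j)

/-- The R-matrix `R_{ij}(z) = b(z) 1 + c(z) P_{ij}`, acting on the tensor factors `i` and `j`. The
functions `b`, `c` depend on `N` also when it acts on a tensor power of `ℂ^d` with `d < N`. -/
def rMatrix (N : ℕ) {d n : ℕ} (i j : Fin n) (z : ℂ) : Module.End ℂ (TensorSpace d n) :=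
  rb N z • (1 : Module.End ℂ (TensorSpace d n)) + rc N z • permSites i j

/-- `Q_{1…n}(x; i) = R_{i+1,i}(x_{i+1} - x_i') ⋯ R_{n,i}(x_n - x_i')
R_{1,i}(x_1 - x_i) ⋯ R_{i-1,i}(x_{i-1} - x_i)` with `x_i' = x_i + 2`. -/
def qMatrix (N : ℕ) {d n : ℕ} (x : Fin n → ℂ) (i : Fin n) : Module.End ℂ (TensorSpace d n) :=
  (((List.finRange n).filter (fun j => i < j)).map
      (fun j => rMatrix N j i (x j - (x i + 2)))).prod *
    (((List.finRange n).filter (fun j => j < i)).map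
      (fun j => rMatrix N j i (x j - x i))).prod

/-- The monodromy matrix `T_{1…n,0}(x, u) = R_{10}(x_1 - u) ⋯ R_{n0}(x_n - u)`. Factor `0` of
`Fin (n + 1)` is the auxiliary space, the factors `i.succ` are the quantum spaces. -/
def monodromy (N : ℕ) {d n : ℕ} (x : Fin n → ℂ) (u : ℂ) :
    Module.End ℂ (TensorSpace d (n + 1)) :=
  (List.ofFn fun i : Fin n => rMatrix N i.succ 0 (x i - u)).prod

/-- `v ↦ |β⟩ ⊗ v`, with `|β⟩` in the auxiliary space. -/
def auxInsert {d n : ℕ} (β : Fin d) : TensorSpace d n →ₗ[ℂ] TensorSpace d (n + 1) where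
  toFun v := fun γ => if γ 0 = β then v (Fin.tail γ) else 0
  map_add' v w := by
    funext γ
    by_cases h : γ 0 = β <;> simp [h]
  map_smul' a v := by
    funext γ
    by_cases h : γ 0 = β <;> simp [h]

/-- The component of a vector along `|α⟩` in the auxiliary space. -/
def auxComponent {d n : ℕ} (α : Fin d) : TensorSpace d (n + 1) →ₗ[ℂ] TensorSpace d n :=
  LinearMap.funLeft ℂ ℂ (fun δ : Fin n → Fin d => (Fin.cons α δ : Fin (n + 1) → Fin d))

/-- The matrix element `T^α_β(x, u)` of the monodromy matrix with respect to the auxiliary space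
(`β` ingoing, `α` outgoing), an operator on the quantum space. -/
def monodromyEntry (N : ℕ) {d n : ℕ} (x : Fin n → ℂ) (u : ℂ) (α β : Fin d) :
    Module.End ℂ (TensorSpace d n) :=
  auxComponent α ∘ₗ monodromy N x u ∘ₗ auxInsert β

/-- The operator `B_β(x, u)`: the entry of the monodromy matrix whose upper index is the first
colour and whose lower index is the colour `β` among the `d` remaining ones. -/
def bOperator (N : ℕ) {d n : ℕ} (x : Fin n → ℂ) (u : ℂ) (β : Fin d) :
    Module.End ℂ (TensorSpace (d + 1) n) :=
  monodromyEntry N x u 0 β.succ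

/-- The reference state: all tensor factors carry the first colour. -/
def refState (d n : ℕ) : TensorSpace d n := fun α => if ∀ i, (α i : ℕ) = 0 then 1 else 0

/-- `∑_β B_{β_m}(x, u_m) ⋯ B_{β_1}(x, u_1) Ω g^{β_1 … β_m}`. -/
def betheVector (N : ℕ) {d n m : ℕ} (x : Fin n → ℂ) (u : Fin m → ℂ) (g : TensorSpace d m) :
    TensorSpace (d + 1) n :=
  ∑ β : Fin m → Fin d,
    g β • ((List.ofFn fun j : Fin m => bOperator N x (u j) (β j)).reverse.prod)
      (refState (d + 1) n)

/-- `∏_{i,j} ψ(x_i - u_j) ∏_{i<j} τ(u_i - u_j) v`. -/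
def dressed (ψ τ : ℂ → ℂ) {d n m : ℕ} (x : Fin n → ℂ) (u : Fin m → ℂ) (v : TensorSpace d m) :
    TensorSpace d m :=
  ((∏ i, ∏ j, ψ (x i - u j)) * ∏ i, ∏ j ∈ Finset.Ioi i, τ (u i - u j)) • v

/-- The point `(ũ_1 - 2 l_1, …, ũ_m - 2 l_m)` of the lattice over which one sums. -/
def latticePoint {m : ℕ} (ut : Fin m → ℂ) (l : Fin m → ℤ) : Fin m → ℂ :=
  fun j => ut j - 2 * (l j : ℂ)

/-- The nested Bethe Ansatz. `nestedBethe N ψ τ n ut r d k` is the vector valued function of level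
`k` with values in `(ℂ^d)^{⊗ n_k}`, `d = N - k`, above which there are `r` more levels. For `r = 0`
it is the reference state, and each level is the Jackson-type sum over the next one. The
case `r > 0`, `d = 0` does not occur for at most `N - 1` levels. -/
def nestedBethe (N : ℕ) (ψ τ : ℂ → ℂ) (n : ℕ → ℕ) (ut : ∀ k, Fin (n k) → ℂ) :
    (r d k : ℕ) → (Fin (n k) → ℂ) → TensorSpace d (n k)
  | 0, d, k => fun _ => refState d (n k)
  | _ + 1, 0, _ => fun _ => 0
  | r + 1, d + 1, k => fun x =>
      ∑' l : Fin (n (k + 1)) → ℤ,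
        betheVector N x (latticePoint (ut (k + 1)) l)
          (dressed ψ τ x (latticePoint (ut (k + 1)) l)
            (nestedBethe N ψ τ n ut r d (k + 1) (latticePoint (ut (k + 1)) l)))

/-- The function `f^{(k)}` of the nested Bethe Ansatz whose iteration starts with the reference
state `f^{(kmax - 1)} = |kmax … kmax⟩`. -/
def levelFunction (N kmax : ℕ) (ψ τ : ℂ → ℂ) (n : ℕ → ℕ) (ut : ∀ k, Fin (n k) → ℂ) (k : ℕ) :
    (Fin (n k) → ℂ) → TensorSpace (N - k) (n k) :=
  nestedBethe N ψ τ n ut (kmax - 1 - k) (N - k) k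

/-- The vector `g^{(k)}(x, u)`, for `x = x^{(k)}` and `u = x^{(k+1)}`. -/
def gFunction (N kmax : ℕ) (ψ τ : ℂ → ℂ) (n : ℕ → ℕ) (ut : ∀ k, Fin (n k) → ℂ) (k : ℕ)
    (x : Fin (n k) → ℂ) (u : Fin (n (k + 1)) → ℂ) : TensorSpace (N - (k + 1)) (n (k + 1)) :=
  dressed ψ τ x u (levelFunction N kmax ψ τ n ut (k + 1) u)

/-- Absolute convergence at `x` of the Jackson-type sum that defines `f^{(k)}(x)`. On the lattice
the matrix elements of `B_β(x, u_j)` are of order `1 / (1 + |l_j|)`; the sum with every operator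
`B_β(x, u_j)` replaced by this order of magnitude is required to be finite. -/
def JacksonConverges (N kmax : ℕ) (ψ τ : ℂ → ℂ) (n : ℕ → ℕ) (ut : ∀ k, Fin (n k) → ℂ) (k : ℕ)
    (x : Fin (n k) → ℂ) : Prop :=
  ∀ β : Fin (n (k + 1)) → Fin (N - (k + 1)),
    Summable fun l : Fin (n (k + 1)) → ℤ =>
      ‖gFunction N kmax ψ τ n ut k x (latticePoint (ut (k + 1)) l) β‖ *
        ∏ j, (1 + |(l j : ℝ)|)⁻¹

/-- `ψ` is a meromorphic solution of `b(z) ψ(z) = ψ(z - 2)`, as an identity of meromorphic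
functions. -/
structure IsPsi (N : ℕ) (ψ : ℂ → ℂ) : Prop where
  meromorphic : Meromorphic ψ
  eqn : ∀ᶠ z in Filter.codiscrete ℂ, rb N z * ψ z = ψ (z - 2)

/-- `τ` is a meromorphic solution of `τ(z) / b(z) = τ(z - 2) / b(2 - z)`, as an identity of
meromorphic functions. -/
structure IsTau (N : ℕ) (τ : ℂ → ℂ) : Prop where
  meromorphic : Meromorphic τ
  eqn : ∀ᶠ z in Filter.codiscrete ℂ, τ z / rb N z = τ (z - 2) / rb N (2 - z)

/-- For arguments `x` of one level and lattice `ut - 2 ℤ^m` of the next level, none of the functions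
`b`, `c` and `ψ` has a pole at a difference `x_i - u_j` (also after shifts of the `x_i` by `2`). -/
def RegularBetween (N : ℕ) (ψ : ℂ → ℂ) {n m : ℕ} (x : Fin n → ℂ) (ut : Fin m → ℂ) : Prop :=
  ∀ (i : Fin n) (j : Fin m) (l : ℤ),
    x i - ut j + 2 * (l : ℂ) ≠ 2 / N ∧ AnalyticAt ℂ ψ (x i - ut j + 2 * (l : ℂ))

/-- On the lattice `ut - 2 ℤ^m` the R-matrices `R(u_i - u_j)`, `i ≠ j`, and the functions
`τ(u_i - u_j)`, `i < j`, have no poles. -/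
def RegularWithin (N : ℕ) (τ : ℂ → ℂ) {m : ℕ} (ut : Fin m → ℂ) : Prop :=
  ∀ (i j : Fin m) (l : ℤ),
    (i ≠ j → ut i - ut j + 2 * (l : ℂ) ≠ 2 / N) ∧
    (i < j → AnalyticAt ℂ τ (ut i - ut j + 2 * (l : ℂ)))

end

noncomputable section

/-! Two properties carry the proof. `ExchangeAt`: exchanging neighbouring arguments acts on the
value by `P R`. `CyclicAt`: raising the last argument by 2 amounts to moving it, with its tensor
factor, to the first place. Together they give the difference equation
(`eq_qMatrix_of_exchangeAt_of_cyclicAt`): carry argument `i` to the first place through the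
arguments before it, pass by cyclicity to the last place, where the argument has become `x i + 2`,
and carry it back through the arguments after `i`.

Both properties hold for the reference state and descend from each level to the one below. Exchange
descends summand by summand (`levelSum_exchangeAt`): by the Yang-Baxter equation `P R` intertwines
the monodromy matrices, and it fixes the reference state.

For cyclicity (`levelSum_cyclicAt`) one compares components in the last factor at the arguments `(y,
s + 2)` with components in the first factor at `(s, y)`. For the first colour the summands agree by
the equation of `ψ`. For another colour they do not. After clearing denominators such a component is
a polynomial in the argument of that factor, of degree less than the number of parameters, so
Lagrange interpolation writes it as a sum over `j` of Bethe vectors without the parameter `u j`. For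
the last factor the nodes are `u j`, where `R` is the permutation
(`lastComponent_succ_betheVector`); for the first they are the poles `u j + 2 / N`
(`auxComponent_succ_betheVector`). By the equations of `ψ` and `τ` and cyclicity on the next level,
the `j`-th term of the second expansion at `u` is the `j`-th term of the first one with `u j` raised
by 2 (`lastCoeff_mul_tauProd_update`, `reducedVector_update_eq`). The difference of the sums over
the lattice therefore telescopes to zero (`hasSum_boundaryTerms`).

Interpolation needs distinct parameters. Where two coincide, the summand vanishes because `τ 0 = 0`,
and the stray terms that telescoping leaves there cancel in pairs, because the product of `τ`
changes sign (`tauProd_update`); the sign comes from `τ 2 = -τ (-2)`. -/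

/-! ### Scalar identities and components in one tensor factor -/

theorem rb_add_rc {N : ℕ} {z : ℂ} (h : z ≠ 2 / N) : rb N z + rc N z = 1 := by
  have : z - 2 / N ≠ 0 := sub_ne_zero.2 h
  unfold rb rc
  field_simp
  ring

theorem rb_zero (N : ℕ) : rb N 0 = 0 := by simp [rb]

theorem rc_zero {N : ℕ} (hN : N ≠ 0) : rc N 0 = 1 := by
  have : (N : ℂ) ≠ 0 := by exact_mod_cast hN
  simp [rc]
  field_simp

/-- The scalar form of the Yang-Baxter equation. -/
theorem rc_rb_yangBaxter {N : ℕ} {z w t : ℂ} (hz : z ≠ 2 / N) (hw : w ≠ 2 / N) (ht : t ≠ 2 / N)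
    (h : w = z + t) :
    rb N z * rc N w * rc N t + rc N z * rc N w * rb N t = rc N t * rb N w * rc N z := by
  have h1 : z - 2 / N ≠ 0 := sub_ne_zero.2 hz
  have h2 : w - 2 / N ≠ 0 := sub_ne_zero.2 hw
  have h3 : t - 2 / N ≠ 0 := sub_ne_zero.2 ht
  have h4 : w * (-2 / (N : ℂ)) ^ 2 = (z + t) * (-2 / (N : ℂ)) ^ 2 := by rw [h]
  unfold rb rc
  simp only [div_mul_div_comm]
  rw [div_add_div _ _ (by positivity) (by positivity), div_eq_div_iff (by positivity) (by positivity)]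
  subst h
  ring

theorem permSites_apply {d n : ℕ} (i j : Fin n) (v : TensorSpace d n) (α : Fin n → Fin d) :
    permSites i j v α = v (α ∘ Equiv.swap i j) := rfl

theorem rMatrix_apply {N d n : ℕ} (i j : Fin n) (z : ℂ) (v : TensorSpace d n)
    (α : Fin n → Fin d) :
    rMatrix N i j z v α = rb N z * v α + rc N z * v (α ∘ Equiv.swap i j) := by
  simp [rMatrix, permSites_apply]

theorem auxComponent_apply {d n : ℕ} (a : Fin d) (v : TensorSpace d (n + 1)) (δ : Fin n → Fin d) :
    auxComponent a v δ = v (Fin.cons a δ) := rfl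

/-- The component of a vector along `|a⟩` in the tensor factor `p`. -/
def siteComponent {d n : ℕ} (p : Fin (n + 1)) (a : Fin d) :
    TensorSpace d (n + 1) →ₗ[ℂ] TensorSpace d n :=
  LinearMap.funLeft ℂ ℂ (fun γ : Fin n → Fin d => (p.insertNth a γ : Fin (n + 1) → Fin d))

theorem siteComponent_apply {d n : ℕ} (p : Fin (n + 1)) (a : Fin d) (v : TensorSpace d (n + 1))
    (γ : Fin n → Fin d) : siteComponent p a v γ = v (p.insertNth a γ) := rfl

theorem insertNth_comp_swap {d n : ℕ} (p : Fin (n + 1)) (a : Fin d) (γ : Fin n → Fin d)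
    (i j : Fin n) :
    (p.insertNth a γ : Fin (n + 1) → Fin d) ∘ Equiv.swap (p.succAbove i) (p.succAbove j) =
      p.insertNth a (γ ∘ Equiv.swap i j) := by
  funext k
  refine Fin.succAboveCases p ?_ (fun k => ?_) k
  · simp [Equiv.swap_apply_of_ne_of_ne, Fin.ne_succAbove]
  · have : Equiv.swap (p.succAbove i) (p.succAbove j) (p.succAbove k) =
        p.succAbove (Equiv.swap i j k) := by
      simp only [Equiv.swap_apply_def, (Fin.succAbove_right_injective).eq_iff]
      split_ifs <;> rfl
    simp [this]

theorem siteComponent_rMatrix {N d n : ℕ} (p : Fin (n + 1)) (a : Fin d) (i j : Fin n) (z : ℂ)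
    (v : TensorSpace d (n + 1)) :
    siteComponent p a (rMatrix N (p.succAbove i) (p.succAbove j) z v) =
      rMatrix N i j z (siteComponent p a v) := by
  funext γ
  simp only [siteComponent_apply, rMatrix_apply, insertNth_comp_swap]

/-- R-matrices that do not touch the factor `p` leave its colour alone. Used with the first and with
the last quantum space as `p`, to split it off from the monodromy matrix. -/
theorem siteComponent_list_prod {N d n m : ℕ} (p : Fin (n + 1)) (a : Fin d) (i j : Fin m → Fin n)
    (z : Fin m → ℂ) (v : TensorSpace d (n + 1)) :
    siteComponent p a ((List.ofFn fun k =>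
        rMatrix N (p.succAbove (i k)) (p.succAbove (j k)) (z k)).prod v) =
      (List.ofFn fun k => rMatrix N (i k) (j k) (z k)).prod (siteComponent p a v) := by
  induction m with
  | zero => simp
  | succ m ih =>
    simp only [List.ofFn_succ, List.prod_cons, Module.End.mul_apply]
    rw [siteComponent_rMatrix, ih (fun k => i k.succ) (fun k => j k.succ) (fun k => z k.succ)]

/-! ### The monodromy matrix with one quantum space split off -/

/-- Splitting off the first quantum space from the monodromy matrix. -/
theorem monodromyEntry_cons_apply (N : ℕ) {d n : ℕ} (x : Fin (n + 1) → ℂ) (u : ℂ) (α β : Fin d)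
    (v : TensorSpace d (n + 1)) (a : Fin d) (δ : Fin n → Fin d) :
    monodromyEntry N x u α β v (Fin.cons a δ) =
      rb N (x 0 - u) * monodromyEntry N (Fin.tail x) u α β (auxComponent a v) δ +
      rc N (x 0 - u) * monodromyEntry N (Fin.tail x) u a β (auxComponent α v) δ := by
  -- All R-matrices but the leftmost avoid factor 1, the first quantum space, so its component can
  -- be taken before they act.
  have key : ∀ a' α' : Fin d,
      (List.ofFn fun i : Fin n => rMatrix N i.succ.succ 0 (x i.succ - u)).prod
        (auxInsert β v : TensorSpace d (n + 1 + 1)) (Fin.cons α' (Fin.cons a' δ)) =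
      monodromyEntry N (Fin.tail x) u α' β (auxComponent a' v) δ := by
    intro a' α'
    have h := siteComponent_list_prod (N := N) (1 : Fin (n + 1 + 1)) a' (fun k : Fin n => k.succ)
      (fun _ => 0) (fun k => x k.succ - u) (auxInsert β v)
    have hins : ∀ (b : Fin d) (γ : Fin (n + 1) → Fin d),
        ((1 : Fin (n + 1 + 1)).insertNth b γ : Fin (n + 1 + 1) → Fin d) =
          Fin.cons (γ 0) (Fin.cons b (Fin.tail γ)) := by
      intro b γ
      funext k
      refine Fin.succAboveCases 1 ?_ (fun k => ?_) k
      · simp only [Fin.insertNth_apply_same]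
        rfl
      · simp only [Fin.insertNth_apply_succAbove]
        refine Fin.cases ?_ (fun k => ?_) k
        · rfl
        · rw [show (1 : Fin (n + 1 + 1)).succAbove k.succ = k.succ.succ from by
            rw [show (1 : Fin (n + 1 + 1)) = Fin.succ 0 from rfl, Fin.succ_succAbove_succ]
            simp]
          rfl
    have hs : ∀ k : Fin n, (1 : Fin (n + 1 + 1)).succAbove k.succ = k.succ.succ := fun k => by
      rw [show (1 : Fin (n + 1 + 1)) = Fin.succ 0 from rfl, Fin.succ_succAbove_succ]
      simp
    have h0 : (1 : Fin (n + 1 + 1)).succAbove 0 = 0 := rfl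
    simp only [hs, h0] at h
    have h2 := congrFun h (Fin.cons α' δ)
    rw [siteComponent_apply, hins] at h2
    simp only [Fin.cons_zero, Fin.tail_cons] at h2
    rw [h2]
    have h3 : siteComponent 1 a' (auxInsert β v) = auxInsert β (auxComponent a' v) := by
      funext γ
      rw [siteComponent_apply, hins]
      simp [auxInsert, auxComponent_apply]
    rw [h3]
    rfl
  have e : ∀ w : TensorSpace d (n + 1 + 1),
      rMatrix N (Fin.succ 0) 0 (x 0 - u) w (Fin.cons α (Fin.cons a δ)) =
      rb N (x 0 - u) * w (Fin.cons α (Fin.cons a δ)) +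
        rc N (x 0 - u) * w (Fin.cons a (Fin.cons α δ)) := by
    intro w
    rw [rMatrix_apply]
    congr 3
    funext k
    refine Fin.cases ?_ (fun k => Fin.cases ?_ (fun k => ?_) k) k
    · simp
    · simp
    · rw [Function.comp_apply, Equiv.swap_apply_of_ne_of_ne]
      · simp
      · simp [Fin.ext_iff]
      · simp
  change monodromy N x u (auxInsert β v) (Fin.cons α (Fin.cons a δ)) = _
  rw [monodromy, List.ofFn_succ, List.prod_cons, Module.End.mul_apply, e, key, key]

/-- The component of a vector along `|a⟩` in the last tensor factor. -/
def lastComponent {d n : ℕ} (a : Fin d) : TensorSpace d (n + 1) →ₗ[ℂ] TensorSpace d n :=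
  LinearMap.funLeft ℂ ℂ (fun δ : Fin n → Fin d => (Fin.snoc δ a : Fin (n + 1) → Fin d))

theorem lastComponent_apply {d n : ℕ} (a : Fin d) (v : TensorSpace d (n + 1)) (δ : Fin n → Fin d) :
    lastComponent a v δ = v (Fin.snoc δ a : Fin (n + 1) → Fin d) := rfl

/-- Splitting off the last quantum space from the monodromy matrix. -/
theorem monodromyEntry_snoc_apply (N : ℕ) {d n : ℕ} (x : Fin (n + 1) → ℂ) (u : ℂ) (α β : Fin d)
    (v : TensorSpace d (n + 1)) (a : Fin d) (δ : Fin n → Fin d) :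
    monodromyEntry N x u α β v (Fin.snoc δ a : Fin (n + 1) → Fin d) =
      rb N (x (Fin.last n) - u) * monodromyEntry N (Fin.init x) u α β (lastComponent a v) δ +
      rc N (x (Fin.last n) - u) * if a = β then
        ∑ γ, monodromyEntry N (Fin.init x) u α γ (lastComponent γ v) δ else 0 := by
  set R : Module.End ℂ (TensorSpace d (n + 1 + 1)) :=
    rMatrix N (Fin.last n).succ 0 (x (Fin.last n) - u) with hR
  have h1 := siteComponent_list_prod (N := N) (Fin.last (n + 1)) a (fun k : Fin n => k.succ)
      (fun _ => 0) (fun k => x k.castSucc - u) (R (auxInsert β v))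
  -- The R-matrix of the last space acts first. Its exchange term puts `β` into the last space and
  -- leaves the former colour `γ` there in the auxiliary space, hence the sum over `γ`.
  have h2 : siteComponent (Fin.last (n + 1)) a (R (auxInsert β v)) =
      rb N (x (Fin.last n) - u) • auxInsert β (lastComponent a v) +
      rc N (x (Fin.last n) - u) • if a = β then ∑ γ, auxInsert γ (lastComponent γ v) else 0 := by
    funext γ
    rw [siteComponent_apply, hR, rMatrix_apply]
    have e1 : (auxInsert β v : TensorSpace d (n + 1 + 1)) ((Fin.last (n + 1)).insertNth a γ) =
        auxInsert β (lastComponent a v) γ := by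
      obtain ⟨g0, γ', rfl⟩ : ∃ g0 γ', γ = Fin.cons g0 γ' := ⟨γ 0, Fin.tail γ, by simp⟩
      simp only [Fin.insertNth_last']
      rw [← Fin.cons_snoc_eq_snoc_cons]
      simp [auxInsert, lastComponent_apply]
    have e2 : (auxInsert β v : TensorSpace d (n + 1 + 1)) (((Fin.last (n + 1)).insertNth a γ :
          Fin (n + 1 + 1) → Fin d) ∘ Equiv.swap (Fin.last n).succ 0) =
        (if a = β then ∑ γ, auxInsert γ (lastComponent γ v) else 0 : TensorSpace d (n + 1)) γ := by
      obtain ⟨g0, γ', rfl⟩ : ∃ g0 γ', γ = Fin.cons g0 γ' := ⟨γ 0, Fin.tail γ, by simp⟩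
      have e3 : ((Fin.last (n + 1)).insertNth a (Fin.cons g0 γ' : Fin (n + 1) → Fin d) :
          Fin (n + 1 + 1) → Fin d) ∘ Equiv.swap (Fin.last n).succ 0 =
          Fin.cons a (Fin.snoc γ' g0 : Fin (n + 1) → Fin d) := by
        simp only [Fin.insertNth_last']
        rw [← Fin.cons_snoc_eq_snoc_cons]
        funext k
        refine Fin.cases ?_ (fun k => Fin.lastCases ?_ (fun k => ?_) k) k
        · simp
        · simp
        · rw [Function.comp_apply, Equiv.swap_apply_of_ne_of_ne]
          · simp
          · simp [Fin.ext_iff]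
            omega
          · simp
      rw [e3]
      by_cases h : a = β
      · simp [auxInsert, h, lastComponent_apply, Finset.sum_apply]
      · simp [auxInsert, h]
    rw [e1, e2]
    simp only [Pi.add_apply, Pi.smul_apply, smul_eq_mul]
  have hs : ∀ k : Fin n, (Fin.last (n + 1)).succAbove k.succ = k.castSucc.succ := fun k => by simp
  have h0 : (Fin.last (n + 1)).succAbove (0 : Fin (n + 1)) = 0 := by simp
  simp only [hs, h0] at h1
  change monodromy N x u (auxInsert β v) (Fin.cons α (Fin.snoc δ a : Fin (n + 1) → Fin d)) = _
  rw [monodromy, List.ofFn_succ', List.concat_eq_append, List.prod_append, List.prod_singleton,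
    Module.End.mul_apply, ← hR, Fin.cons_snoc_eq_snoc_cons]
  have h3 := congrFun h1 (Fin.cons α δ)
  rw [siteComponent_apply, Fin.insertNth_last', h2] at h3
  refine h3.trans ?_
  rw [map_add, map_smul, map_smul]
  by_cases h : a = β
  · simp only [h, if_true, map_sum]
    simp only [Pi.add_apply, Pi.smul_apply, Finset.sum_apply, smul_eq_mul]
    rfl
  · simp only [h, if_false, map_zero]
    simp only [Pi.add_apply, Pi.smul_apply, smul_eq_mul]
    rfl

theorem monodromyEntry_zero (N : ℕ) {d : ℕ} (x : Fin 0 → ℂ) (u : ℂ) (α β : Fin d)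
    (v : TensorSpace d 0) : monodromyEntry N x u α β v = if α = β then v else 0 := by
  funext δ
  change (if _ then _ else _) = _
  by_cases h : α = β
  · simp only [h, Fin.cons_zero, if_true]
    congr 1
  · simp [h]

theorem auxComponent_monodromyEntry (N : ℕ) {d n : ℕ} (x : Fin (n + 1) → ℂ) (u : ℂ) (α β a : Fin d)
    (v : TensorSpace d (n + 1)) :
    auxComponent a (monodromyEntry N x u α β v) =
      rb N (x 0 - u) • monodromyEntry N (Fin.tail x) u α β (auxComponent a v) +
      rc N (x 0 - u) • monodromyEntry N (Fin.tail x) u a β (auxComponent α v) := by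
  funext δ
  rw [auxComponent_apply, monodromyEntry_cons_apply]
  rfl

/-! ### Exchange relations and the reference state -/

/-- The exchange relation of the matrix elements of two monodromy matrices. -/
theorem monodromyEntry_exchange {N d n : ℕ} (x : Fin n → ℂ) {s u : ℂ} (hsu : s - u ≠ 2 / N)
    (hs : ∀ i, x i - s ≠ 2 / N) (hu : ∀ i, x i - u ≠ 2 / N) (α β γ δ : Fin d)
    (v : TensorSpace d n) :
    rb N (s - u) • monodromyEntry N x s α β (monodromyEntry N x u γ δ v) +
        rc N (s - u) • monodromyEntry N x s α δ (monodromyEntry N x u γ β v) =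
      rb N (s - u) • monodromyEntry N x u γ δ (monodromyEntry N x s α β v) +
        rc N (s - u) • monodromyEntry N x u α δ (monodromyEntry N x s γ β v) := by
  induction n generalizing α β γ δ with
  | zero =>
    simp only [monodromyEntry_zero]
    by_cases h1 : α = β <;> by_cases h2 : γ = δ <;> by_cases h3 : α = δ <;>
      by_cases h4 : γ = β <;> (simp [h1, h2, h3, h4]; try grind)
  | succ n ih =>
    have hs' : ∀ i, Fin.tail x i - s ≠ 2 / N := fun i => hs i.succ
    have hu' : ∀ i, Fin.tail x i - u ≠ 2 / N := fun i => hu i.succ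
    funext ε
    obtain ⟨a, ε, rfl⟩ : ∃ a ε', ε = Fin.cons a ε' := ⟨ε 0, Fin.tail ε, by simp⟩
    simp only [Pi.add_apply, Pi.smul_apply, smul_eq_mul, monodromyEntry_cons_apply,
      auxComponent_monodromyEntry, map_add, map_smul]
    have Y := rc_rb_yangBaxter (N := N) hsu (hu 0) (hs 0) (by ring)
    have I := fun p q : Fin d => fun w => congrFun (ih (Fin.tail x) hs' hu' p β q δ w) ε
    simp only [Pi.add_apply, Pi.smul_apply, smul_eq_mul] at I
    have I1 := I α γ (auxComponent a v)
    have I2 := I α a (auxComponent γ v)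
    have I3 := I a γ (auxComponent α v)
    have I4 := I a α (auxComponent γ v)
    set bs := rb N (x 0 - s)
    set cs := rc N (x 0 - s)
    set bu := rb N (x 0 - u)
    set cu := rc N (x 0 - u)
    set b := rb N (s - u)
    set c := rc N (s - u)
    set T := fun (p q p' q' : Fin d) w => monodromyEntry N (Fin.tail x) u p q
      (monodromyEntry N (Fin.tail x) s p' q' w) ε with hT
    -- The four instances of the induction hypothesis are weighted by the coefficients of the first
    -- site; the remainder is a multiple of the scalar Yang-Baxter equation.
    linear_combination (bs * bu) * I1 + (bs * cu) * I2 + (cs * bu) * I3 + (cs * cu) * I4 +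
      Y * (T α δ a β (auxComponent γ v) - T a δ γ β (auxComponent α v))

theorem refState_cons (d n : ℕ) (a : Fin (d + 1)) :
    auxComponent a (refState (d + 1) (n + 1)) = if a = 0 then refState (d + 1) n else 0 := by
  funext δ
  rw [auxComponent_apply]
  by_cases h : a = 0
  · simp [refState, h, Fin.forall_fin_succ]
  · simp [refState, h, Fin.forall_fin_succ]

/-- The reference state is an eigenvector of the operator `A`. -/
theorem monodromyEntry_refState_zero {N d n : ℕ} (x : Fin n → ℂ) {u : ℂ}
    (hu : ∀ i, x i - u ≠ 2 / N) :
    monodromyEntry N x u 0 0 (refState (d + 1) n) = refState (d + 1) n := by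
  induction n with
  | zero => simp [monodromyEntry_zero]
  | succ n ih =>
    have h := ih (Fin.tail x) (fun i => hu i.succ)
    funext ε
    obtain ⟨a, ε, rfl⟩ : ∃ a ε', ε = Fin.cons a ε' := ⟨ε 0, Fin.tail ε, by simp⟩
    have e := rb_add_rc (hu 0)
    rw [monodromyEntry_cons_apply, refState_cons, refState_cons, ← auxComponent_apply a (refState _ _), refState_cons]
    by_cases ha : a = 0
    · simp only [ha, if_true, h]
      rw [← add_mul, e, one_mul]
    · simp only [ha, if_false, if_true, map_zero, Pi.zero_apply, mul_zero, zero_add]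
      -- The operators `C` (column 0, row not 0) annihilate the reference state.
      have : ∀ (m : ℕ) (y : Fin m → ℂ), monodromyEntry N y u a 0 (refState (d + 1) m) = 0 := by
        intro m
        induction m with
        | zero => intro y; simp [monodromyEntry_zero, ha]
        | succ m ih =>
          intro y
          funext ε
          obtain ⟨b, ε, rfl⟩ : ∃ a ε', ε = Fin.cons a ε' := ⟨ε 0, Fin.tail ε, by simp⟩
          rw [monodromyEntry_cons_apply, refState_cons, refState_cons]
          by_cases hb : b = 0 <;> simp [hb, ha, ih]
      simp [this]

/-- The reference state is an eigenvector of the diagonal entries of the operator `D`, and is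
annihilated by the off-diagonal ones. -/
theorem monodromyEntry_refState_succ {N d n : ℕ} (x : Fin n → ℂ) (u : ℂ) (α β : Fin d)
    (γ : Fin n → Fin (d + 1)) :
    monodromyEntry N x u α.succ β.succ (refState (d + 1) n) γ =
      if α = β then (∏ i, rb N (x i - u)) * refState (d + 1) n γ else 0 := by
  induction n with
  | zero => by_cases h : α = β <;> simp [monodromyEntry_zero, h]
  | succ n ih =>
    obtain ⟨a, γ, rfl⟩ : ∃ a ε', γ = Fin.cons a ε' := ⟨γ 0, Fin.tail γ, by simp⟩
    rw [monodromyEntry_cons_apply, refState_cons, refState_cons,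
      ← auxComponent_apply a (refState _ _), refState_cons, Fin.prod_univ_succ]
    by_cases ha : a = 0
    · have := ih (Fin.tail x) γ
      by_cases h : α = β <;> simp [h, ha] at this ⊢
      · rw [this, mul_assoc]
        rfl
      · simp [this]
    · by_cases h : α = β <;> simp [h, ha]

/-- The exchange operator of two neighbouring tensor factors commutes with the exchange of the
corresponding arguments of the monodromy matrix. -/
theorem monodromyEntry_comp_swap {N d n : ℕ} (x : Fin n → ℂ) {u : ℂ}
    (hu : ∀ i, x i - u ≠ 2 / N) (i j : Fin n) (hij : (j : ℕ) = i + 1)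
    (hx : x i - x j ≠ 2 / N) (α β : Fin d) (v : TensorSpace d n) :
    monodromyEntry N (x ∘ Equiv.swap i j) u α β (permSites i j (rMatrix N i j (x i - x j) v)) =
      permSites i j (rMatrix N i j (x i - x j) (monodromyEntry N x u α β v)) := by
  induction n generalizing α β with
  | zero => exact i.elim0
  | succ n ih =>
    funext ε
    obtain ⟨a, ε, rfl⟩ : ∃ a ε', ε = Fin.cons a ε' := ⟨ε 0, Fin.tail ε, by simp⟩
    obtain ⟨j, rfl⟩ : ∃ j', j = Fin.succ j' :=
      ⟨j.pred (by rintro rfl; simp at hij), by simp⟩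
    have hcons : ∀ (b : Fin d) (γ : Fin n → Fin d) (p q : Fin n),
        (Fin.cons b γ : Fin (n + 1) → Fin d) ∘ Equiv.swap p.succ q.succ =
          Fin.cons b (γ ∘ Equiv.swap p q) := by
      intro b γ p q
      have := insertNth_comp_swap 0 b γ p q
      simpa using this
    -- For sites 0 and 1 both are split off and the scalar Yang-Baxter equation remains; otherwise
    -- site 0 is a spectator and induction applies.
    refine Fin.cases (fun hij hx => ?_) (fun i hij hx => ?_) i hij hx
    · obtain ⟨n, rfl⟩ : ∃ m, n = m + 1 := ⟨n - 1, by have := j.isLt; omega⟩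
      obtain rfl : j = 0 := Fin.ext (by simp at hij; simpa using hij)
      have hw : ∀ (p q : Fin d) (γ : Fin n → Fin d),
          (Fin.cons p (Fin.cons q γ : Fin (n + 1) → Fin d) : Fin (n + 1 + 1) → Fin d) ∘
            Equiv.swap 0 (Fin.succ 0) = Fin.cons q (Fin.cons p γ : Fin (n + 1) → Fin d) := by
        intro p q γ
        funext k
        refine Fin.cases ?_ (fun k => Fin.cases ?_ (fun k => ?_) k) k
        · simp
        · simp
        · rw [Function.comp_apply, Equiv.swap_apply_of_ne_of_ne]
          · simp
          · simp
          · simp [Fin.ext_iff]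
      obtain ⟨a', ε, rfl⟩ : ∃ a ε', ε = Fin.cons a ε' := ⟨ε 0, Fin.tail ε, by simp⟩
      have ht : Fin.tail (Fin.tail (x ∘ Equiv.swap 0 (Fin.succ 0))) = Fin.tail (Fin.tail x) := by
        funext k
        simp only [Fin.tail, Function.comp_apply]
        rw [Equiv.swap_apply_of_ne_of_ne (by simp) (by simp [Fin.ext_iff])]
      have h0 : (x ∘ Equiv.swap 0 (Fin.succ 0)) 0 = x 1 := by simp
      have h1 : Fin.tail (x ∘ Equiv.swap 0 (Fin.succ 0)) 0 = x 0 := by simp [Fin.tail]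
      have h1' : Fin.tail x 0 = x 1 := rfl
      have hv : ∀ p q : Fin d, auxComponent q (auxComponent p
          (permSites 0 (Fin.succ 0) (rMatrix N 0 (Fin.succ 0) (x 0 - x 1) v))) =
          rb N (x 0 - x 1) • auxComponent p (auxComponent q v) +
          rc N (x 0 - x 1) • auxComponent q (auxComponent p v) := by
        intro p q
        funext γ
        simp only [Pi.add_apply, Pi.smul_apply, smul_eq_mul, auxComponent_apply, permSites_apply,
          rMatrix_apply, hw]
      have Y := rc_rb_yangBaxter (N := N) (z := x 0 - x 1) (w := x 0 - u) (t := x 1 - u) hx (hu 0) (hu 1) (by ring)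
      change _ = permSites 0 (Fin.succ 0) (rMatrix N 0 (Fin.succ 0) (x 0 - x 1) _) _
      simp only [permSites_apply, rMatrix_apply, hw]
      simp only [monodromyEntry_cons_apply, ht, h0, h1, h1']
      change _ * (_ * monodromyEntry N _ u α β (auxComponent a' (auxComponent a
          (permSites 0 (Fin.succ 0) (rMatrix N 0 (Fin.succ 0) (x 0 - x 1) v)))) _ +
        _ * monodromyEntry N _ u a' β (auxComponent α (auxComponent a
          (permSites 0 (Fin.succ 0) (rMatrix N 0 (Fin.succ 0) (x 0 - x 1) v)))) _) +
        _ * (_ * monodromyEntry N _ u a β (auxComponent a' (auxComponent α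
          (permSites 0 (Fin.succ 0) (rMatrix N 0 (Fin.succ 0) (x 0 - x 1) v)))) _ +
        _ * monodromyEntry N _ u a' β (auxComponent a (auxComponent α
          (permSites 0 (Fin.succ 0) (rMatrix N 0 (Fin.succ 0) (x 0 - x 1) v)))) _) = _
      simp only [hv, map_add, map_smul, Pi.add_apply, Pi.smul_apply, smul_eq_mul]
      set T := fun (p q r : Fin d) => monodromyEntry N (Fin.tail (Fin.tail x)) u p β
        (auxComponent q (auxComponent r v)) ε with hT
      linear_combination Y * (T a' α a - T a a' α)
    · have h := fun (α : Fin d) (w : TensorSpace d n) =>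
        ih (Fin.tail x) (fun k => hu k.succ) i j (by simp at hij; omega) hx α β w
      have ht : Fin.tail (x ∘ Equiv.swap i.succ j.succ) = Fin.tail x ∘ Equiv.swap i j := by
        funext k
        simp only [Fin.tail, Function.comp_apply]
        rw [(Fin.succ_injective n).swap_apply]
      have h0 : (x ∘ Equiv.swap i.succ j.succ) 0 = x 0 := by
        simp [Equiv.swap_apply_of_ne_of_ne, (Fin.succ_ne_zero _).symm]
      have hv : ∀ (b : Fin d) (w : TensorSpace d (n + 1)),
          auxComponent b (permSites i.succ j.succ (rMatrix N i.succ j.succ (x i.succ - x j.succ) w)) =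
            permSites i j (rMatrix N i j (x i.succ - x j.succ) (auxComponent b w)) := by
        intro b w
        funext γ
        simp only [auxComponent_apply, permSites_apply, rMatrix_apply, hcons]
      rw [monodromyEntry_cons_apply, ht, h0, hv, hv]
      have h1 := h α (auxComponent a v)
      have h2 := h a (auxComponent α v)
      simp only [Fin.tail] at h1 h2
      rw [← auxComponent_apply a (permSites _ _ _), hv, auxComponent_monodromyEntry]
      change _ * monodromyEntry N (Fin.tail x ∘ _) u _ _ _ _ + _ * monodromyEntry N (Fin.tail x ∘ _) u _ _ _ _ = _
      change monodromyEntry N (Fin.tail x ∘ _) u _ _ _ = _ at h1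
      change monodromyEntry N (Fin.tail x ∘ _) u _ _ _ = _ at h2
      rw [h1, h2]
      simp only [map_add, map_smul]
      rfl

theorem lastComponent_monodromyEntry (N : ℕ) {d n : ℕ} (x : Fin (n + 1) → ℂ) (u : ℂ)
    (α β a : Fin d) (v : TensorSpace d (n + 1)) :
    lastComponent a (monodromyEntry N x u α β v) =
      rb N (x (Fin.last n) - u) • monodromyEntry N (Fin.init x) u α β (lastComponent a v) +
      rc N (x (Fin.last n) - u) • if a = β then
        ∑ γ, monodromyEntry N (Fin.init x) u α γ (lastComponent γ v) else 0 := by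
  funext δ
  rw [lastComponent_apply, monodromyEntry_snoc_apply]
  by_cases h : a = β <;> simp [h, Finset.sum_apply]

theorem lastComponent_refState (d n : ℕ) (a : Fin (d + 1)) :
    lastComponent a (refState (d + 1) (n + 1)) = if a = 0 then refState (d + 1) n else 0 := by
  funext δ
  rw [lastComponent_apply]
  by_cases h : a = 0
  · simp [refState, h, Fin.forall_fin_succ']
  · simp [refState, Fin.forall_fin_succ', h]

/-! ### Bethe vectors and their symmetry in the parameters -/

theorem betheVector_zero (N : ℕ) {d n : ℕ} (x : Fin n → ℂ) (u : Fin 0 → ℂ) (g : TensorSpace d 0) :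
    betheVector N x u g = g Fin.elim0 • refState (d + 1) n := by
  simp [betheVector, Subsingleton.elim (default : Fin 0 → Fin d) Fin.elim0]

/-- Splitting off the outermost operator of a Bethe vector. -/
theorem betheVector_succ (N : ℕ) {d n m : ℕ} (x : Fin n → ℂ) (u : Fin (m + 1) → ℂ)
    (g : TensorSpace d (m + 1)) :
    betheVector N x u g = ∑ b, monodromyEntry N x (u (Fin.last m)) 0 b.succ
      (betheVector N x (Fin.init u) (lastComponent b g)) := by
  unfold betheVector
  rw [← (Fin.snocEquiv fun _ : Fin (m + 1) => Fin d).sum_comp, Fintype.sum_prod_type]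
  refine Finset.sum_congr rfl fun b _ => ?_
  rw [map_sum]
  refine Finset.sum_congr rfl fun β _ => ?_
  rw [map_smul, lastComponent_apply]
  congr 1
  rw [List.ofFn_succ', List.concat_eq_append, List.reverse_append, List.reverse_singleton,
    List.prod_append, List.prod_singleton, Module.End.mul_apply]
  simp [Fin.snocEquiv, bOperator, Fin.init]

theorem betheVector_smul (N : ℕ) {d n m : ℕ} (x : Fin n → ℂ) (u : Fin m → ℂ) (c : ℂ)
    (g : TensorSpace d m) : betheVector N x u (c • g) = c • betheVector N x u g := by
  simp [betheVector, Finset.smul_sum, mul_smul]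

/-- When both rows are 0, the two terms on the right of the general exchange relation coincide, and
`b + c = 1`. -/
theorem monodromyEntry_zero_exchange {N d n : ℕ} (x : Fin n → ℂ) {s u : ℂ} (hsu : s - u ≠ 2 / N)
    (hs : ∀ i, x i - s ≠ 2 / N) (hu : ∀ i, x i - u ≠ 2 / N) (β γ : Fin (d + 1))
    (v : TensorSpace (d + 1) n) :
    rb N (s - u) • monodromyEntry N x s 0 β (monodromyEntry N x u 0 γ v) +
        rc N (s - u) • monodromyEntry N x s 0 γ (monodromyEntry N x u 0 β v) =
      monodromyEntry N x u 0 γ (monodromyEntry N x s 0 β v) := by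
  rw [monodromyEntry_exchange x hsu hs hu, ← add_smul, rb_add_rc hsu, one_smul]

/-- The exchange of two neighbouring parameters of a Bethe vector. -/
theorem betheVector_comp_swap {N d n m : ℕ} (x : Fin n → ℂ) (u : Fin m → ℂ)
    (hxu : ∀ i j, x i - u j ≠ 2 / N) (i j : Fin m) (hij : (j : ℕ) = i + 1)
    (hu : u i - u j ≠ 2 / N) (g : TensorSpace d m) :
    betheVector N x (u ∘ Equiv.swap i j) (permSites i j (rMatrix N i j (u i - u j) g)) =
      betheVector N x u g := by
  induction m with
  | zero => exact i.elim0
  | succ m ih =>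
    obtain ⟨i, rfl⟩ : ∃ i', i = Fin.castSucc i' :=
      ⟨i.castPred (by rintro rfl; have := j.isLt; simp at hij; omega), by simp⟩
    refine Fin.lastCases (fun hij hu => ?_) (fun j hij hu => ?_) j hij hu
    · obtain ⟨m, rfl⟩ : ∃ k, m = k + 1 := ⟨m - 1, by have := i.isLt; omega⟩
      obtain rfl : i = Fin.last m := Fin.ext (by simp at hij; simp; omega)
      have hw : ∀ (p q : Fin d) (γ : Fin m → Fin d),
          (Fin.snoc (Fin.snoc γ p : Fin (m + 1) → Fin d) q : Fin (m + 1 + 1) → Fin d) ∘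
            Equiv.swap (Fin.castSucc (Fin.last m)) (Fin.last (m + 1)) =
            (Fin.snoc (Fin.snoc γ q : Fin (m + 1) → Fin d) p : Fin (m + 1 + 1) → Fin d) := by
        intro p q γ
        funext k
        refine Fin.lastCases ?_ (fun k => Fin.lastCases ?_ (fun k => ?_) k) k
        · simp
        · simp
        · rw [Function.comp_apply, Equiv.swap_apply_of_ne_of_ne]
          · simp
          · simp [Fin.ext_iff]; omega
          · simp [Fin.ext_iff]; omega
      set S := Equiv.swap (Fin.castSucc (Fin.last m)) (Fin.last (m + 1)) with hS
      have h1 : (u ∘ S) (Fin.last (m + 1)) = u (Fin.castSucc (Fin.last m)) := by simp [hS]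
      have h2 : Fin.init (u ∘ S) (Fin.last m) = u (Fin.last (m + 1)) := by simp [hS, Fin.init]
      have h2' : Fin.init u (Fin.last m) = u (Fin.castSucc (Fin.last m)) := rfl
      have h3 : Fin.init (Fin.init (u ∘ S)) = Fin.init (Fin.init u) := by
        funext k
        simp only [Fin.init, Function.comp_apply, hS]
        rw [Equiv.swap_apply_of_ne_of_ne]
        · simp [Fin.ext_iff]; omega
        · simp [Fin.ext_iff]; omega
      set p := u (Fin.castSucc (Fin.last m))
      set q := u (Fin.last (m + 1))
      have hv : ∀ b b' : Fin d, lastComponent b' (lastComponent b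
          (permSites (Fin.castSucc (Fin.last m)) (Fin.last (m + 1))
            (rMatrix N (Fin.castSucc (Fin.last m)) (Fin.last (m + 1)) (p - q) g))) =
          rb N (p - q) • lastComponent b (lastComponent b' g) +
          rc N (p - q) • lastComponent b' (lastComponent b g) := by
        intro b b'
        funext γ
        simp only [Pi.add_apply, Pi.smul_apply, smul_eq_mul, lastComponent_apply, permSites_apply,
          rMatrix_apply, ← hS, hw]
      have hadd : ∀ g g' : TensorSpace d m, betheVector N x (Fin.init (Fin.init u)) (g + g') =
          betheVector N x (Fin.init (Fin.init u)) g + betheVector N x (Fin.init (Fin.init u)) g' := by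
        intro g g'
        simp [betheVector, add_smul, Finset.sum_add_distrib]
      simp only [betheVector_succ, h1, h2, h2', h3, hv, hadd, betheVector_smul, map_sum, map_add,
        map_smul, Finset.sum_add_distrib]
      -- In the `b` part the two colours are attached in the opposite order; renaming them makes the
      -- identity hold summand by summand.
      nth_rewrite 1 [Finset.sum_comm]
      simp only [← Finset.sum_add_distrib]
      refine Finset.sum_congr rfl fun b _ => Finset.sum_congr rfl fun b' _ => ?_
      exact monodromyEntry_zero_exchange x hu (fun i => hxu i _) (fun i => hxu i _) _ _ _
    · have hsn : ∀ (b : Fin d) (γ : Fin m → Fin d) (p q : Fin m),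
          (Fin.snoc γ b : Fin (m + 1) → Fin d) ∘ Equiv.swap p.castSucc q.castSucc =
            (Fin.snoc (γ ∘ Equiv.swap p q) b : Fin (m + 1) → Fin d) := by
        intro b γ p q
        have := insertNth_comp_swap (Fin.last m) b γ p q
        simpa using this
      have hv : ∀ b : Fin d, lastComponent b (permSites i.castSucc j.castSucc
          (rMatrix N i.castSucc j.castSucc (u i.castSucc - u j.castSucc) g)) =
            permSites i j (rMatrix N i j (u i.castSucc - u j.castSucc) (lastComponent b g)) := by
        intro b
        funext γ
        simp only [lastComponent_apply, permSites_apply, rMatrix_apply, hsn]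
      have h1 : (u ∘ Equiv.swap i.castSucc j.castSucc) (Fin.last m) = u (Fin.last m) := by
        simp [Equiv.swap_apply_of_ne_of_ne, (Fin.castSucc_ne_last _).symm]
      have h2 : Fin.init (u ∘ Equiv.swap i.castSucc j.castSucc) = Fin.init u ∘ Equiv.swap i j := by
        funext k
        simp only [Fin.init, Function.comp_apply]
        rw [(Fin.castSucc_injective m).swap_apply]
      rw [betheVector_succ, betheVector_succ, h1, h2]
      refine Finset.sum_congr rfl fun b _ => ?_
      rw [hv]
      congr 1
      exact ih (Fin.init u) (fun i j => hxu i _) i j (by simpa using hij) hu _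

/-- `f` is compatible at `u` with the exchange of neighbouring arguments. -/
def ExchangeAt (N : ℕ) {d m : ℕ} (f : (Fin m → ℂ) → TensorSpace d m) (u : Fin m → ℂ) : Prop :=
  ∀ i j : Fin m, (j : ℕ) = i + 1 → u i - u j ≠ 2 / N →
    f (u ∘ Equiv.swap i j) = permSites i j (rMatrix N i j (u i - u j) (f u))

/-- Adjacent transpositions generate the symmetric group. They multiply on the right because `u ∘ (π
* s) = (u ∘ π) ∘ s`. -/
theorem perm_induction_adjacent {m : ℕ} {p : Equiv.Perm (Fin m) → Prop} (h1 : p 1)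
    (hs : ∀ π, ∀ i j : Fin m, (j : ℕ) = i + 1 → p π → p (π * Equiv.swap i j)) (π) : p π := by
  cases m with
  | zero => rwa [Subsingleton.elim π 1]
  | succ m =>
    have hπ : π ∈ Submonoid.closure (Set.range fun i : Fin m => Equiv.swap i.castSucc i.succ) := by
      rw [Equiv.Perm.mclosure_swap_castSucc_succ]
      trivial
    induction hπ using Submonoid.closure_induction_right with
    | one => exact h1
    | mul_right x hx y hy ih =>
      obtain ⟨i, rfl⟩ := hy
      exact hs x _ _ (by simp) ih

/-- A Bethe vector formed with a function that is compatible with exchanges is symmetric. -/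
theorem betheVector_comp_perm {N d n m : ℕ} (x : Fin n → ℂ) (u : Fin m → ℂ)
    (hxu : ∀ i j, x i - u j ≠ 2 / N) (huu : ∀ i j, i ≠ j → u i - u j ≠ 2 / N)
    (f : (Fin m → ℂ) → TensorSpace d m) (hf : ∀ π : Equiv.Perm (Fin m), ExchangeAt N f (u ∘ π))
    (π : Equiv.Perm (Fin m)) :
    betheVector N x (u ∘ π) (f (u ∘ π)) = betheVector N x u (f u) := by
  induction π using perm_induction_adjacent with
  | h1 => rfl
  | hs π i j hij ih =>
    rw [← ih]
    have hne : u (π i) - u (π j) ≠ 2 / N :=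
      huu _ _ fun h => by have := π.injective h; rw [this] at hij; omega
    have h := hf π i j hij hne
    have e : u ∘ (π * Equiv.swap i j : Equiv.Perm (Fin m)) = (u ∘ π) ∘ Equiv.swap i j := rfl
    rw [e, h]
    exact betheVector_comp_swap x (u ∘ π) (fun _ _ => hxu _ _) i j hij hne _

/-! ### Appending a quantum space -/

/-- The exchange term of the last R-matrix leaves the ingoing auxiliary colour in the last space.
For the operators `B` this is never the first colour, so only the factors `b` survive. -/
theorem lastComponent_zero_betheVector (N : ℕ) {d n m : ℕ} (x : Fin (n + 1) → ℂ) (u : Fin m → ℂ)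
    (g : TensorSpace d m) :
    lastComponent 0 (betheVector N x u g) =
      (∏ j, rb N (x (Fin.last n) - u j)) • betheVector N (Fin.init x) u g := by
  induction m with
  | zero => simp [betheVector_zero, lastComponent_refState]
  | succ m ih =>
    rw [betheVector_succ, betheVector_succ, map_sum, Finset.smul_sum]
    refine Finset.sum_congr rfl fun b _ => ?_
    rw [lastComponent_monodromyEntry, if_neg (Fin.succ_ne_zero b).symm, smul_zero, add_zero, ih,
      map_smul, smul_smul, Fin.prod_univ_castSucc, mul_comm]
    rfl

/-- The contraction of the last quantum space with the row of index `0` of the monodromy matrix. -/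
theorem sum_monodromyEntry_lastComponent_betheVector {N d n m : ℕ} (x : Fin (n + 1) → ℂ)
    (u : Fin m → ℂ) (hxx : ∀ i, Fin.init x i - x (Fin.last n) ≠ 2 / N)
    (hxu : ∀ i j, x i - u j ≠ 2 / N) (g : TensorSpace d m) :
    ∑ γ, monodromyEntry N (Fin.init x) (x (Fin.last n)) 0 γ
      (lastComponent γ (betheVector N x u g)) = betheVector N (Fin.init x) u g := by
  induction m with
  | zero =>
    simp only [betheVector_zero, map_smul, lastComponent_refState]
    rw [Finset.sum_eq_single 0 (by intro b _ hb; simp [hb]) (by simp), if_pos rfl,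
      monodromyEntry_refState_zero _ hxx]
  | succ m ih =>
    rw [betheVector_succ, betheVector_succ]
    simp only [map_sum]
    rw [Finset.sum_comm]
    refine Finset.sum_congr rfl fun b _ => ?_
    rw [← ih (Fin.init u) (fun _ _ => hxu _ _) (lastComponent b g), map_sum]
    -- The exchange term occurs only for `γ = b.succ`. With the direct term it forms the left side
    -- of `monodromyEntry_zero_exchange`, which carries the contracted row past `B`.
    simp only [lastComponent_monodromyEntry, map_add, map_smul, Finset.sum_add_distrib]
    rw [Finset.sum_eq_single b.succ (f := fun γ => rc N (x (Fin.last n) - u (Fin.last m)) • _)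
      (by intro c _ hc; simp [hc]) (by simp), if_pos rfl, map_sum, Finset.smul_sum,
      ← Finset.sum_add_distrib]
    refine Finset.sum_congr rfl fun γ _ => ?_
    exact monodromyEntry_zero_exchange _ (hxu _ _) hxx (fun _ => hxu _ _) _ _ _

/-- Evaluation at the point where the argument of the last quantum space is the last parameter. -/
theorem lastComponent_succ_betheVector_of_eq {N d n m : ℕ} (hN : N ≠ 0) (x : Fin (n + 1) → ℂ)
    (u : Fin (m + 1) → ℂ) (hx : x (Fin.last n) = u (Fin.last m))
    (hxu : ∀ (i : Fin n) j, x i.castSucc - u j ≠ 2 / N) (hu : ∀ j, u (Fin.last m) - u j ≠ 2 / N)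
    (α : Fin d) (g : TensorSpace d (m + 1)) :
    lastComponent α.succ (betheVector N x u g) =
      betheVector N (Fin.init x) (Fin.init u) (lastComponent α g) := by
  -- At argument 0 the R-matrix is the permutation, so the outermost `B` deposits its own colour in
  -- the last space: only the colour `α` contributes.
  rw [betheVector_succ, map_sum, Finset.sum_eq_single α]
  · rw [lastComponent_monodromyEntry, hx, sub_self, rb_zero, rc_zero hN, zero_smul, zero_add,
      one_smul, if_pos rfl, ← hx]
    refine sum_monodromyEntry_lastComponent_betheVector x (Fin.init u) ?_ ?_ _
    · intro i
      rw [hx]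
      exact hxu i _
    · intro i j
      refine Fin.lastCases ?_ (fun i => ?_) i
      · rw [hx]
        exact hu _
      · exact hxu _ _
  · intro b _ hb
    rw [lastComponent_monodromyEntry, hx, sub_self, rb_zero, zero_smul, zero_add,
      if_neg (by simpa using hb.symm), smul_zero]
  · simp

/-! ### Prepending a quantum space -/

/-- Here the outgoing auxiliary colour and the colour of the split-off space agree, so the direct
and the exchange term coincide and `b + c = 1`. Unlike the last space, the first one contributes no
factor. -/
theorem auxComponent_zero_betheVector {N d n m : ℕ} (x : Fin (n + 1) → ℂ) (u : Fin m → ℂ)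
    (hxu : ∀ j, x 0 - u j ≠ 2 / N) (g : TensorSpace d m) :
    auxComponent 0 (betheVector N x u g) = betheVector N (Fin.tail x) u g := by
  induction m with
  | zero => simp [betheVector_zero, refState_cons]
  | succ m ih =>
    rw [betheVector_succ, betheVector_succ, map_sum]
    refine Finset.sum_congr rfl fun b _ => ?_
    rw [auxComponent_monodromyEntry, ih (Fin.init u) (fun _ => hxu _), ← add_smul, rb_add_rc (hxu _), one_smul]

/-! ### Vectors depending polynomially on a parameter -/

/-- All components of the vector valued function `v` are polynomials of degree less than `k`. -/
def PolyVec {d n : ℕ} (k : ℕ) (v : ℂ → TensorSpace d n) : Prop :=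
  ∀ δ, ∃ p : Polynomial ℂ, p.degree < k ∧ ∀ s, v s δ = p.eval s

namespace PolyVec

variable {d n k : ℕ} {v w : ℂ → TensorSpace d n}

theorem zero (k : ℕ) : PolyVec k (fun _ => (0 : TensorSpace d n)) := fun _ =>
  ⟨0, by simp, fun s => by simp⟩

theorem add (hv : PolyVec k v) (hw : PolyVec k w) : PolyVec k (fun s => v s + w s) := fun δ => by
  obtain ⟨p, hp, hp'⟩ := hv δ
  obtain ⟨q, hq, hq'⟩ := hw δ
  exact ⟨p + q, (Polynomial.degree_add_le p q).trans_lt (max_lt hp hq), fun s => by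
    simp [hp', hq']⟩

theorem sum {ι : Type*} (t : Finset ι) {v : ι → ℂ → TensorSpace d n}
    (hv : ∀ i, PolyVec k (v i)) : PolyVec k (fun s => ∑ i ∈ t, v i s) := by
  classical
  induction t using Finset.induction_on with
  | empty => simpa using zero k
  | insert i t hi ih => simpa [Finset.sum_insert hi] using (hv i).add ih

theorem mul_poly (hv : PolyVec k v) (q : Polynomial ℂ) {l k' : ℕ} (hq : q.degree ≤ l)
    (hk : l + k ≤ k') : PolyVec k' (fun s => q.eval s • v s) := fun δ => by
  obtain ⟨p, hp, hp'⟩ := hv δ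
  refine ⟨q * p, ?_, fun s => by simp [hp']⟩
  by_cases h0 : p = 0
  · simp [h0]
  by_cases h1 : q = 0
  · simp [h1]
  rw [Polynomial.degree_mul, Polynomial.degree_eq_natDegree h0, Polynomial.degree_eq_natDegree h1]
  rw [Polynomial.degree_eq_natDegree h0] at hp
  rw [Polynomial.degree_eq_natDegree h1] at hq
  norm_cast at *
  omega

theorem const_smul (hv : PolyVec k v) (c : ℂ) : PolyVec k (fun s => c • v s) := by
  simpa using hv.mul_poly (Polynomial.C c) (l := 0) Polynomial.degree_C_le (by simp)

theorem sub_smul (hv : PolyVec k v) (t : ℂ) : PolyVec (k + 1) (fun s => (s - t) • v s) := by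
  simpa using hv.mul_poly (Polynomial.X - Polynomial.C t) (l := 1)
    (Polynomial.degree_X_sub_C_le t) (by omega)

theorem const (v : TensorSpace d n) : PolyVec 1 (fun _ => v) := fun δ =>
  ⟨Polynomial.C (v δ), Polynomial.degree_C_le.trans_lt (by norm_num), fun s => by simp⟩

theorem prod_smul {m : ℕ} (u : Fin m → ℂ) (v : TensorSpace d n) :
    PolyVec (m + 1) (fun s => (∏ j, (s - u j)) • v) := by
  obtain ⟨q, hq, hq'⟩ : ∃ q : Polynomial ℂ, q.degree ≤ m ∧ ∀ s, q.eval s = ∏ j, (s - u j) :=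
    ⟨∏ j, (Polynomial.X - Polynomial.C (u j)), (Polynomial.degree_prod_le _ _).trans (by simp),
      fun s => by rw [Polynomial.eval_prod]; simp⟩
  simpa only [hq'] using (const v).mul_poly q hq le_rfl

theorem map {d' n' : ℕ} (hv : PolyVec k v) (f : TensorSpace d n →ₗ[ℂ] TensorSpace d' n') :
    PolyVec k (fun s => f (v s)) := by
  have h : ∀ s, f (v s) = ∑ δ, v s δ • f (Pi.single δ 1) := fun s => by
    conv_lhs => rw [← Finset.univ_sum_single (v s)]
    rw [map_sum]
    refine Finset.sum_congr rfl fun δ _ => ?_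
    rw [← map_smul, ← Pi.single_smul, smul_eq_mul, mul_one]
  simp only [h]
  refine sum _ fun δ ε => ?_
  obtain ⟨p, hp, hp'⟩ := hv δ
  refine ⟨p * Polynomial.C (f (Pi.single δ 1) ε), ?_, fun s => by simp [hp']⟩
  by_cases h0 : f (Pi.single δ 1) ε = 0
  · simp [h0]
  · rwa [Polynomial.degree_mul_C h0]

theorem eq_of_eqOn_compl_finite (hv : PolyVec k v) (hw : PolyVec k w) {S : Set ℂ} (hS : S.Finite)
    (h : ∀ s ∉ S, v s = w s) : v = w := by
  funext s δ
  obtain ⟨p, -, hp⟩ := hv δ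
  obtain ⟨q, -, hq⟩ := hw δ
  rw [hp, hq, Polynomial.eq_of_infinite_eval_eq p q]
  refine hS.infinite_compl.mono fun t ht => ?_
  change p.eval t = q.eval t
  rw [← hp, ← hq, h t ht]

/-- Lagrange interpolation. -/
theorem eq_interpolate {m : ℕ} {v : ℂ → TensorSpace d n} (hv : PolyVec m v) (t : Fin m → ℂ)
    (ht : Function.Injective t) (s : ℂ) :
    v s = ∑ j, (∏ i ∈ Finset.univ.erase j, (s - t i) / (t j - t i)) • v (t j) := by
  funext δ
  obtain ⟨p, hp, hp'⟩ := hv δ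
  have h := Lagrange.eq_interpolate (s := Finset.univ) (v := t) (f := p) ht.injOn
    (by simpa using hp)
  rw [hp', h, Finset.sum_apply, Lagrange.interpolate_apply, Polynomial.eval_finsetSum]
  refine Finset.sum_congr rfl fun j _ => ?_
  rw [Pi.smul_apply, hp', Polynomial.eval_mul, Polynomial.eval_C, smul_eq_mul, mul_comm,
    Lagrange.basis, Polynomial.eval_prod]
  congr 1
  refine Finset.prod_congr rfl fun i _ => ?_
  simp [Lagrange.basisDivisor, div_eq_mul_inv, mul_comm]

end PolyVec

/-! ### Expansion of components by interpolation -/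

theorem mul_rb {N : ℕ} {z : ℂ} (h : z ≠ 2 / N) : (z - 2 / N) * rb N z = z := by
  have : z - 2 / N ≠ 0 := sub_ne_zero.2 h
  unfold rb
  field_simp

theorem mul_rc {N : ℕ} {z : ℂ} (h : z ≠ 2 / N) : (z - 2 / N) * rc N z = -2 / N := by
  have : z - 2 / N ≠ 0 := sub_ne_zero.2 h
  unfold rc
  field_simp

theorem prod_mul_prod_rb {N m : ℕ} (u : Fin m → ℂ) {s : ℂ} (h : ∀ j, s - u j ≠ 2 / N) :
    (∏ j, (s - u j - 2 / N)) * ∏ j, rb N (s - u j) = ∏ j, (s - u j) := by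
  rw [← Finset.prod_mul_distrib]
  exact Finset.prod_congr rfl fun j _ => mul_rb (h j)

/-- A colour `α > 1` reaches the last space only through an exchange term, and the numerator of `c`
is constant. This lowers the degree below `m`, so that the `m` nodes `u j` determine the polynomial.
-/
theorem exists_polyVec_lastComponent (N : ℕ) {d n m : ℕ} (y : Fin n → ℂ) (u : Fin m → ℂ)
    (g : TensorSpace d m) :
    ∃ v : Fin d → ℂ → TensorSpace (d + 1) n, (∀ α, PolyVec m (v α)) ∧
      ∀ s, (∀ j, s - u j ≠ 2 / N) → ∀ α, (∏ j, (s - u j - 2 / N)) •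
        lastComponent α.succ (betheVector N (Fin.snoc y s : Fin (n + 1) → ℂ) u g) = v α s := by
  induction m with
  | zero =>
    exact ⟨fun _ _ => 0, fun _ => PolyVec.zero 0, fun s _ α => by
      simp [betheVector_zero, lastComponent_refState]⟩
  | succ m ih =>
    choose v hv hv' using fun b : Fin d => ih (Fin.init u) (lastComponent b g)
    set E := fun β => monodromyEntry N y (u (Fin.last m)) (0 : Fin (d + 1)) β with hE
    refine ⟨fun α s => (-2 / N : ℂ) • ((∏ j, (s - Fin.init u j)) •
        E 0 (betheVector N y (Fin.init u) (lastComponent α g))) +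
        ((s - u (Fin.last m)) • ∑ b, E b.succ (v b α s) +
        (-2 / N : ℂ) • ∑ γ, E γ.succ (v α γ s)), fun α => ?_, fun s hs α => ?_⟩
    · refine ((PolyVec.prod_smul _ _).const_smul _).add (PolyVec.add ?_ ?_)
      · exact (PolyVec.sum _ fun b => (hv b α).map _).sub_smul _
      · refine PolyVec.const_smul (PolyVec.sum _ fun γ => ?_) _
        simpa using ((hv α γ).map (E γ.succ)).mul_poly 1 (l := 1) (k' := m + 1) (by simp) (by omega)
    · have hs' : ∀ j, s - Fin.init u j ≠ 2 / N := fun j => hs _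
      simp only [← hv' _ s hs']
      rw [betheVector_succ, map_sum]
      simp only [lastComponent_monodromyEntry, Fin.init_snoc, Fin.snoc_last, Fin.succ_inj,
        Finset.sum_add_distrib, Fin.sum_univ_succ, lastComponent_zero_betheVector]
      rw [Finset.sum_eq_single α (f := fun b => rc N _ • _)
        (by intro b _ hb; simp [hb.symm]) (by simp), if_pos rfl, Fin.prod_univ_castSucc]
      have e1 := mul_rb (hs (Fin.last m))
      have e2 := mul_rc (hs (Fin.last m))
      have e3 := prod_mul_prod_rb (Fin.init u) hs'
      change ((∏ j, (s - Fin.init u j - 2 / N)) * _) • _ = _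
      rw [← e3, ← e2]
      conv_rhs => enter [2, 1, 1]; rw [← e1]
      simp only [smul_add, map_smul, Finset.smul_sum, smul_smul, hE]
      refine (add_left_comm _ _ _).trans (congrArg₂ _ (congrArg₂ _ (by ring) rfl) ?_)
      refine congrArg₂ _ (Finset.sum_congr rfl fun b _ => congrArg₂ _ (by ring) rfl)
        (Finset.sum_congr rfl fun b _ => congrArg₂ _ (by ring) rfl)

/-- The components of a Bethe vector that carry a colour `α > 1` in the last quantum space, in terms
of Bethe vectors of the remaining quantum spaces. -/
theorem lastComponent_succ_betheVector {N d n m : ℕ} (hN : N ≠ 0) (y : Fin n → ℂ) (s : ℂ)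
    (u : Fin (m + 1) → ℂ) (hu : Function.Injective u)
    (huu : ∀ i j, i ≠ j → u i - u j ≠ 2 / N) (hyu : ∀ i j, y i - u j ≠ 2 / N)
    (hsu : ∀ j, s - u j ≠ 2 / N)
    (f : (Fin (m + 1) → ℂ) → TensorSpace d (m + 1))
    (hf : ∀ π : Equiv.Perm (Fin (m + 1)), ExchangeAt N f (u ∘ π))
    (π : Fin (m + 1) → Equiv.Perm (Fin (m + 1))) (hπ : ∀ j, π j (Fin.last m) = j) (α : Fin d) :
    lastComponent α.succ (betheVector N (Fin.snoc y s : Fin (n + 1) → ℂ) u (f u)) =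
      ∑ j, (rc N (s - u j) * ∏ i ∈ Finset.univ.erase j, rb N (s - u i) * (rb N (u j - u i))⁻¹) •
        betheVector N y (Fin.init (u ∘ π j)) (lastComponent α (f (u ∘ π j))) := by
  obtain ⟨v, hv, hv'⟩ := exists_polyVec_lastComponent N y u (f u)
  have ha : (2 / N : ℂ) ≠ 0 := by
    have : (N : ℂ) ≠ 0 := by exact_mod_cast hN
    exact div_ne_zero two_ne_zero this
  have huu' : ∀ i j, u i - u j ≠ 2 / N := fun i j => by
    by_cases h : i = j
    · simpa [h] using ha.symm
    · exact huu i j h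
  have hval : ∀ j, v α (u j) = (∏ i, (u j - u i - 2 / N)) •
      betheVector N y (Fin.init (u ∘ π j)) (lastComponent α (f (u ∘ π j))) := fun j => by
    -- At the node `u j` the symmetry of the Bethe vector allows `u j` to be put last, where
    -- `lastComponent_succ_betheVector_of_eq` evaluates the component.
    rw [← hv' (u j) (huu' j) α]
    have hx : ∀ (i : Fin (n + 1)) k, (Fin.snoc y (u j) : Fin (n + 1) → ℂ) i - u k ≠ 2 / N := by
      intro i k
      refine Fin.lastCases ?_ (fun i => ?_) i
      · simpa using huu' j k
      · simpa using hyu i k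
    rw [← betheVector_comp_perm _ u hx huu f hf (π j), lastComponent_succ_betheVector_of_eq hN]
    · simp
    · simp [hπ]
    · intro i k
      simpa using hyu i _
    · intro k
      exact huu' _ _
  have hD : ∏ j, (s - u j - 2 / N) ≠ 0 := Finset.prod_ne_zero_iff.2 fun j _ => sub_ne_zero.2 (hsu j)
  have h := hv' s hsu α
  rw [(hv α).eq_interpolate u hu s] at h
  rw [← inv_smul_smul₀ hD (lastComponent _ _), h, Finset.smul_sum]
  refine Finset.sum_congr rfl fun j _ => ?_
  rw [hval, smul_smul, smul_smul]
  congr 1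
  rw [← Finset.mul_prod_erase _ _ (Finset.mem_univ j),
    ← Finset.mul_prod_erase _ (fun i => u j - u i - 2 / (N : ℂ)) (Finset.mem_univ j), mul_inv,
    ← Finset.prod_inv_distrib]
  -- The constant numerator of `c` is the diagonal factor of the product in `hval`.
  have hr : rc N (s - u j) = (s - u j - 2 / N)⁻¹ * (u j - u j - 2 / N) := by
    rw [rc]
    ring
  rw [hr]
  have hp : ∏ i ∈ Finset.univ.erase j, rb N (s - u i) * (rb N (u j - u i))⁻¹ =
      (∏ i ∈ Finset.univ.erase j, (s - u i - 2 / N)⁻¹) *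
      (∏ i ∈ Finset.univ.erase j, (s - u i) / (u j - u i)) *
      ∏ i ∈ Finset.univ.erase j, (u j - u i - 2 / N) := by
    rw [← Finset.prod_mul_distrib, ← Finset.prod_mul_distrib]
    refine Finset.prod_congr rfl fun i _ => ?_
    rw [rb, rb, inv_div]
    ring
  rw [hp]
  ring

theorem prod_perm_succ {M : Type*} [CommMonoid M] {m : ℕ} (π : Equiv.Perm (Fin (m + 1)))
    (F : Fin (m + 1) → M) :
    ∏ k : Fin m, F (π k.succ) = ∏ i ∈ Finset.univ.erase (π 0), F i := by
  refine Finset.prod_bij (fun k _ => π k.succ) (fun k _ => by simp) (fun k _ l _ h => by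
    simpa using h) (fun i hi => ?_) (fun _ _ => rfl)
  have hi' : π.symm i ≠ 0 := fun h => (Finset.mem_erase.1 hi).1 (by simp [← h])
  exact ⟨(π.symm i).pred hi', Finset.mem_univ _, by simp⟩

/-- The useful node is now the pole `u 0 + 2 / N`, which belongs to the innermost operator. There
the cleared denominator keeps only the terms in which that operator performs the exchange; it then
acts on the reference state as a diagonal operator `D`, with eigenvalue `∏ b`. -/
theorem exists_polyVec_auxComponent (N : ℕ) {d n m : ℕ} (y : Fin n → ℂ)
    (u : Fin (m + 1) → ℂ) (g : TensorSpace d (m + 1)) :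
    ∃ v : Fin d → ℂ → TensorSpace (d + 1) n, (∀ α, PolyVec (m + 1) (v α)) ∧
      (∀ s, (∀ j, s - u j ≠ 2 / N) → ∀ α, (∏ j, (s - u j - 2 / N)) •
        auxComponent α.succ (betheVector N (Fin.cons s y : Fin (n + 1) → ℂ) u g) = v α s) ∧
      ∀ α, v α (u 0 + 2 / N) =
        ((-2 / N) * (∏ i, rb N (y i - u 0)) * ∏ j : Fin m, (u 0 + 2 / N - u j.succ)) •
          betheVector N y (Fin.tail u) (auxComponent α g) := by
  induction m with
  | zero =>
    refine ⟨fun α s => ((-2 / N) * ∏ i, rb N (y i - u 0)) •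
      (g (Fin.cons α Fin.elim0) • refState (d + 1) n), fun α => PolyVec.const _, fun s hs α => ?_,
      fun α => by simp [betheVector_zero, auxComponent_apply]⟩
    rw [betheVector_succ, map_sum]
    simp only [auxComponent_monodromyEntry, Fin.cons_zero, Fin.tail_cons, betheVector_zero, map_smul,
      refState_cons, if_neg (Fin.succ_ne_zero _), if_true, map_zero, smul_zero, zero_add]
    have hE : ∀ β : Fin d, monodromyEntry N y (u (Fin.last 0)) α.succ β.succ (refState (d + 1) n) =
        if α = β then (∏ i, rb N (y i - u 0)) • refState (d + 1) n else 0 := by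
      intro β
      funext γ
      rw [monodromyEntry_refState_succ]
      by_cases h : α = β <;> simp [h]
    rw [Finset.sum_eq_single α (by
        intro b _ hb
        rw [hE, if_neg hb.symm, smul_zero, smul_zero]) (by simp), hE, if_pos rfl]
    simp only [smul_smul, lastComponent_apply]
    rw [← mul_rc (hs 0)]
    have : (Fin.snoc (Fin.elim0 : Fin 0 → Fin d) α : Fin (0 + 1) → Fin d) =
        Fin.cons α Fin.elim0 := by
      funext i
      obtain rfl : i = 0 := Fin.ext (by omega)
      rfl
    rw [this]
    congr 1
    rw [Fin.prod_univ_succ, Fin.prod_univ_zero]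
    change _ * (_ * (rc N (s - u 0) * _)) = _
    ring
  | succ m ih =>
    choose v hv hv' hv'' using fun b : Fin d => ih (Fin.init u) (lastComponent b g)
    have h0 : Fin.init u 0 = u 0 := rfl
    refine ⟨fun α s => (s - u (Fin.last (m + 1))) •
          ∑ b, monodromyEntry N y (u (Fin.last (m + 1))) 0 b.succ (v b α s) +
        (-2 / N * ∏ j, (s - Fin.init u j - 2 / N)) •
          ∑ b, monodromyEntry N y (u (Fin.last (m + 1))) α.succ b.succ
            (betheVector N y (Fin.init u) (lastComponent b g)), fun α => ?_, fun s hs α => ?_,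
      fun α => ?_⟩
    · refine PolyVec.add ((PolyVec.sum _ fun b => (hv b α).map _).sub_smul _) ?_
      simp only [mul_smul]
      refine PolyVec.const_smul ?_ _
      simpa only [sub_sub] using
        PolyVec.prod_smul (fun j => Fin.init u j + 2 / (N : ℂ)) (_ : TensorSpace (d + 1) n)
    · have hs' : ∀ j, s - Fin.init u j ≠ 2 / N := fun j => hs _
      simp only [← hv' _ s hs']
      rw [betheVector_succ, map_sum]
      simp only [auxComponent_monodromyEntry, Fin.cons_zero, Fin.tail_cons,
        auxComponent_zero_betheVector (Fin.cons s y) (Fin.init u) hs', Finset.sum_add_distrib]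
      rw [Fin.prod_univ_castSucc]
      have e1 := mul_rb (hs (Fin.last (m + 1)))
      have e2 := mul_rc (hs (Fin.last (m + 1)))
      change ((∏ j, (s - Fin.init u j - 2 / N)) * _) • _ = _
      rw [← e2]
      conv_rhs => enter [1, 1]; rw [← e1]
      simp only [smul_add, map_smul, Finset.smul_sum, smul_smul]
      refine congrArg₂ _ (Finset.sum_congr rfl fun b _ => congrArg₂ _ (by ring) rfl)
        (Finset.sum_congr rfl fun b _ => congrArg₂ _ (by ring) rfl)
    -- At the node the terms in which the outermost operator performs the exchange carry a vanishing
    -- factor.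
    · have hz : ∏ j, (u 0 + 2 / N - Fin.init u j - 2 / N) = 0 :=
        Finset.prod_eq_zero (Finset.mem_univ 0) (by rw [h0]; ring)
      have h1 := fun b => hv'' b α
      rw [h0] at h1
      simp only [hz, mul_zero, zero_smul, add_zero, h1, map_smul]
      rw [betheVector_succ, ← Finset.smul_sum, smul_smul, Fin.prod_univ_castSucc]
      congr 1
      · change _ * (_ * ∏ j : Fin m, (u 0 + 2 / N - u j.succ.castSucc)) =
          _ * (_ * (u 0 + 2 / N - u (Fin.last (m + 1))))
        simp only [Fin.succ_castSucc]
        ring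
      · refine Finset.sum_congr rfl fun b _ => ?_
        have : auxComponent α (lastComponent b g) = lastComponent b (auxComponent α g) := by
          funext γ
          simp only [auxComponent_apply, lastComponent_apply, Fin.cons_snoc_eq_snoc_cons]
        rw [this]
        rfl

/-- The components of a Bethe vector that carry a colour `α > 1` in the first quantum space, in terms
of Bethe vectors of the remaining quantum spaces. -/
theorem auxComponent_succ_betheVector {N d n m : ℕ} (y : Fin n → ℂ) (s : ℂ)
    (u : Fin (m + 1) → ℂ) (hu : Function.Injective u)
    (huu : ∀ i j, i ≠ j → u i - u j ≠ 2 / N) (hyu : ∀ i j, y i - u j ≠ 2 / N)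
    (hsu : ∀ j, s - u j ≠ 2 / N)
    (f : (Fin (m + 1) → ℂ) → TensorSpace d (m + 1))
    (hf : ∀ π : Equiv.Perm (Fin (m + 1)), ExchangeAt N f (u ∘ π))
    (π : Fin (m + 1) → Equiv.Perm (Fin (m + 1))) (hπ : ∀ j, π j 0 = j) (α : Fin d) :
    auxComponent α.succ (betheVector N (Fin.cons s y : Fin (n + 1) → ℂ) u (f u)) =
      ∑ j, (rc N (s - u j) * (∏ i, rb N (y i - u j)) *
        ∏ i ∈ Finset.univ.erase j, (rb N (u i - u j))⁻¹) •
        betheVector N y (Fin.tail (u ∘ π j)) (auxComponent α (f (u ∘ π j))) := by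
  obtain ⟨v, hv, hv', -⟩ := exists_polyVec_auxComponent N y u (f u)
  have hval : ∀ j, v α (u j + 2 / N) =
      ((-2 / N) * (∏ i, rb N (y i - u j)) * ∏ i ∈ Finset.univ.erase j, (u j + 2 / N - u i)) •
      betheVector N y (Fin.tail (u ∘ π j)) (auxComponent α (f (u ∘ π j))) := fun j => by
    obtain ⟨w, hw, hw', hw''⟩ := exists_polyVec_auxComponent N y (u ∘ π j) (f (u ∘ π j))
    -- The node is a pole, where the component itself gives no information. The polynomials for `u`
    -- and `u ∘ π j` agree off the poles by the symmetry of Bethe vectors, hence everywhere, and the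
    -- second one has an explicit value at the node.
    have hvw : v α = w α := by
      refine (hv α).eq_of_eqOn_compl_finite (hw α)
        (S := Set.range fun k => u k + 2 / N) (Set.finite_range _) fun t ht => ?_
      have ht' : ∀ k, t - u k ≠ 2 / N := fun k hk => ht ⟨k, by rw [← hk]; ring⟩
      rw [← hv' t ht' α, ← hw' t (fun k => ht' _) α, betheVector_comp_perm _ u _ huu f hf (π j)]
      · congr 1
        exact (Equiv.prod_comp (π j) fun k => t - u k - 2 / (N : ℂ)).symm
      · intro i k
        refine Fin.cases ?_ (fun i => ?_) i
        · simpa using ht' k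
        · simpa using hyu i k
    have h := hw'' α
    rw [← hvw] at h
    simp only [Function.comp_apply, hπ] at h
    rw [h]
    rw [prod_perm_succ (π j) fun k => u j + 2 / (N : ℂ) - u k, hπ]
  have hD : ∏ j, (s - u j - 2 / N) ≠ 0 := Finset.prod_ne_zero_iff.2 fun j _ => sub_ne_zero.2 (hsu j)
  have h := hv' s hsu α
  rw [(hv α).eq_interpolate (fun j => u j + 2 / N) (fun i j hij => hu (by simpa using hij)) s] at h
  rw [← inv_smul_smul₀ hD (auxComponent _ _), h, Finset.smul_sum]
  refine Finset.sum_congr rfl fun j _ => ?_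
  rw [hval, smul_smul, smul_smul]
  congr 1
  rw [← Finset.mul_prod_erase _ _ (Finset.mem_univ j), mul_inv, ← Finset.prod_inv_distrib]
  have hr : rc N (s - u j) = (s - u j - 2 / N)⁻¹ * (-2 / N) := by
    rw [rc]
    ring
  rw [hr]
  have hp : ∏ i ∈ Finset.univ.erase j, (rb N (u i - u j))⁻¹ =
      (∏ i ∈ Finset.univ.erase j, (s - u i - 2 / N)⁻¹) *
      (∏ i ∈ Finset.univ.erase j, (s - (u i + 2 / N)) / (u j + 2 / N - (u i + 2 / N))) *
      ∏ i ∈ Finset.univ.erase j, (u j + 2 / N - u i) := by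
    rw [← Finset.prod_mul_distrib, ← Finset.prod_mul_distrib]
    refine Finset.prod_congr rfl fun i hi => ?_
    have h1 : s - u i - 2 / N ≠ 0 := sub_ne_zero.2 (hsu i)
    have h2 : u j - u i ≠ 0 := sub_ne_zero.2 fun h => (Finset.mem_erase.1 hi).1 (hu h).symm
    have h2' : u i - u j ≠ 0 := sub_ne_zero.2 fun h => (Finset.mem_erase.1 hi).1 (hu h)
    have h3 : s - (u i + 2 / N) = s - u i - 2 / N := by ring
    have h4 : u j + 2 / N - (u i + 2 / N) = u j - u i := by ring
    rw [h3, h4, rb, inv_div, div_eq_iff h2', ← neg_sub (u j) (u i)]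
    generalize hA : s - u i - 2 / (N : ℂ) = A at *
    have h5 : A⁻¹ * (A / (u j - u i)) = (u j - u i)⁻¹ := by field_simp
    rw [h5]
    linear_combination (u j + 2 / N - u i) * inv_mul_cancel₀ h2
  rw [hp]
  ring

/-! ### The difference equations of `ψ` and `τ` at regular points -/

/-- A meromorphic identity extends to every point where both sides are continuous, by uniqueness of
limits. `S` absorbs the points lost in clearing denominators. -/
theorem eq_of_eventually_codiscrete {g h : ℂ → ℂ} {z : ℂ} (hg : ContinuousAt g z)
    (hh : ContinuousAt h z) (S : Finset ℂ)
    (H : ∀ᶠ w in Filter.codiscrete ℂ, w ∉ S → g w = h w) : g z = h z := by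
  have h1 : ∀ᶠ w in nhdsWithin z {z}ᶜ, w ∉ S → g w = h w := by
    have := mem_codiscrete.1 H z
    rwa [Filter.disjoint_principal_right, compl_compl] at this
  have h2 : ∀ᶠ w in nhdsWithin z {z}ᶜ, w ∉ S := by
    have h3 : ∀ᶠ w in nhdsWithin z {z}ᶜ, w ∉ S.erase z := by
      refine Filter.Eventually.filter_mono nhdsWithin_le_nhds ?_
      exact (S.erase z).finite_toSet.isClosed.isOpen_compl.mem_nhds (by simp)
    filter_upwards [h3, self_mem_nhdsWithin] with w hw hw' hS
    exact hw (Finset.mem_erase.2 ⟨hw', hS⟩)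
  refine tendsto_nhds_unique_of_eventuallyEq (hg.tendsto.mono_left nhdsWithin_le_nhds)
    (hh.tendsto.mono_left nhdsWithin_le_nhds) (f := g) (g := h) (l := nhdsWithin z {z}ᶜ) ?_
  filter_upwards [h1, h2] with w hw hw' using hw hw'

theorem IsPsi.eqn_apply {N : ℕ} {ψ : ℂ → ℂ} (hψ : IsPsi N ψ) {z : ℂ} (hz : z ≠ 2 / N)
    (h1 : AnalyticAt ℂ ψ z) (h2 : AnalyticAt ℂ ψ (z - 2)) : rb N z * ψ z = ψ (z - 2) := by
  refine eq_of_eventually_codiscrete (g := fun w => rb N w * ψ w) (h := fun w => ψ (w - 2))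
    ?_ ?_ ∅ (hψ.eqn.mono fun w hw _ => hw)
  · refine ContinuousAt.mul ?_ h1.continuousAt
    unfold rb
    exact continuousAt_id.div (by fun_prop) (sub_ne_zero.2 hz)
  · exact ContinuousAt.comp (f := fun w : ℂ => w - 2) (g := ψ) h2.continuousAt (by fun_prop)

/-- The excluded points are the zeros and poles of `b(w)` and `b(2 - w)`. -/
theorem IsTau.eventually {N : ℕ} {τ : ℂ → ℂ} (hτ : IsTau N τ) :
    ∀ᶠ w in Filter.codiscrete ℂ, w ∉ ({0, 2, (2 / N : ℂ), (2 - 2 / N : ℂ)} : Finset ℂ) →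
      τ w * ((w - 2 / N) * (2 - w)) = τ (w - 2) * ((2 - w - 2 / N) * w) := by
  refine hτ.eqn.mono fun w hw hS => ?_
  simp only [Finset.mem_insert, Finset.mem_singleton, not_or] at hS
  obtain ⟨h0, h2, ha, ha'⟩ := hS
  have h2' : 2 - w ≠ 0 := fun h => h2 (by linear_combination -h)
  have h3 : w - 2 / N ≠ 0 := sub_ne_zero.2 ha
  have h4 : 2 - w - 2 / N ≠ 0 := fun h => ha' (by linear_combination -h)
  have e1 : τ w = τ w / rb N w * rb N w := by
    rw [div_mul_cancel₀]
    exact div_ne_zero h0 h3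
  rw [e1, hw]
  unfold rb
  generalize w - 2 / (N : ℂ) = A at *
  generalize 2 - w - 2 / (N : ℂ) = B at *
  field_simp

theorem IsTau.eqn_apply {N : ℕ} {τ : ℂ → ℂ} (hτ : IsTau N τ) {z : ℂ}
    (h1 : AnalyticAt ℂ τ z) (h2 : AnalyticAt ℂ τ (z - 2)) :
    τ z * ((z - 2 / N) * (2 - z)) = τ (z - 2) * ((2 - z - 2 / N) * z) := by
  refine eq_of_eventually_codiscrete (g := fun w => τ w * ((w - 2 / N) * (2 - w)))
    (h := fun w => τ (w - 2) * ((2 - w - 2 / N) * w)) ?_ ?_ _ hτ.eventually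
  · exact h1.continuousAt.mul (by fun_prop)
  · exact ContinuousAt.mul (ContinuousAt.comp (f := fun w : ℂ => w - 2) (g := τ) h2.continuousAt
      (by fun_prop)) (by fun_prop)

theorem two_div_ne_zero {N : ℕ} (hN : N ≠ 0) : (2 / N : ℂ) ≠ 0 :=
  div_ne_zero two_ne_zero (by exact_mod_cast hN)

theorem IsTau.apply_zero {N : ℕ} (hN : N ≠ 0) {τ : ℂ → ℂ} (hτ : IsTau N τ)
    (h : ∀ p : ℤ, AnalyticAt ℂ τ (2 * p)) : τ 0 = 0 := by
  have := hτ.eqn_apply (z := 0) (by simpa using h 0) (by simpa using h (-1))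
  have ha := two_div_ne_zero hN
  simpa [ha, hN] using this

/-- The equations at `w` and at `w + 2` are uninformative for `w = 0`. Eliminating `τ w` between
them for `w ≠ 0` leaves a common factor `w`; divide by it and let `w` tend to 0. -/
theorem IsTau.apply_two {N : ℕ} (hN : N ≠ 0) {τ : ℂ → ℂ} (hτ : IsTau N τ)
    (h : ∀ p : ℤ, AnalyticAt ℂ τ (2 * p)) (h2 : (2 : ℂ) ≠ 2 / N) : τ 2 = -τ (-2) := by
  have ha := two_div_ne_zero hN
  have hs : ∀ c z : ℂ, AnalyticAt ℂ τ (z + c) → ContinuousAt (fun w => τ (w + c)) z := fun c z h =>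
    ContinuousAt.comp (f := fun w : ℂ => w + c) (g := τ) h.continuousAt (by fun_prop)
  have hw : ∀ᶠ w in nhdsWithin (0 : ℂ) {0}ᶜ,
      τ w * ((w - 2 / N) * (2 - w)) = τ (w - 2) * ((2 - w - 2 / N) * w) := by
    have e := hτ.eventually
    have := mem_codiscrete.1 e 0
    rw [Filter.disjoint_principal_right, compl_compl] at this
    have h3 : ∀ᶠ w in nhdsWithin (0 : ℂ) {0}ᶜ,
        w ∉ ({0, 2, (2 / N : ℂ), (2 - 2 / N : ℂ)} : Finset ℂ).erase 0 := by
      refine Filter.Eventually.filter_mono nhdsWithin_le_nhds ?_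
      exact (Finset.finite_toSet _).isClosed.isOpen_compl.mem_nhds (by simp)
    filter_upwards [this, h3, self_mem_nhdsWithin] with w hw hw1 hw2
    exact hw fun hS => hw1 (Finset.mem_erase.2 ⟨hw2, hS⟩)
  have hw2 : ∀ᶠ w in nhdsWithin (0 : ℂ) {0}ᶜ,
      τ (w + 2) * ((w + 2 - 2 / N) * (2 - (w + 2))) =
        τ (w + 2 - 2) * ((2 - (w + 2) - 2 / N) * (w + 2)) := by
    have e := hτ.eventually
    have := mem_codiscrete.1 e 2
    rw [Filter.disjoint_principal_right, compl_compl] at this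
    have h3 : ∀ᶠ w in nhdsWithin (2 : ℂ) {2}ᶜ,
        w ∉ ({0, 2, (2 / N : ℂ), (2 - 2 / N : ℂ)} : Finset ℂ).erase 2 := by
      refine Filter.Eventually.filter_mono nhdsWithin_le_nhds ?_
      exact (Finset.finite_toSet _).isClosed.isOpen_compl.mem_nhds (by simp)
    have h4 : ∀ᶠ w in nhdsWithin (2 : ℂ) {2}ᶜ,
        τ w * ((w - 2 / N) * (2 - w)) = τ (w - 2) * ((2 - w - 2 / N) * w) := by
      filter_upwards [this, h3, self_mem_nhdsWithin] with w hw hw1 hw2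
      exact hw fun hS => hw1 (Finset.mem_erase.2 ⟨hw2, hS⟩)
    have ht : Filter.Tendsto (fun w : ℂ => w + 2) (nhdsWithin 0 {0}ᶜ) (nhdsWithin 2 {2}ᶜ) := by
      refine tendsto_nhdsWithin_iff.2 ⟨?_, ?_⟩
      · refine Filter.Tendsto.mono_left ?_ nhdsWithin_le_nhds
        have : ContinuousAt (fun w : ℂ => w + 2) 0 := by fun_prop
        simpa [ContinuousAt] using this
      · filter_upwards [self_mem_nhdsWithin] with w hw
        simpa using hw
    exact ht.eventually h4
  have key := tendsto_nhds_unique_of_eventuallyEq (l := nhdsWithin (0 : ℂ) {0}ᶜ)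
    (f := fun w => τ (w + 2) * ((w + 2 - 2 / N) * (w - 2 / N) * (2 - w)))
    (g := fun w => τ (w + -2) * ((2 - w - 2 / N) * (w + 2 / N) * (w + 2)))
    (a := τ (0 + 2) * ((0 + 2 - 2 / N) * (0 - 2 / N) * (2 - 0)))
    (b := τ (0 + -2) * ((2 - 0 - 2 / N) * (0 + 2 / N) * (0 + 2)))
    (((hs 2 0 (by simpa using h 1)).mul (by fun_prop)).tendsto.mono_left nhdsWithin_le_nhds)
    (((hs (-2) 0 (by simpa using h (-1))).mul (by fun_prop)).tendsto.mono_left nhdsWithin_le_nhds)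
    (by
      filter_upwards [hw, hw2, self_mem_nhdsWithin] with w e1 e2 hw0
      rw [add_sub_cancel_right] at e2
      refine mul_left_cancel₀ (show w ≠ 0 from hw0) ?_
      rw [← sub_eq_add_neg]
      linear_combination (-((w - 2 / N) * (2 - w))) * e2 + ((w + 2 / N) * (w + 2)) * e1)
  have h2' : (2 : ℂ) - 2 / N ≠ 0 := sub_ne_zero.2 h2
  simp only [zero_add, sub_zero, zero_sub] at key
  have h5 : (2 - 2 / (N : ℂ)) * (2 / N) * 2 ≠ 0 := mul_ne_zero (mul_ne_zero h2' ha) two_ne_zero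
  refine mul_right_cancel₀ h5 ?_
  linear_combination -key

/-- In the product of the equations at `z` and `2 - z` the polynomial factors are the same on both
sides. They vanish for `z = 0` and `z = 2`, where `τ 0 = 0` settles the claim instead. -/
theorem IsTau.mul_apply {N : ℕ} (hN : N ≠ 0) {τ : ℂ → ℂ} (hτ : IsTau N τ) {z : ℂ}
    (h1 : ∀ p : ℤ, AnalyticAt ℂ τ (z + 2 * p)) (h2 : ∀ p : ℤ, AnalyticAt ℂ τ (-z + 2 * p))
    (hz : z ≠ 2 / N) (hz' : 2 - z ≠ 2 / N) : τ z * τ (2 - z) = τ (z - 2) * τ (-z) := by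
  by_cases h0 : z = 0
  · subst h0
    have := hτ.apply_zero hN (fun p => by simpa using h1 p)
    simp [this]
  by_cases h20 : z = 2
  · subst h20
    have := hτ.apply_zero hN (fun p => by
      have := h1 (p - 1)
      push_cast at this
      rwa [show (2 : ℂ) + 2 * (p - 1) = 2 * p by ring] at this)
    simp [this]
  have e1 := hτ.eqn_apply (z := z) (by simpa using h1 0)
    (by have := h1 (-1); push_cast at this; rwa [show z + 2 * -1 = z - 2 by ring] at this)
  have e2 := hτ.eqn_apply (z := 2 - z)
    (by have := h2 1; push_cast at this; rwa [show -z + 2 * 1 = 2 - z by ring] at this)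
    (by have := h2 0; push_cast at this; rwa [show -z + 2 * 0 = 2 - z - 2 by ring] at this)
  have hA : (z - 2 / N) * (2 - z) ≠ 0 :=
    mul_ne_zero (sub_ne_zero.2 hz) (sub_ne_zero.2 fun h => h20 h.symm)
  have hB : (2 - z - 2 / N) * z ≠ 0 := mul_ne_zero (sub_ne_zero.2 hz') h0
  rw [show 2 - z - 2 = -z by ring, show 2 - (2 - z) = z by ring] at e2
  refine mul_right_cancel₀ (mul_ne_zero hA hB) ?_
  linear_combination (τ (2 - z) * ((2 - z - 2 / N) * z)) * e1 +
    (τ (z - 2) * ((2 - z - 2 / N) * z)) * e2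

/-! ### Products over pairs -/

theorem prod_pairs_insert {ι : Type*} [LinearOrder ι] (h : ι → ι → ℂ) (hh : ∀ k l, h k l = h l k)
    (S : Finset ι) {j : ι} (hj : j ∉ S) :
    ∏ k ∈ insert j S, ∏ l ∈ insert j S with k < l, h k l =
      (∏ k ∈ S, h k j) * ∏ k ∈ S, ∏ l ∈ S with k < l, h k l := by
  rw [Finset.prod_insert hj, Finset.filter_insert, if_neg (lt_irrefl j), Finset.prod_filter]
  have : ∀ k ∈ S, ∏ l ∈ insert j S with k < l, h k l =
      (if k < j then h k j else 1) * ∏ l ∈ S with k < l, h k l := by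
    intro k _
    rw [Finset.filter_insert]
    split_ifs with hk
    · rw [Finset.prod_insert (by simp [hj])]
    · rw [one_mul]
  rw [Finset.prod_congr rfl this, Finset.prod_mul_distrib, ← mul_assoc, ← Finset.prod_mul_distrib]
  congr 1
  refine Finset.prod_congr rfl fun k hk => ?_
  rcases lt_trichotomy k j with hkj | rfl | hkj
  · simp [hkj, hkj.not_gt]
  · exact absurd hk hj
  · simp [hkj, hkj.not_gt, hh j k]

/-- The product of `τ` over the differences of the components of `u`. -/
def tauProd (τ : ℂ → ℂ) {m : ℕ} (u : Fin m → ℂ) : ℂ := ∏ i, ∏ j ∈ Finset.Ioi i, τ (u i - u j)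

/-- The factor of `tauProd` that belongs to the unordered pair of `k` and `l`. -/
def tauPair (τ : ℂ → ℂ) {m : ℕ} (u : Fin m → ℂ) (k l : Fin m) : ℂ :=
  if k < l then τ (u k - u l) else τ (u l - u k)

theorem tauPair_comm (τ : ℂ → ℂ) {m : ℕ} (u : Fin m → ℂ) (k l : Fin m) :
    tauPair τ u k l = tauPair τ u l k := by
  unfold tauPair
  rcases lt_trichotomy k l with h | rfl | h
  · simp [h, h.not_gt]
  · rfl
  · simp [h, h.not_gt]

theorem tauProd_eq_prod_pairs (τ : ℂ → ℂ) {m : ℕ} (u : Fin m → ℂ) :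
    tauProd τ u = ∏ k, ∏ l with k < l, tauPair τ u k l := by
  refine Finset.prod_congr rfl fun k _ => ?_
  rw [show Finset.Ioi k = Finset.univ.filter (k < ·) by ext; simp]
  refine Finset.prod_congr rfl fun l hl => ?_
  simp [tauPair, (Finset.mem_filter.1 hl).2]

theorem tauProd_eq (τ : ℂ → ℂ) {m : ℕ} (u : Fin m → ℂ) (j : Fin m) :
    tauProd τ u = (∏ k ∈ Finset.univ.erase j, tauPair τ u k j) *
      ∏ k ∈ Finset.univ.erase j, ∏ l ∈ Finset.univ.erase j with k < l, tauPair τ u k l := by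
  rw [tauProd_eq_prod_pairs, ← prod_pairs_insert _ (tauPair_comm τ u) _ (Finset.notMem_erase j _),
    Finset.insert_erase (Finset.mem_univ j)]

theorem tauProd_eq_zero {N : ℕ} (hN : N ≠ 0) {τ : ℂ → ℂ} (hτ : IsTau N τ) {m : ℕ} {u : Fin m → ℂ}
    (hu : RegularWithin N τ u) (h : ¬ Function.Injective u) : tauProd τ u = 0 := by
  obtain ⟨i, j, hij, hlt⟩ : ∃ i j, u i = u j ∧ i < j := by
    simp only [Function.Injective, not_forall] at h
    obtain ⟨i, j, hij, hne⟩ := h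
    rcases lt_or_gt_of_ne hne with h | h
    · exact ⟨i, j, hij, h⟩
    · exact ⟨j, i, hij.symm, h⟩
  refine Finset.prod_eq_zero (Finset.mem_univ i) (Finset.prod_eq_zero (Finset.mem_Ioi.2 hlt) ?_)
  rw [hij, sub_self]
  exact hτ.apply_zero hN fun p => by simpa [hij] using (hu i j p).2 hlt

/-- If `k` does not lie between `i` and `j`, the two factors merely trade places. If it does, the
arguments of `τ` have opposite orientations and `IsTau.mul_apply` is needed. -/
theorem tauPair_update_mul {N : ℕ} (hN : N ≠ 0) {τ : ℂ → ℂ} (hτ : IsTau N τ) {m : ℕ}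
    {u : Fin m → ℂ} (hu : RegularWithin N τ u) {i j : Fin m} (hlt : i < j) (hij : u i = u j)
    {e : ℂ} (he : e = 2 ∨ e = -2) {k : Fin m} (hki : k ≠ i) (hkj : k ≠ j) :
    tauPair τ (Function.update u i (u i + e)) k j * tauPair τ (Function.update u i (u i + e)) k i =
      tauPair τ (Function.update u j (u j + e)) k j *
        tauPair τ (Function.update u j (u j + e)) k i := by
  have hne := hlt.ne
  simp only [tauPair, Function.update_self, Function.update_of_ne hne,
    Function.update_of_ne hne.symm, Function.update_of_ne hki, Function.update_of_ne hkj, hij]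
  rcases lt_or_gt_of_ne hki with h1 | h1
  · simp [h1, h1.trans hlt, mul_comm]
  rcases lt_or_gt_of_ne hkj with h2 | h2
  · simp only [h1.not_gt, h2, if_true, if_false]
    have r1 := fun p => (hu i k p).2 h1
    have r2 := fun p => (hu k j p).2 h2
    have r3 := fun p => (hu i k p).1 hki.symm
    have r4 := fun p => (hu k j p).1 hkj
    rw [hij] at r1 r3
    have r5 : ∀ q : ℂ, ∀ p : ℤ, (q = u k - u j + 2 * p → AnalyticAt ℂ τ q ∧ q ≠ 2 / N) := by
      rintro q p rfl
      exact ⟨r2 p, r4 p⟩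
    have r6 : ∀ q : ℂ, ∀ p : ℤ, (q = u j - u k + 2 * p → AnalyticAt ℂ τ q ∧ q ≠ 2 / N) := by
      rintro q p rfl
      exact ⟨r1 p, r3 p⟩
    rcases he with rfl | rfl
    · have := hτ.mul_apply hN (z := u k - u j) r2
        (fun p => (r6 _ p (by ring)).1) (r5 _ 0 (by simp)).2 (r6 _ 1 (by push_cast; ring)).2
      rw [show u j + 2 - u k = 2 - (u k - u j) by ring, this]
      rw [show u k - (u j + 2) = u k - u j - 2 by ring, neg_sub]
    · have := hτ.mul_apply hN (z := u k - u j + 2)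
        (fun p => (r5 _ (1 + p) (by push_cast; ring)).1)
        (fun p => (r6 _ (p - 1) (by push_cast; ring)).1) (r5 _ 1 (by simp)).2
        (r6 _ 0 (by push_cast; ring)).2
      rw [show 2 - (u k - u j + 2) = u j - u k by ring,
        show -(u k - u j + 2) = u j + -2 - u k by ring,
        show u k - u j + 2 - 2 = u k - u j by ring] at this
      rw [← this]
      congr 2
      ring
  · simp [h1.not_gt, h2.not_gt, mul_comm]

/-- The sign comes from the pair `i`, `j` alone, through `τ 2 = -τ (-2)`; the pairs with one other
index match jointly, and the remaining pairs are not touched. -/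
theorem tauProd_update_of_lt {N : ℕ} (hN : N ≠ 0) {τ : ℂ → ℂ} (hτ : IsTau N τ) {m : ℕ}
    {u : Fin m → ℂ} (hu : RegularWithin N τ u) {i j : Fin m} (hlt : i < j) (hij : u i = u j)
    {e : ℂ} (he : e = 2 ∨ e = -2) :
    tauProd τ (Function.update u i (u i + e)) = -tauProd τ (Function.update u j (u j + e)) := by
  have hne := hlt.ne
  have hsplit : ∀ w : Fin m → ℂ, tauProd τ w = (tauPair τ w i j *
      ∏ k ∈ (Finset.univ.erase j).erase i, (tauPair τ w k j * tauPair τ w k i)) *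
      ∏ k ∈ (Finset.univ.erase j).erase i, ∏ l ∈ (Finset.univ.erase j).erase i with k < l,
        tauPair τ w k l := by
    intro w
    have hi : i ∈ Finset.univ.erase j := Finset.mem_erase.2 ⟨hne, Finset.mem_univ i⟩
    rw [tauProd_eq τ w j, ← Finset.mul_prod_erase _ _ hi]
    conv_lhs => rw [← Finset.insert_erase hi]
    rw [prod_pairs_insert _ (tauPair_comm τ w) _ (Finset.notMem_erase i _),
      Finset.erase_insert (Finset.notMem_erase i _), Finset.prod_mul_distrib]
    ring
  rw [hsplit, hsplit (Function.update u j (u j + e)), ← neg_mul, ← neg_mul]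
  have h0 : ∀ p : ℤ, AnalyticAt ℂ τ (2 * p) := fun p => by simpa [hij] using (hu i j p).2 hlt
  have h2 : (2 : ℂ) ≠ 2 / N := by simpa [hij] using (hu i j 1).1 hne
  have h22 := hτ.apply_two hN h0 h2
  congr 1
  · congr 1
    · simp only [tauPair, hlt, if_true, Function.update_self, Function.update_of_ne hne,
        Function.update_of_ne hne.symm, hij]
      rcases he with rfl | rfl
      · simp [h22]
      · simp [h22]
    · exact Finset.prod_congr rfl fun k hk => tauPair_update_mul hN hτ hu hlt hij he
        (Finset.mem_erase.1 hk).1 (Finset.mem_erase.1 (Finset.mem_erase.1 hk).2).1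
  · refine Finset.prod_congr rfl fun k hk => Finset.prod_congr rfl fun l hl => ?_
    have hki : k ≠ i := (Finset.mem_erase.1 hk).1
    have hkj : k ≠ j := (Finset.mem_erase.1 (Finset.mem_erase.1 hk).2).1
    have hl' := (Finset.mem_filter.1 hl).1
    have hli : l ≠ i := (Finset.mem_erase.1 hl').1
    have hlj : l ≠ j := (Finset.mem_erase.1 (Finset.mem_erase.1 hl').2).1
    simp only [tauPair, Function.update_of_ne hki, Function.update_of_ne hkj,
      Function.update_of_ne hli, Function.update_of_ne hlj]

theorem tauProd_update {N : ℕ} (hN : N ≠ 0) {τ : ℂ → ℂ} (hτ : IsTau N τ) {m : ℕ}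
    {u : Fin m → ℂ} (hu : RegularWithin N τ u) {i j : Fin m} (hne : i ≠ j) (hij : u i = u j)
    {e : ℂ} (he : e = 2 ∨ e = -2) :
    tauProd τ (Function.update u i (u i + e)) = -tauProd τ (Function.update u j (u j + e)) := by
  rcases lt_or_gt_of_ne hne with h | h
  · exact tauProd_update_of_lt hN hτ hu h hij he
  · rw [tauProd_update_of_lt hN hτ hu h hij.symm he, neg_neg]

/-! ### Telescoping sums over a lattice -/

/-- In use, `I` is the set of lattice points with distinct parameters. Each `X j` is extended beyond
`I` so that `t` becomes a sum of differences of summable families and their shifts; such differences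
sum to zero. The condition on the complement of `I` says that the values introduced there cancel
between two directions. -/
theorem hasSum_zero_of_telescoping {ι L E : Type*} [Fintype ι] [AddCommGroup L]
    [NormedAddCommGroup E] [CompleteSpace E] (e : ι → L) (I : Set L) (X Y : ι → L → E) (t : L → E)
    (ht : ∀ l ∈ I, t l = ∑ j, (X j l - Y j l)) (ht' : ∀ l ∉ I, t l = 0)
    (hXY : ∀ l j, l ∈ I → l - e j ∈ I → X j (l - e j) = Y j l)
    (hI : ∀ l ∉ I, ∃ i j, i ≠ j ∧
      (∀ k, k ≠ i → k ≠ j → l - e k ∉ I ∧ l + e k ∉ I) ∧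
      (l - e i ∈ I ↔ l - e j ∈ I) ∧
      (l + e i ∈ I ↔ l + e j ∈ I) ∧
      X i (l - e i) + X j (l - e j) = 0 ∧
      Y i (l + e i) + Y j (l + e j) = 0)
    (hX : ∀ j, ∃ w : L → ℝ, Summable w ∧ (∀ l, 0 ≤ w l) ∧ ∀ l ∈ I, ‖X j l‖ ≤ w l)
    (hY : ∀ j, ∃ w : L → ℝ, Summable w ∧ (∀ l, 0 ≤ w l) ∧ ∀ l ∈ I, ‖Y j l‖ ≤ w l) :
    HasSum t 0 := by
  classical
  -- Outside `I` the extension borrows the value of `Y j` one step further on, so that on `I`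
  -- shifting `X' j` always gives `Y j`.
  set X' : ι → L → E := fun j l => if l ∈ I then X j l else
    if l + e j ∈ I then Y j (l + e j) else 0 with hX'
  have hsum : ∀ j, Summable (X' j) := by
    intro j
    obtain ⟨w, hw, hw0, hwX⟩ := hX j
    obtain ⟨w', hw', hw0', hwY⟩ := hY j
    have hs : Summable fun l => w' (l + e j) :=
      (Equiv.addRight (e j)).summable_iff.2 hw'
    refine Summable.of_norm_bounded (hw.add hs) fun l => ?_
    have h0 := hw0 l
    have h0' := hw0' (l + e j)
    simp only [hX']
    split_ifs with h1 h2
    · linarith [hwX l h1]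
    · linarith [hwY _ h2]
    · simp only [norm_zero]
      linarith
  have hdiff : ∀ j, HasSum (fun l => X' j l - X' j (l - e j)) 0 := by
    intro j
    have h1 := (hsum j).hasSum
    have h2 := (Equiv.subRight (e j)).hasSum_iff.2 h1
    simpa using h1.sub h2
  have hY' : ∀ j l, X' j (l - e j) = if l ∈ I then Y j l else
      if l - e j ∈ I then X j (l - e j) else 0 := by
    intro j l
    simp only [hX', sub_add_cancel]
    by_cases h1 : l ∈ I <;> by_cases h2 : l - e j ∈ I
    · simp [h1, h2, hXY]
    · simp [h1, h2]
    · simp [h1, h2]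
    · simp [h1, h2]
  have := hasSum_sum (s := Finset.univ) fun j _ => hdiff j
  rw [Finset.sum_const_zero] at this
  convert this using 1
  funext l
  rw [Finset.sum_sub_distrib]
  simp only [hY']
  by_cases hl : l ∈ I
  · simp only [hX', hl, if_true, ht l hl, Finset.sum_sub_distrib]
  · obtain ⟨i, j, hij, hk, h1, h2, h3, h4⟩ := hI l hl
    simp only [hX', hl, if_false, ht' l hl]
    have e1 : ∑ k, (if l + e k ∈ I then Y k (l + e k) else 0) = 0 := by
      rw [Finset.sum_eq_add i j hij]
      · by_cases h : l + e i ∈ I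
        · rw [if_pos h, if_pos (h2.1 h), h4]
        · rw [if_neg h, if_neg fun h' => h (h2.2 h'), add_zero]
      · rintro k - ⟨hki, hkj⟩
        rw [if_neg (hk k hki hkj).2]
      · simp
      · simp
    have e2 : ∑ k, (if l - e k ∈ I then X k (l - e k) else 0) = 0 := by
      rw [Finset.sum_eq_add i j hij]
      · by_cases h : l - e i ∈ I
        · rw [if_pos h, if_pos (h1.1 h), h3]
        · rw [if_neg h, if_neg fun h' => h (h1.2 h'), add_zero]
      · rintro k - ⟨hki, hkj⟩
        rw [if_neg (hk k hki hkj).1]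
      · simp
      · simp
    rw [e1, e2, sub_zero]

/-! ### Bounds on a lattice -/

theorem one_add_abs_pos (l : ℤ) : 0 < 1 + |(l : ℝ)| := by positivity

theorem exists_one_add_abs_le (w : ℂ) :
    ∃ C : ℝ, 0 ≤ C ∧ ∀ l : ℤ, w + 2 * l ≠ 0 → 1 + |(l : ℝ)| ≤ C * ‖w + 2 * l‖ := by
  -- Outside `S` the triangle inequality gives the constant 1; the finitely many quotients on `S`
  -- are bounded by their sum.
  set S : Finset ℤ := Finset.Icc (-⌈‖w‖ + 1⌉) ⌈‖w‖ + 1⌉ with hS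
  have hpos : ∀ l : ℤ, 0 ≤ (1 + |(l : ℝ)|) / ‖w + 2 * l‖ := fun l => by positivity
  refine ⟨1 + ∑ l ∈ S, (1 + |(l : ℝ)|) / ‖w + 2 * l‖,
    add_nonneg zero_le_one (Finset.sum_nonneg fun l _ => hpos l), fun l hl => ?_⟩
  have hn : 0 < ‖w + 2 * l‖ := norm_pos_iff.2 hl
  by_cases h : l ∈ S
  · have h1 := Finset.single_le_sum (fun k _ => hpos k) h
    have h2 : 1 + |(l : ℝ)| = (1 + |(l : ℝ)|) / ‖w + 2 * l‖ * ‖w + 2 * l‖ := by field_simp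
    rw [h2]
    gcongr
    linarith
  · have h1 : ‖w‖ + 1 ≤ |(l : ℝ)| := by
      by_contra! h'
      refine h (Finset.mem_Icc.2 (abs_le.1 ?_))
      have h3 : |(l : ℝ)| ≤ (⌈‖w‖ + 1⌉ : ℝ) := h'.le.trans (Int.le_ceil _)
      exact_mod_cast h3
    have h2 : ‖(2 * l : ℂ)‖ ≤ ‖w + 2 * l‖ + ‖w‖ := by
      have := norm_sub_le (w + 2 * (l : ℂ)) w
      rwa [add_sub_cancel_left] at this
    have h3 : ‖(2 * l : ℂ)‖ = 2 * |(l : ℝ)| := by simp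
    have h4 : 0 ≤ ∑ l ∈ S, (1 + |(l : ℝ)|) / ‖w + 2 * l‖ := Finset.sum_nonneg fun l _ => hpos l
    have h5 : 1 + |(l : ℝ)| ≤ ‖w + 2 * l‖ := by linarith
    nlinarith

theorem exists_norm_rc_le (N : ℕ) (w : ℂ) (hw : ∀ l : ℤ, w + 2 * l ≠ 2 / N) :
    ∃ C : ℝ, 0 ≤ C ∧ ∀ l : ℤ, ‖rc N (w + 2 * l)‖ ≤ C * (1 + |(l : ℝ)|)⁻¹ := by
  obtain ⟨C, hC, h⟩ := exists_one_add_abs_le (w - 2 / N)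
  refine ⟨‖(-2 / N : ℂ)‖ * C, by positivity, fun l => ?_⟩
  have e : w + 2 * l - 2 / N = w - 2 / N + 2 * l := by ring
  have hne : w - 2 / N + 2 * l ≠ 0 := by
    rw [← e]
    exact sub_ne_zero.2 (hw l)
  have h1 := h l hne
  have h2 : 0 < ‖w - 2 / N + 2 * l‖ := norm_pos_iff.2 hne
  rw [rc, e, norm_div, mul_assoc, div_eq_mul_inv]
  gcongr
  rw [inv_le_iff_one_le_mul₀ h2, mul_assoc, mul_comm (_⁻¹), ← mul_assoc, ← div_eq_mul_inv,
    one_le_div (one_add_abs_pos l)]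
  exact h1

theorem inv_one_add_abs_le_one (l : ℤ) : (1 + |(l : ℝ)|)⁻¹ ≤ 1 :=
  inv_le_one_of_one_le₀ (by simp)

theorem exists_norm_rb_le (N : ℕ) (w : ℂ) (hw : ∀ l : ℤ, w + 2 * l ≠ 2 / N) :
    ∃ C : ℝ, 0 ≤ C ∧ ∀ l : ℤ, ‖rb N (w + 2 * l)‖ ≤ C := by
  obtain ⟨C, hC, h⟩ := exists_norm_rc_le N w hw
  refine ⟨1 + C, by positivity, fun l => ?_⟩
  rw [eq_sub_of_add_eq (rb_add_rc (hw l))]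
  refine (norm_sub_le _ _).trans ?_
  rw [norm_one]
  have := (h l).trans (mul_le_of_le_one_right hC (inv_one_add_abs_le_one l))
  linarith

theorem exists_norm_rb_inv_le (N : ℕ) (w : ℂ) :
    ∃ C : ℝ, 0 ≤ C ∧ ∀ l : ℤ, w + 2 * l ≠ 0 → ‖(rb N (w + 2 * l))⁻¹‖ ≤ C := by
  obtain ⟨C, hC, h⟩ := exists_one_add_abs_le w
  refine ⟨1 + ‖(2 / N : ℂ)‖ * C, by positivity, fun l hl => ?_⟩
  have h2 : 0 < ‖w + 2 * l‖ := norm_pos_iff.2 hl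
  have e : (rb N (w + 2 * l))⁻¹ = 1 - 2 / N / (w + 2 * l) := by
    rw [rb, inv_div, sub_div, div_self hl]
  rw [e]
  refine (norm_sub_le _ _).trans ?_
  rw [norm_one, norm_div]
  have h3 : 1 ≤ C * ‖w + 2 * l‖ := le_trans (by simp) (h l hl)
  have h4 : ‖(2 / N : ℂ)‖ / ‖w + 2 * l‖ ≤ ‖(2 / N : ℂ)‖ * C := by
    rw [div_le_iff₀ h2, mul_assoc]
    exact le_mul_of_one_le_right (norm_nonneg _) h3
  linarith

theorem norm_auxComponent_le {d n : ℕ} (a : Fin d) (v : TensorSpace d (n + 1)) :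
    ‖auxComponent a v‖ ≤ ‖v‖ :=
  (pi_norm_le_iff_of_nonneg (norm_nonneg v)).2 fun _ => norm_le_pi_norm v _

theorem norm_lastComponent_le {d n : ℕ} (a : Fin d) (v : TensorSpace d (n + 1)) :
    ‖lastComponent a v‖ ≤ ‖v‖ :=
  (pi_norm_le_iff_of_nonneg (norm_nonneg v)).2 fun _ => norm_le_pi_norm v _

/-- Changing the auxiliary colour takes at least one exchange, hence one decaying factor `c`. Both
bounds are proved together, since after an exchange the remaining entry may be diagonal. -/
theorem exists_norm_monodromyEntry_le (N : ℕ) {d n : ℕ} (x : Fin n → ℂ) (t : ℂ)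
    (hx : ∀ (i : Fin n) (l : ℤ), x i - t + 2 * l ≠ 2 / N) :
    ∃ C : ℝ, 0 ≤ C ∧ ∀ (l : ℤ) (α β : Fin d) (v : TensorSpace d n),
      ‖monodromyEntry N x (t - 2 * l) α β v‖ ≤ C * ‖v‖ ∧
      (α ≠ β → ‖monodromyEntry N x (t - 2 * l) α β v‖ ≤ C * (1 + |(l : ℝ)|)⁻¹ * ‖v‖) := by
  induction n with
  | zero =>
    refine ⟨1, zero_le_one, fun l α β v => ?_⟩
    by_cases h : α = β <;> simp [monodromyEntry_zero, h]
    positivity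
  | succ n ih =>
    obtain ⟨C, hC, h⟩ := ih (Fin.tail x) (fun i => hx i.succ)
    obtain ⟨Cb, hCb, hb⟩ := exists_norm_rb_le N _ (hx 0)
    obtain ⟨Cc, hCc, hc⟩ := exists_norm_rc_le N _ (hx 0)
    refine ⟨Cb * C + Cc * C, by positivity, fun l α β v => ?_⟩
    have e : x 0 - (t - 2 * l) = x 0 - t + 2 * l := by ring
    have hcl : ∀ (a : Fin d) (δ : Fin n → Fin d),
        ‖rc N (x 0 - (t - 2 * l)) * monodromyEntry N (Fin.tail x) (t - 2 * l) a β
          (auxComponent α v) δ‖ ≤ Cc * (1 + |(l : ℝ)|)⁻¹ * (C * ‖v‖) := by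
      intro a δ
      rw [norm_mul, e]
      gcongr
      · exact hc l
      · refine (norm_le_pi_norm _ δ).trans ((h l a β _).1.trans ?_)
        gcongr
        exact norm_auxComponent_le _ _
    refine ⟨?_, fun hne => ?_⟩
    · refine (pi_norm_le_iff_of_nonneg (by positivity)).2 fun ε => ?_
      obtain ⟨a, δ, rfl⟩ : ∃ a ε', ε = Fin.cons a ε' := ⟨ε 0, Fin.tail ε, by simp⟩
      rw [monodromyEntry_cons_apply]
      refine (norm_add_le _ _).trans ?_
      rw [add_mul]
      refine add_le_add ?_ ((hcl a δ).trans ?_)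
      · rw [norm_mul, e, mul_assoc]
        gcongr
        · exact hb l
        · refine (norm_le_pi_norm _ δ).trans ((h l α β _).1.trans ?_)
          gcongr
          exact norm_auxComponent_le _ _
      · rw [mul_assoc Cc C]
        gcongr
        exact mul_le_of_le_one_right hCc (inv_one_add_abs_le_one l)
    · refine (pi_norm_le_iff_of_nonneg (by positivity)).2 fun ε => ?_
      obtain ⟨a, δ, rfl⟩ : ∃ a ε', ε = Fin.cons a ε' := ⟨ε 0, Fin.tail ε, by simp⟩
      rw [monodromyEntry_cons_apply]
      refine (norm_add_le _ _).trans ?_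
      rw [add_mul, add_mul]
      refine add_le_add ?_ ((hcl a δ).trans (le_of_eq (by ring)))
      rw [norm_mul, e, mul_assoc, mul_assoc]
      gcongr
      · exact hb l
      · refine (norm_le_pi_norm _ δ).trans (((h l α β _).2 hne).trans ?_)
        rw [mul_assoc]
        gcongr
        exact norm_auxComponent_le _ _

/-- Each `B` is an off-diagonal entry and contributes one decaying factor, which is why the weight
in `JacksonConverges` suffices. -/
theorem exists_norm_betheVector_le (N : ℕ) {d n m : ℕ} (x : Fin n → ℂ) (ut : Fin m → ℂ)
    (hx : ∀ i j (l : ℤ), x i - ut j + 2 * l ≠ 2 / N) :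
    ∃ C : ℝ, 0 ≤ C ∧ ∀ (l : Fin m → ℤ) (g : TensorSpace d m),
      ‖betheVector N x (latticePoint ut l) g‖ ≤ C * (∏ j, (1 + |(l j : ℝ)|)⁻¹) * ‖g‖ := by
  induction m with
  | zero =>
    refine ⟨‖refState (d + 1) n‖, norm_nonneg _, fun l g => ?_⟩
    rw [betheVector_zero, norm_smul, mul_comm]
    simp only [Finset.univ_eq_empty, Finset.prod_empty, mul_one]
    gcongr
    exact norm_le_pi_norm g _
  | succ m ih =>
    obtain ⟨C, hC, h⟩ := ih (Fin.init ut) (fun i j => hx i _)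
    obtain ⟨C', hC', h'⟩ := exists_norm_monodromyEntry_le N (d := d + 1) x (ut (Fin.last m))
      (fun i => hx i _)
    refine ⟨d * (C' * C), by positivity, fun l g => ?_⟩
    rw [betheVector_succ]
    refine (norm_sum_le _ _).trans ?_
    have hb : ∀ b : Fin d, ‖monodromyEntry N x (latticePoint ut l (Fin.last m)) 0 b.succ
        (betheVector N x (Fin.init (latticePoint ut l)) (lastComponent b g))‖ ≤
          C' * C * (∏ j, (1 + |(l j : ℝ)|)⁻¹) * ‖g‖ := by
      intro b
      refine ((h' (l (Fin.last m)) 0 b.succ _).2 (Fin.succ_ne_zero b).symm).trans ?_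
      have h1 := h (Fin.init l) (lastComponent b g)
      have h2 : ‖betheVector N x (Fin.init (latticePoint ut l)) (lastComponent b g)‖ ≤
          C * (∏ j, (1 + |(Fin.init l j : ℝ)|)⁻¹) * ‖g‖ := by
        refine h1.trans ?_
        gcongr
        exact norm_lastComponent_le _ _
      refine (mul_le_mul_of_nonneg_left h2 (by positivity)).trans (le_of_eq ?_)
      rw [Fin.prod_univ_castSucc]
      simp only [Fin.init]
      ring
    refine (Finset.sum_le_sum fun b _ => hb b).trans (le_of_eq ?_)
    simp
    ring

theorem norm_permSites_le {d n : ℕ} (i j : Fin n) (v : TensorSpace d n) :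
    ‖permSites i j v‖ ≤ ‖v‖ :=
  (pi_norm_le_iff_of_nonneg (norm_nonneg v)).2 fun _ => norm_le_pi_norm v _

theorem norm_rMatrix_le (N : ℕ) {d n : ℕ} (i j : Fin n) (z : ℂ) (v : TensorSpace d n) :
    ‖rMatrix N i j z v‖ ≤ (‖rb N z‖ + ‖rc N z‖) * ‖v‖ := by
  refine (pi_norm_le_iff_of_nonneg (by positivity)).2 fun α => ?_
  rw [rMatrix_apply, add_mul]
  refine (norm_add_le _ _).trans ?_
  rw [norm_mul, norm_mul]
  gcongr <;> exact norm_le_pi_norm v _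

theorem latticePoint_sub_latticePoint {m : ℕ} (ut : Fin m → ℂ) (l : Fin m → ℤ) (i j : Fin m) :
    latticePoint ut l i - latticePoint ut l j = ut i - ut j + 2 * ((l j - l i : ℤ) : ℂ) := by
  simp only [latticePoint]
  push_cast
  ring

theorem RegularWithin.latticePoint {N : ℕ} {τ : ℂ → ℂ} {m : ℕ} {ut : Fin m → ℂ}
    (h : RegularWithin N τ ut) (l : Fin m → ℤ) : RegularWithin N τ (latticePoint ut l) := by
  intro i j p
  have e : _root_.latticePoint ut l i - _root_.latticePoint ut l j + 2 * (p : ℂ) =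
      ut i - ut j + 2 * ((l j - l i + p : ℤ) : ℂ) := by
    rw [latticePoint_sub_latticePoint]
    push_cast
    ring
  rw [e]
  exact h i j _

theorem RegularWithin.sub_ne {N : ℕ} {τ : ℂ → ℂ} {m : ℕ} {u : Fin m → ℂ}
    (h : RegularWithin N τ u) {i j : Fin m} (hij : i ≠ j) : u i - u j ≠ 2 / N := by
  simpa using (h i j 0).1 hij

/-- The convergence hypothesis controls `f` only at unpermuted lattice points. Permuting costs
R-matrices, which are bounded uniformly on the lattice. -/
theorem exists_norm_comp_perm_le {N : ℕ} {τ : ℂ → ℂ} {d m : ℕ}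
    {f : (Fin m → ℂ) → TensorSpace d m} {ut : Fin m → ℂ} (hut : RegularWithin N τ ut)
    (hf : ∀ (π : Equiv.Perm (Fin m)) l, ExchangeAt N f (latticePoint ut l ∘ π))
    (π : Equiv.Perm (Fin m)) :
    ∃ C : ℝ, 0 ≤ C ∧ ∀ l, ‖f (latticePoint ut l ∘ π)‖ ≤ C * ‖f (latticePoint ut l)‖ := by
  induction π using perm_induction_adjacent with
  | h1 => exact ⟨1, zero_le_one, fun l => by simp⟩
  | hs π i j hij ih =>
    obtain ⟨C, hC, h⟩ := ih
    have hne : π i ≠ π j := fun h => by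
      have := π.injective h
      rw [this] at hij
      omega
    obtain ⟨Cb, hCb, hb⟩ := exists_norm_rb_le N (ut (π i) - ut (π j)) fun l =>
      (hut (π i) (π j) l).1 hne
    obtain ⟨Cc, hCc, hc⟩ := exists_norm_rc_le N (ut (π i) - ut (π j)) fun l =>
      (hut (π i) (π j) l).1 hne
    refine ⟨(Cb + Cc) * C, by positivity, fun l => ?_⟩
    have e := hf π l i j hij ((hut.latticePoint l).sub_ne hne)
    have e' : latticePoint ut l ∘ (π * Equiv.swap i j : Equiv.Perm (Fin m)) =
      (latticePoint ut l ∘ π) ∘ Equiv.swap i j := rfl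
    rw [e', e]
    refine (norm_permSites_le _ _ _).trans ((norm_rMatrix_le _ _ _ _ _).trans ?_)
    rw [mul_assoc]
    have h1 := hb (l (π j) - l (π i))
    have h2 := (hc (l (π j) - l (π i))).trans
      (mul_le_of_le_one_right hCc (inv_one_add_abs_le_one _))
    rw [← latticePoint_sub_latticePoint] at h1 h2
    exact mul_le_mul (add_le_add h1 h2) (h l) (norm_nonneg _) (by positivity)

/-! ### One level of the nesting and its exchange property -/

/-- One step of the nested Bethe Ansatz: the Jackson-type sum of Bethe vectors formed with `f`. -/
def levelSum (N : ℕ) (ψ τ : ℂ → ℂ) {d n m : ℕ} (f : (Fin m → ℂ) → TensorSpace d m)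
    (ut : Fin m → ℂ) (x : Fin n → ℂ) : TensorSpace (d + 1) n :=
  ∑' l : Fin m → ℤ, betheVector N x (latticePoint ut l)
    (dressed ψ τ x (latticePoint ut l) (f (latticePoint ut l)))

/-- Absolute convergence of the sum in `levelSum`, in the sense of `JacksonConverges`. -/
def LevelConverges (ψ τ : ℂ → ℂ) {d n m : ℕ} (f : (Fin m → ℂ) → TensorSpace d m)
    (ut : Fin m → ℂ) (x : Fin n → ℂ) : Prop :=
  ∀ β : Fin m → Fin d, Summable fun l : Fin m → ℤ =>
    ‖dressed ψ τ x (latticePoint ut l) (f (latticePoint ut l)) β‖ * ∏ j, (1 + |(l j : ℝ)|)⁻¹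

/-- The product of `ψ` over the differences of the components of `x` and `u`. -/
def psiProd (ψ : ℂ → ℂ) {n m : ℕ} (x : Fin n → ℂ) (u : Fin m → ℂ) : ℂ := ∏ i, ∏ j, ψ (x i - u j)

theorem dressed_eq (ψ τ : ℂ → ℂ) {d n m : ℕ} (x : Fin n → ℂ) (u : Fin m → ℂ)
    (v : TensorSpace d m) : dressed ψ τ x u v = (psiProd ψ x u * tauProd τ u) • v := rfl

theorem psiProd_comp_perm_left (ψ : ℂ → ℂ) {n m : ℕ} (x : Fin n → ℂ) (u : Fin m → ℂ)
    (π : Equiv.Perm (Fin n)) : psiProd ψ (x ∘ π) u = psiProd ψ x u :=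
  Equiv.prod_comp π fun i => ∏ j, ψ (x i - u j)

theorem psiProd_comp_perm_right (ψ : ℂ → ℂ) {n m : ℕ} (x : Fin n → ℂ) (u : Fin m → ℂ)
    (π : Equiv.Perm (Fin m)) : psiProd ψ x (u ∘ π) = psiProd ψ x u :=
  Finset.prod_congr rfl fun i _ => Equiv.prod_comp π fun j => ψ (x i - u j)

theorem dressed_comp_perm_left (ψ τ : ℂ → ℂ) {d n m : ℕ} (x : Fin n → ℂ) (u : Fin m → ℂ)
    (v : TensorSpace d m) (π : Equiv.Perm (Fin n)) :
    dressed ψ τ (x ∘ π) u v = dressed ψ τ x u v := by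
  rw [dressed_eq, psiProd_comp_perm_left, dressed_eq]

theorem LevelConverges.comp_perm {ψ τ : ℂ → ℂ} {d n m : ℕ} {f : (Fin m → ℂ) → TensorSpace d m}
    {ut : Fin m → ℂ} {x : Fin n → ℂ} (h : LevelConverges ψ τ f ut x) (π : Equiv.Perm (Fin n)) :
    LevelConverges ψ τ f ut (x ∘ π) := fun β => by
  simpa only [dressed_comp_perm_left] using h β

theorem RegularBetween.comp_perm {N : ℕ} {ψ : ℂ → ℂ} {n m : ℕ} {x : Fin n → ℂ} {ut : Fin m → ℂ}
    (h : RegularBetween N ψ x ut) (π : Equiv.Perm (Fin n)) : RegularBetween N ψ (x ∘ π) ut :=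
  fun i j l => h (π i) j l

theorem sub_latticePoint {m : ℕ} (ut : Fin m → ℂ) (l : Fin m → ℤ) (j : Fin m) (z : ℂ) :
    z - latticePoint ut l j = z - ut j + 2 * (l j : ℂ) := by
  simp only [latticePoint]
  ring

theorem RegularBetween.sub_ne {N : ℕ} {ψ : ℂ → ℂ} {n m : ℕ} {x : Fin n → ℂ} {ut : Fin m → ℂ}
    (h : RegularBetween N ψ x ut) (l : Fin m → ℤ) (i j) :
    x i - latticePoint ut l j ≠ 2 / N := by
  rw [sub_latticePoint]
  exact (h i j _).1

theorem LevelConverges.summable_norm {ψ τ : ℂ → ℂ} {d n m : ℕ}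
    {f : (Fin m → ℂ) → TensorSpace d m} {ut : Fin m → ℂ} {x : Fin n → ℂ}
    (h : LevelConverges ψ τ f ut x) :
    Summable fun l : Fin m → ℤ => ‖dressed ψ τ x (latticePoint ut l) (f (latticePoint ut l))‖ *
      ∏ j, (1 + |(l j : ℝ)|)⁻¹ := by
  have hs := summable_sum (s := Finset.univ) fun β _ => h β
  refine Summable.of_nonneg_of_le (fun l => by positivity) (fun l => ?_) hs
  rw [← Finset.sum_mul]
  gcongr
  refine (pi_norm_le_iff_of_nonneg (Finset.sum_nonneg fun _ _ => norm_nonneg _)).2 fun β => ?_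
  exact Finset.single_le_sum
    (f := fun β => ‖dressed ψ τ x (latticePoint ut l) (f (latticePoint ut l)) β‖)
    (fun _ _ => norm_nonneg _) (Finset.mem_univ β)

theorem LevelConverges.hasSum {N : ℕ} {ψ τ : ℂ → ℂ} {d n m : ℕ}
    {f : (Fin m → ℂ) → TensorSpace d m} {ut : Fin m → ℂ} {x : Fin n → ℂ}
    (h : LevelConverges ψ τ f ut x) (hx : RegularBetween N ψ x ut) :
    HasSum (fun l : Fin m → ℤ => betheVector N x (latticePoint ut l)
      (dressed ψ τ x (latticePoint ut l) (f (latticePoint ut l)))) (levelSum N ψ τ f ut x) := by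
  obtain ⟨C, hC, hb⟩ := exists_norm_betheVector_le N (d := d) x ut fun i j l => (hx i j l).1
  refine (Summable.of_norm_bounded (h.summable_norm.mul_left C) fun l => ?_).hasSum
  refine (hb l _).trans (le_of_eq (by ring))

theorem HasSum.mapLinear {ι : Type*} {d n d' n' : ℕ} {t : ι → TensorSpace d n}
    {v : TensorSpace d n} (h : HasSum t v) (A : TensorSpace d n →ₗ[ℂ] TensorSpace d' n') :
    HasSum (fun i => A (t i)) (A v) :=
  (LinearMap.toContinuousLinearMap A).hasSum h

theorem refState_comp_perm (d n : ℕ) (α : Fin n → Fin d) (π : Equiv.Perm (Fin n)) :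
    refState d n (α ∘ π) = refState d n α := by
  unfold refState
  congr 1
  exact propext (π.forall_congr_right (q := fun k => (α k : ℕ) = 0))

theorem permSites_rMatrix_refState {N d n : ℕ} (i j : Fin n) {z : ℂ} (hz : z ≠ 2 / N) :
    permSites i j (rMatrix N i j z (refState d n)) = refState d n := by
  funext α
  rw [permSites_apply, rMatrix_apply]
  simp only [refState_comp_perm]
  rw [← add_mul,
    rb_add_rc hz, one_mul]

/-- `P R` fixes the reference state and intertwines every `B`. -/
theorem betheVector_comp_swap_left {N d n m : ℕ} (x : Fin n → ℂ) (u : Fin m → ℂ)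
    (hxu : ∀ i j, x i - u j ≠ 2 / N) (i j : Fin n) (hij : (j : ℕ) = i + 1)
    (hx : x i - x j ≠ 2 / N) (g : TensorSpace d m) :
    betheVector N (x ∘ Equiv.swap i j) u g =
      permSites i j (rMatrix N i j (x i - x j) (betheVector N x u g)) := by
  induction m with
  | zero => rw [betheVector_zero, betheVector_zero, map_smul, map_smul,
      permSites_rMatrix_refState i j hx]
  | succ m ih =>
    rw [betheVector_succ, betheVector_succ, map_sum, map_sum]
    refine Finset.sum_congr rfl fun b _ => ?_
    rw [ih (Fin.init u) (fun _ _ => hxu _ _)]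
    exact monodromyEntry_comp_swap x (fun _ => hxu _ _) i j hij hx _ _ _

/-- The symmetry property is inherited by the next level. -/
theorem levelSum_exchangeAt {N : ℕ} {ψ τ : ℂ → ℂ} {d n m : ℕ} {f : (Fin m → ℂ) → TensorSpace d m}
    {ut : Fin m → ℂ} {x : Fin n → ℂ} (h : LevelConverges ψ τ f ut x)
    (hx : RegularBetween N ψ x ut) : ExchangeAt N (levelSum N ψ τ f ut) x := by
  intro i j hij hne
  refine ((h.comp_perm (Equiv.swap i j)).hasSum (hx.comp_perm _)).unique ?_
  have := ((h.hasSum hx).mapLinear (rMatrix N i j (x i - x j))).mapLinear (permSites i j)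
  convert this using 2 with l
  rw [betheVector_comp_swap_left _ _ (fun _ _ => hx.sub_ne l _ _) i j hij hne,
    dressed_comp_perm_left]

/-! ### Cyclicity and the coefficients of the two expansions -/

/-- `f` has the cyclicity property at `u`: shifting the last argument by `2` amounts to moving it,
together with its tensor factor, to the first place. -/
def CyclicAt {d m : ℕ} (f : (Fin m → ℂ) → TensorSpace d m) (u : Fin m → ℂ) : Prop :=
  ∀ p : Fin m, (p : ℕ) + 1 = m → ∀ β, f (Function.update u p (u p + 2)) β =
    f (u ∘ (finRotate m).symm) (β ∘ (finRotate m).symm)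

theorem comp_finRotate_symm {X : Type*} {m : ℕ} (v : Fin (m + 1) → X) :
    v ∘ (finRotate (m + 1)).symm = (Fin.cons (v (Fin.last m)) (Fin.init v) : Fin (m + 1) → X) := by
  rw [Equiv.comp_symm_eq]
  funext i
  rw [Function.comp_apply]
  refine Fin.lastCases ?_ (fun i => ?_) i
  · rw [finRotate_last, Fin.cons_zero]
  · rw [finRotate_apply, Fin.coeSucc_eq_succ, Fin.cons_succ]
    rfl

theorem finRotate_symm_zero (m : ℕ) : (finRotate (m + 1)).symm 0 = Fin.last m := by
  rw [Equiv.symm_apply_eq, finRotate_last]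

section Step

variable {N : ℕ} {ψ τ : ℂ → ℂ} {d n m : ℕ} {f : (Fin m → ℂ) → TensorSpace d m}

/-- The Bethe vector with the parameter `u j` also attached to an additional last quantum space,
the colour of which is projected on `α > 1`. -/
def reducedVector (N : ℕ) (f : (Fin m → ℂ) → TensorSpace d m) (y : Fin n → ℂ) (α : Fin d)
    (j : Fin m) (u : Fin m → ℂ) : TensorSpace (d + 1) n :=
  lastComponent α.succ (betheVector N (Fin.snoc y (u j) : Fin (n + 1) → ℂ) u (f u))

/-- A family of functions of `u` that is permuted together with the components of `u`. -/
def Equivariant {E : Type*} (K : Fin m → (Fin m → ℂ) → E) (u : Fin m → ℂ) : Prop :=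
  ∀ (π : Equiv.Perm (Fin m)) (j : Fin m), K j (u ∘ π) = K (π j) u

/-- Coefficient of `reducedVector` in the components of colour `> 1` in the last quantum space. -/
def lastCoeff (N : ℕ) (ψ : ℂ → ℂ) (y : Fin n → ℂ) (s : ℂ) (j : Fin m) (u : Fin m → ℂ) : ℂ :=
  psiProd ψ (Fin.snoc y (s + 2) : Fin (n + 1) → ℂ) u *
    (rc N (s + 2 - u j) * ∏ i ∈ Finset.univ.erase j, rb N (s + 2 - u i) * (rb N (u j - u i))⁻¹)

/-- Coefficient of `reducedVector` in the components of colour `> 1` in the first quantum space. -/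
def firstCoeff (N : ℕ) (ψ : ℂ → ℂ) (y : Fin n → ℂ) (s : ℂ) (j : Fin m) (u : Fin m → ℂ) : ℂ :=
  psiProd ψ (Fin.cons s y : Fin (n + 1) → ℂ) u *
    (rc N (s - u j) * (∏ i, rb N (y i - u j)) * ∏ i ∈ Finset.univ.erase j, (rb N (u i - u j))⁻¹)

theorem prod_erase_comp_perm (π : Equiv.Perm (Fin m)) (j : Fin m) (F : Fin m → ℂ) :
    ∏ i ∈ Finset.univ.erase j, F (π i) = ∏ i ∈ Finset.univ.erase (π j), F i :=
  Finset.prod_equiv π (by simp) fun _ _ => rfl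

theorem lastCoeff_equivariant (y : Fin n → ℂ) (s : ℂ) (u : Fin m → ℂ) :
    Equivariant (lastCoeff N ψ y s) u := fun π j => by
  simp only [lastCoeff, psiProd_comp_perm_right, Function.comp_apply]
  rw [prod_erase_comp_perm π j fun i => rb N (s + 2 - u i) * (rb N (u (π j) - u i))⁻¹]

theorem firstCoeff_equivariant (y : Fin n → ℂ) (s : ℂ) (u : Fin m → ℂ) :
    Equivariant (firstCoeff N ψ y s) u := fun π j => by
  simp only [firstCoeff, psiProd_comp_perm_right, Function.comp_apply]
  rw [prod_erase_comp_perm π j fun i => (rb N (u i - u (π j)))⁻¹]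

theorem snoc_sub_ne {y : Fin n → ℂ} {u : Fin m → ℂ} (hN : N ≠ 0) (hu : RegularWithin N τ u)
    (hyu : ∀ i j, y i - u j ≠ 2 / N) (j : Fin m) (i : Fin (n + 1)) (k : Fin m) :
    (Fin.snoc y (u j) : Fin (n + 1) → ℂ) i - u k ≠ 2 / N := by
  refine Fin.lastCases ?_ (fun i => ?_) i
  · rw [Fin.snoc_last]
    by_cases h : j = k
    · rw [h, sub_self]
      exact (two_div_ne_zero hN).symm
    · exact hu.sub_ne h
  · rw [Fin.snoc_castSucc]
    exact hyu i k

theorem reducedVector_equivariant (hN : N ≠ 0) {y : Fin n → ℂ} {u : Fin m → ℂ}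
    (hu : RegularWithin N τ u) (hyu : ∀ i j, y i - u j ≠ 2 / N)
    (hf : ∀ π : Equiv.Perm (Fin m), ExchangeAt N f (u ∘ π)) (α : Fin d) :
    Equivariant (reducedVector N f y α) u := fun π j => by
  unfold reducedVector
  rw [Function.comp_apply, betheVector_comp_perm _ u (fun i k => snoc_sub_ne hN hu hyu (π j) i k)
    (fun i j h => hu.sub_ne h) f hf π]

theorem update_comp_perm (u : Fin m → ℂ) (π : Equiv.Perm (Fin m)) (j : Fin m) (z : ℂ) :
    Function.update (u ∘ π) j z = Function.update u (π j) z ∘ π := by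
  rw [Function.update_comp_eq_of_injective _ π.injective]

theorem latticePoint_sub_single (ut : Fin m → ℂ) (l : Fin m → ℤ) (j : Fin m) :
    latticePoint ut (l - Pi.single j 1) =
      Function.update (latticePoint ut l) j (latticePoint ut l j + 2) := by
  funext k
  by_cases h : k = j
  · subst h
    simp [latticePoint]
    ring
  · simp [latticePoint, h]

theorem latticePoint_add_single (ut : Fin m → ℂ) (l : Fin m → ℤ) (j : Fin m) :
    latticePoint ut (l + Pi.single j 1) =
      Function.update (latticePoint ut l) j (latticePoint ut l j + -2) := by
  funext k
  by_cases h : k = j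
  · subst h
    simp [latticePoint]
    ring
  · simp [latticePoint, h]

/-- With equal components `u` is invariant under the swap, so the two shifted points differ only by
a permutation. This pairs the stray terms at coincident parameters. -/
theorem update_eq_update_comp_swap {u : Fin m → ℂ} {i j : Fin m} (h : u i = u j) (e : ℂ) :
    Function.update u j (u j + e) = Function.update u i (u i + e) ∘ Equiv.swap i j := by
  have h1 : u = u ∘ Equiv.swap i j := by
    funext k
    rw [Function.comp_apply, Equiv.swap_apply_def]
    split_ifs with h1 h2
    · rw [h1, h]
    · rw [h2, h]
    · rfl
  conv_lhs => rw [h1]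
  rw [update_comp_perm]
  simp

/-- The reason for the difference equations imposed on `ψ` and `τ`: they make the coefficients of
the two expansions shifts of each other. The factors depending on `s`, on `y` and on `u` alone are
treated separately, in `hP`, `hQ` and `hT`. -/
theorem lastCoeff_mul_tauProd_update (hψ : IsPsi N ψ) (hτ : IsTau N τ) {y : Fin n → ℂ} {s : ℂ}
    {ut : Fin m → ℂ} (hut : RegularWithin N τ ut)
    (hx : RegularBetween N ψ (Fin.cons s y : Fin (n + 1) → ℂ) ut) (l : Fin m → ℤ)
    (hl : Function.Injective (latticePoint ut l)) (j : Fin m)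
    (hl' : Function.Injective (latticePoint ut (l - Pi.single j 1))) :
    tauProd τ (latticePoint ut (l - Pi.single j 1)) *
        lastCoeff N ψ y s j (latticePoint ut (l - Pi.single j 1)) =
      tauProd τ (latticePoint ut l) * firstCoeff N ψ y s j (latticePoint ut l) := by
  have hψs : ∀ k (p : ℤ), s - latticePoint ut l k + 2 * p ≠ 2 / N ∧
      AnalyticAt ℂ ψ (s - latticePoint ut l k + 2 * p) := by
    intro k p
    have := hx 0 k (l k + p)
    rw [Fin.cons_zero, show s - ut k + 2 * ((l k + p : ℤ) : ℂ) = s - latticePoint ut l k + 2 * p by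
      rw [sub_latticePoint]; push_cast; ring] at this
    exact this
  have hψy : ∀ i k (p : ℤ), y i - latticePoint ut l k + 2 * p ≠ 2 / N ∧
      AnalyticAt ℂ ψ (y i - latticePoint ut l k + 2 * p) := by
    intro i k p
    have := hx i.succ k (l k + p)
    rw [Fin.cons_succ, show y i - ut k + 2 * ((l k + p : ℤ) : ℂ) =
      y i - latticePoint ut l k + 2 * p by rw [sub_latticePoint]; push_cast; ring] at this
    exact this
  have hu := hut.latticePoint l
  rw [latticePoint_sub_single] at hl' ⊢
  generalize latticePoint ut l = u at *
  have hne : ∀ k ∈ Finset.univ.erase j, k ≠ j := fun k hk => (Finset.mem_erase.1 hk).1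
  have hupd : ∀ F : ℂ → ℂ, ∏ k ∈ Finset.univ.erase j, F (Function.update u j (u j + 2) k) =
      ∏ k ∈ Finset.univ.erase j, F (u k) := fun F =>
    Finset.prod_congr rfl fun k hk => by rw [Function.update_of_ne (hne k hk)]
  have hP : (∏ k, ψ (s + 2 - Function.update u j (u j + 2) k)) *
      ∏ k ∈ Finset.univ.erase j, rb N (s + 2 - u k) = ∏ k, ψ (s - u k) := by
    rw [← Finset.mul_prod_erase _ _ (Finset.mem_univ j), mul_assoc, ← Finset.prod_mul_distrib,
      ← Finset.mul_prod_erase _ (fun k => ψ (s - u k)) (Finset.mem_univ j)]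
    congr 1
    · rw [Function.update_self]
      congr 1
      ring
    · refine Finset.prod_congr rfl fun k hk => ?_
      have h1 := hψs k 1
      have h0 := (hψs k 0).2
      have e1 : s - u k + 2 * ((1 : ℤ) : ℂ) = s + 2 - u k := by push_cast; ring
      have e0 : s - u k + 2 * ((0 : ℤ) : ℂ) = s + 2 - u k - 2 := by push_cast; ring
      rw [e1] at h1
      rw [e0] at h0
      rw [Function.update_of_ne (hne k hk), mul_comm, hψ.eqn_apply h1.1 h1.2 h0]
      congr 1
      ring
  have hQ : psiProd ψ y (Function.update u j (u j + 2)) =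
      psiProd ψ y u * ∏ i, rb N (y i - u j) := by
    unfold psiProd
    rw [← Finset.prod_mul_distrib]
    refine Finset.prod_congr rfl fun i _ => ?_
    rw [← Finset.mul_prod_erase _ _ (Finset.mem_univ j),
      ← Finset.mul_prod_erase _ (fun k => ψ (y i - u k)) (Finset.mem_univ j)]
    have h0 := hψy i j 0
    have h1 := (hψy i j (-1)).2
    have e0 : y i - u j + 2 * ((0 : ℤ) : ℂ) = y i - u j := by push_cast; ring
    have e1 : y i - u j + 2 * ((-1 : ℤ) : ℂ) = y i - u j - 2 := by push_cast; ring
    rw [e0] at h0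
    rw [e1] at h1
    have h2 := hψ.eqn_apply h0.1 h0.2 h1
    rw [Function.update_self, show y i - (u j + 2) = y i - u j - 2 by ring, ← h2,
      hupd fun z => ψ (y i - z)]
    ring
  -- Injectivity before and after the shift keeps the inverted `b` away from their zeros. The order
  -- of `k` and `j` decides whether the equation of `τ` is used at `u k - u j` or at `u j + 2 - u
  -- k`.
  have hT : tauProd τ (Function.update u j (u j + 2)) *
      ∏ k ∈ Finset.univ.erase j, (rb N (u j + 2 - u k))⁻¹ =
      tauProd τ u * ∏ k ∈ Finset.univ.erase j, (rb N (u k - u j))⁻¹ := by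
    rw [tauProd_eq τ _ j, tauProd_eq τ u j, mul_right_comm,
      mul_right_comm (∏ k ∈ Finset.univ.erase j, tauPair τ u k j)]
    congr 1
    · rw [← Finset.prod_mul_distrib, ← Finset.prod_mul_distrib]
      refine Finset.prod_congr rfl fun k hk => ?_
      have hkj := hne k hk
      have hz1 : u j + 2 - u k ≠ 0 := by
        intro h
        refine hkj (hl' ?_)
        rw [Function.update_self, Function.update_of_ne hkj]
        linear_combination -h
      have hz2 : u k - u j ≠ 0 := sub_ne_zero.2 fun h => hkj (hl h)
      have ha1 : u j + 2 - u k - 2 / N ≠ 0 := by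
        have := (hu j k 1).1 hkj.symm
        rw [show u j - u k + 2 * ((1 : ℤ) : ℂ) = u j + 2 - u k by push_cast; ring] at this
        exact sub_ne_zero.2 this
      have ha2 : u k - u j - 2 / N ≠ 0 := sub_ne_zero.2 (hu.sub_ne hkj)
      rw [rb, rb, inv_div, inv_div, mul_div_assoc', mul_div_assoc', div_eq_div_iff hz1 hz2]
      unfold tauPair
      rw [Function.update_self, Function.update_of_ne hkj]
      rcases lt_or_gt_of_ne hkj with h | h
      · simp only [h, if_true]
        have h0 := (hu k j 0).2 h
        have h1 := (hu k j (-1)).2 h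
        rw [show u k - u j + 2 * ((0 : ℤ) : ℂ) = u k - u j by simp] at h0
        rw [show u k - u j + 2 * ((-1 : ℤ) : ℂ) = u k - u j - 2 by push_cast; ring] at h1
        have := hτ.eqn_apply h0 h1
        rw [show u k - (u j + 2) = u k - u j - 2 by ring]
        linear_combination -this
      · simp only [h.not_gt, if_false]
        have h0 := (hu j k 0).2 h
        have h1 := (hu j k 1).2 h
        rw [show u j - u k + 2 * ((0 : ℤ) : ℂ) = u j + 2 - u k - 2 by push_cast; ring] at h0
        rw [show u j - u k + 2 * ((1 : ℤ) : ℂ) = u j + 2 - u k by push_cast; ring] at h1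
        have := hτ.eqn_apply h1 h0
        rw [show u j + 2 - u k - 2 = u j - u k by ring] at this
        linear_combination this
    · refine Finset.prod_congr rfl fun k hk => Finset.prod_congr rfl fun l hl => ?_
      rw [tauPair, tauPair, Function.update_of_ne (hne k hk),
        Function.update_of_ne (hne l (Finset.mem_filter.1 hl).1)]
  unfold lastCoeff firstCoeff
  have e1 : psiProd ψ (Fin.snoc y (s + 2) : Fin (n + 1) → ℂ) (Function.update u j (u j + 2)) =
      psiProd ψ y (Function.update u j (u j + 2)) *
        ∏ k, ψ (s + 2 - Function.update u j (u j + 2) k) := by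
    simp [psiProd, Fin.prod_univ_castSucc]
  have e2 : psiProd ψ (Fin.cons s y : Fin (n + 1) → ℂ) u =
      (∏ k, ψ (s - u k)) * psiProd ψ y u := by
    simp [psiProd, Fin.prod_univ_succ]
  rw [e1, e2, hQ, ← hP, Finset.prod_mul_distrib, Function.update_self]
  rw [hupd fun z => rb N (s + 2 - z), hupd fun z => (rb N (u j + 2 - z))⁻¹]
  rw [show s + 2 - (u j + 2) = s - u j by ring]
  linear_combination (psiProd ψ y u * (∏ i, rb N (y i - u j)) *
    (∏ k, ψ (s + 2 - Function.update u j (u j + 2) k)) *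
    (∏ k ∈ Finset.univ.erase j, rb N (s + 2 - u k)) * rc N (s - u j)) * hT

end Step

/-! ### The telescoping sum behind cyclicity -/

section Cyclic

variable {N : ℕ} {ψ τ : ℂ → ℂ} {d n m : ℕ} {f : (Fin (m + 1) → ℂ) → TensorSpace d (m + 1)}

theorem reducedVector_eq (hN : N ≠ 0) {y : Fin n → ℂ} {u : Fin (m + 1) → ℂ}
    (hu : RegularWithin N τ u) (hyu : ∀ i j, y i - u j ≠ 2 / N)
    (hf : ∀ π : Equiv.Perm (Fin (m + 1)), ExchangeAt N f (u ∘ π)) (α : Fin d)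
    (π : Equiv.Perm (Fin (m + 1))) :
    reducedVector N f y α (π (Fin.last m)) u =
      betheVector N y (Fin.init (u ∘ π)) (lastComponent α (f (u ∘ π))) := by
  rw [← reducedVector_equivariant hN hu hyu hf α π (Fin.last m), reducedVector,
    lastComponent_succ_betheVector_of_eq hN]
  · simp
  · simp
  · intro i k
    simpa using hyu i _
  · intro k
    simpa using snoc_sub_ne hN hu hyu (π (Fin.last m)) (Fin.last n) (π k)

/-- Put the shifted parameter last; cyclicity of `f` then undoes the shift and moves the parameter
to the first place. This identifies the vectors of the two expansions. -/
theorem reducedVector_update_eq (hN : N ≠ 0) {y : Fin n → ℂ} {u : Fin (m + 1) → ℂ} (j : Fin (m + 1))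
    (hu : RegularWithin N τ (Function.update u j (u j + 2)))
    (hyu : ∀ i k, y i - Function.update u j (u j + 2) k ≠ 2 / N)
    (hf : ∀ π : Equiv.Perm (Fin (m + 1)), ExchangeAt N f (Function.update u j (u j + 2) ∘ π))
    (α : Fin d) (π : Equiv.Perm (Fin (m + 1))) (hπ : π (Fin.last m) = j)
    (hc : CyclicAt f (u ∘ π)) :
    reducedVector N f y α j (Function.update u j (u j + 2)) =
      betheVector N y (Fin.tail (u ∘ (π * (finRotate (m + 1)).symm : Equiv.Perm (Fin (m + 1)))))
        (auxComponent α (f (u ∘ (π * (finRotate (m + 1)).symm : Equiv.Perm (Fin (m + 1)))))) := by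
  have h := reducedVector_eq hN hu hyu hf α π
  have e : Function.update u j (u j + 2) ∘ π =
      Function.update (u ∘ π) (Fin.last m) ((u ∘ π) (Fin.last m) + 2) := by
    rw [update_comp_perm, Function.comp_apply, hπ]
  have e' : u ∘ (π * (finRotate (m + 1)).symm : Equiv.Perm (Fin (m + 1))) =
      (u ∘ π) ∘ (finRotate (m + 1)).symm := rfl
  rw [hπ, e] at h
  rw [h, e', Fin.init_update_last, comp_finRotate_symm (u ∘ π), Fin.tail_cons]
  congr 1
  funext δ
  rw [lastComponent_apply, hc (Fin.last m) (by simp), comp_finRotate_symm (u ∘ π),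
    comp_finRotate_symm, Fin.snoc_last, Fin.init_snoc, auxComponent_apply]

theorem exists_norm_prod_le {ι L : Type*} (S : Finset ι) (F : ι → L → ℂ) (P : L → Prop)
    (h : ∀ i ∈ S, ∃ C : ℝ, 0 ≤ C ∧ ∀ l, P l → ‖F i l‖ ≤ C) :
    ∃ C : ℝ, 0 ≤ C ∧ ∀ l, P l → ‖∏ i ∈ S, F i l‖ ≤ C := by
  choose! C hC h using h
  refine ⟨∏ i ∈ S, C i, Finset.prod_nonneg hC, fun l hl => ?_⟩
  rw [norm_prod]
  exact Finset.prod_le_prod (fun _ _ => norm_nonneg _) fun i hi => h i hi l hl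

theorem exists_norm_rb_inv_lattice_le {m : ℕ} (N : ℕ) (ut : Fin m → ℂ) {i j : Fin m} (hij : i ≠ j) :
    ∃ C : ℝ, 0 ≤ C ∧ ∀ l, Function.Injective (latticePoint ut l) →
      ‖(rb N (latticePoint ut l i - latticePoint ut l j))⁻¹‖ ≤ C := by
  obtain ⟨C, hC, h⟩ := exists_norm_rb_inv_le N (ut i - ut j)
  refine ⟨C, hC, fun l hl => ?_⟩
  rw [latticePoint_sub_latticePoint]
  refine h _ ?_
  rw [← latticePoint_sub_latticePoint]
  exact sub_ne_zero.2 fun h => hij (hl h)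

theorem exists_norm_lastCoeff_le {m : ℕ} (N : ℕ) (s : ℂ) (ut : Fin m → ℂ)
    (hs : ∀ j (l : ℤ), s - ut j + 2 * l ≠ 2 / N) (j : Fin m) :
    ∃ C : ℝ, 0 ≤ C ∧ ∀ l, Function.Injective (latticePoint ut l) →
      ‖rc N (s - latticePoint ut l j) * ∏ i ∈ Finset.univ.erase j, rb N (s - latticePoint ut l i) *
        (rb N (latticePoint ut l j - latticePoint ut l i))⁻¹‖ ≤ C * (1 + |(l j : ℝ)|)⁻¹ := by
  obtain ⟨Cc, hCc, hc⟩ := exists_norm_rc_le N (s - ut j) (hs j)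
  obtain ⟨C, hC, h⟩ := exists_norm_prod_le (Finset.univ.erase j)
    (fun i l => rb N (s - latticePoint ut l i) *
      (rb N (latticePoint ut l j - latticePoint ut l i))⁻¹)
    (fun l => Function.Injective (latticePoint ut l)) (fun i hi => by
      obtain ⟨C, hC, h⟩ := exists_norm_rb_le N (s - ut i) (hs i)
      obtain ⟨C', hC', h'⟩ := exists_norm_rb_inv_lattice_le N ut (Finset.mem_erase.1 hi).1.symm
      refine ⟨C * C', by positivity, fun l hl => ?_⟩
      rw [norm_mul, sub_latticePoint]
      exact mul_le_mul (h _) (h' l hl) (norm_nonneg _) hC)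
  refine ⟨Cc * C, by positivity, fun l hl => ?_⟩
  rw [norm_mul, sub_latticePoint, mul_right_comm]
  exact mul_le_mul (hc _) (h l hl) (norm_nonneg _) (by positivity)

theorem exists_norm_firstCoeff_le {m : ℕ} (N : ℕ) (y : Fin n → ℂ) (s : ℂ) (ut : Fin m → ℂ)
    (hs : ∀ j (l : ℤ), s - ut j + 2 * l ≠ 2 / N)
    (hy : ∀ i j (l : ℤ), y i - ut j + 2 * l ≠ 2 / N) (j : Fin m) :
    ∃ C : ℝ, 0 ≤ C ∧ ∀ l, Function.Injective (latticePoint ut l) →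
      ‖rc N (s - latticePoint ut l j) * (∏ i, rb N (y i - latticePoint ut l j)) *
        ∏ i ∈ Finset.univ.erase j, (rb N (latticePoint ut l i - latticePoint ut l j))⁻¹‖ ≤
        C * (1 + |(l j : ℝ)|)⁻¹ := by
  obtain ⟨Cc, hCc, hc⟩ := exists_norm_rc_le N (s - ut j) (hs j)
  obtain ⟨C, hC, h⟩ := exists_norm_prod_le (Finset.univ.erase j)
    (fun i l => (rb N (latticePoint ut l i - latticePoint ut l j))⁻¹)
    (fun l => Function.Injective (latticePoint ut l)) (fun i hi =>
      exists_norm_rb_inv_lattice_le N ut (Finset.mem_erase.1 hi).1)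
  obtain ⟨C', hC', h'⟩ := exists_norm_prod_le Finset.univ
    (fun i (l : Fin m → ℤ) => rb N (y i - latticePoint ut l j)) (fun _ => True) (fun i _ => by
      obtain ⟨C, hC, h⟩ := exists_norm_rb_le N (y i - ut j) (hy i j)
      refine ⟨C, hC, fun l _ => ?_⟩
      rw [sub_latticePoint]
      exact h _)
  refine ⟨Cc * C' * C, by positivity, fun l hl => ?_⟩
  have h1 := hc (l j)
  rw [← sub_latticePoint] at h1
  rw [norm_mul, norm_mul]
  calc _ ≤ Cc * (1 + |(l j : ℝ)|)⁻¹ * C' * C :=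
        mul_le_mul (mul_le_mul h1 (h' l trivial) (norm_nonneg _) (by positivity)) (h l hl)
          (norm_nonneg _) (by positivity)
    _ = _ := by ring

/-- The decay in the direction of the dropped parameter is missing here; the factor `c` of the
coefficients supplies it in `norm_boundaryTerm_le`. -/
theorem exists_norm_betheVector_tail_le {m : ℕ} (N : ℕ) (y : Fin n → ℂ) (ut : Fin (m + 1) → ℂ)
    (hy : ∀ i j (l : ℤ), y i - ut j + 2 * l ≠ 2 / N) (π : Equiv.Perm (Fin (m + 1))) :
    ∃ C : ℝ, 0 ≤ C ∧ ∀ (l : Fin (m + 1) → ℤ) (g : TensorSpace d m),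
      ‖betheVector N y (Fin.tail (latticePoint ut l ∘ π)) g‖ ≤
        C * (∏ i ∈ Finset.univ.erase (π 0), (1 + |(l i : ℝ)|)⁻¹) * ‖g‖ := by
  obtain ⟨C, hC, h⟩ := exists_norm_betheVector_le N (d := d) y (Fin.tail (ut ∘ π))
    (fun i j => hy i _)
  refine ⟨C, hC, fun l g => ?_⟩
  have := h (Fin.tail (l ∘ π)) g
  rw [← prod_perm_succ π fun i => (1 + |(l i : ℝ)|)⁻¹]
  exact this

/-- The bound that makes the boundary terms of the telescoping sum summable. -/
theorem norm_boundaryTerm_le {m : ℕ} {E F : Type*} [NormedAddCommGroup E] [NormedSpace ℂ E]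
    [NormedAddCommGroup F] [NormedSpace ℂ F]
    (l : Fin m → ℤ) (j : Fin m) {T Ψ c : ℂ} {Z : E} {v : F} {C C' C'' : ℝ} (hC : 0 ≤ C)
    (hc : ‖c‖ ≤ C * (1 + |(l j : ℝ)|)⁻¹)
    (hZ : ‖Z‖ ≤ C' * (∏ i ∈ Finset.univ.erase j, (1 + |(l i : ℝ)|)⁻¹) * (C'' * ‖v‖)) :
    ‖T • (Ψ * c) • Z‖ ≤ C * C' * C'' * (‖(Ψ * T) • v‖ * ∏ i, (1 + |(l i : ℝ)|)⁻¹) := by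
  rw [norm_smul, norm_smul, norm_mul, norm_smul, norm_mul,
    ← Finset.mul_prod_erase _ _ (Finset.mem_univ j)]
  calc _ ≤ ‖T‖ * (‖Ψ‖ * (C * (1 + |(l j : ℝ)|)⁻¹) *
        (C' * (∏ i ∈ Finset.univ.erase j, (1 + |(l i : ℝ)|)⁻¹) * (C'' * ‖v‖))) := by gcongr
    _ = _ := by ring

/-- The summands do not vanish individually: for distinct parameters each is a sum over `j` of a
term minus its translate in direction `j`. -/
theorem hasSum_boundaryTerms (hN : N ≠ 0) (hψ : IsPsi N ψ) (hτ : IsTau N τ) {y : Fin n → ℂ} {s : ℂ}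
    {ut : Fin (m + 1) → ℂ} (hut : RegularWithin N τ ut)
    (hx : RegularBetween N ψ (Fin.cons s y : Fin (n + 1) → ℂ) ut)
    (hx' : RegularBetween N ψ (Fin.snoc y (s + 2) : Fin (n + 1) → ℂ) ut)
    (h1 : LevelConverges ψ τ f ut (Fin.cons s y : Fin (n + 1) → ℂ))
    (h2 : LevelConverges ψ τ f ut (Fin.snoc y (s + 2) : Fin (n + 1) → ℂ))
    (hf : ∀ (π : Equiv.Perm (Fin (m + 1))) l, ExchangeAt N f (latticePoint ut l ∘ π))
    (hc : ∀ (π : Equiv.Perm (Fin (m + 1))) l, CyclicAt f (latticePoint ut l ∘ π)) (α : Fin d) :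
    HasSum (fun l => lastComponent α.succ (betheVector N (Fin.snoc y (s + 2) : Fin (n + 1) → ℂ)
        (latticePoint ut l) (dressed ψ τ (Fin.snoc y (s + 2) : Fin (n + 1) → ℂ)
          (latticePoint ut l) (f (latticePoint ut l)))) -
      auxComponent α.succ (betheVector N (Fin.cons s y : Fin (n + 1) → ℂ)
        (latticePoint ut l) (dressed ψ τ (Fin.cons s y : Fin (n + 1) → ℂ)
          (latticePoint ut l) (f (latticePoint ut l))))) 0 := by
  have hyu : ∀ l i j, y i - latticePoint ut l j ≠ 2 / N := fun l i j => by
    simpa using hx.sub_ne l i.succ j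
  have hsu : ∀ l j, s - latticePoint ut l j ≠ 2 / N := fun l j => by simpa using hx.sub_ne l 0 j
  have hsu' : ∀ l j, s + 2 - latticePoint ut l j ≠ 2 / N := fun l j => by
    simpa using hx'.sub_ne l (Fin.last n) j
  have hy0 : ∀ i j (l : ℤ), y i - ut j + 2 * l ≠ 2 / N := fun i j l => by
    simpa using (hx i.succ j l).1
  have hs0 : ∀ j (l : ℤ), s - ut j + 2 * l ≠ 2 / N := fun j l => by simpa using (hx 0 j l).1
  have hs0' : ∀ j (l : ℤ), s + 2 - ut j + 2 * l ≠ 2 / N := fun j l => by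
    simpa using (hx' (Fin.last n) j l).1
  -- `π j` puts the parameter `j` last, for the last-space expansion; `ρ j` rotates it on to the
  -- first place, for the other one.
  set π : Fin (m + 1) → Equiv.Perm (Fin (m + 1)) := fun j => Equiv.swap j (Fin.last m) with hπ
  have hπl : ∀ j, π j (Fin.last m) = j := fun j => by simp [hπ]
  set ρ : Fin (m + 1) → Equiv.Perm (Fin (m + 1)) := fun j => π j * (finRotate (m + 1)).symm with hρ
  have hρ0 : ∀ j, ρ j 0 = j := fun j => by
    rw [hρ, Equiv.Perm.mul_apply, finRotate_symm_zero, hπl]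
  have hZ : ∀ l j, reducedVector N f y α j (latticePoint ut l) =
      betheVector N y (Fin.init (latticePoint ut l ∘ π j))
        (lastComponent α (f (latticePoint ut l ∘ π j))) := fun l j => by
    have := reducedVector_eq hN (hut.latticePoint l) (hyu l) (fun π => hf π l) α (π j)
    rwa [hπl] at this
  have hZ' : ∀ l j, reducedVector N f y α j
      (Function.update (latticePoint ut l) j (latticePoint ut l j + 2)) =
      betheVector N y (Fin.tail (latticePoint ut l ∘ ρ j))
        (auxComponent α (f (latticePoint ut l ∘ ρ j))) := fun l j => by
    refine reducedVector_update_eq (τ := τ) hN j ?_ ?_ ?_ α (π j) (hπl j) (hc (π j) l)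
    · rw [← latticePoint_sub_single]
      exact hut.latticePoint _
    · rw [← latticePoint_sub_single]
      exact hyu _
    · rw [← latticePoint_sub_single]
      exact fun π => hf π _
  -- An equivariant family times the sign-changing product of `τ` cancels between two points related
  -- by a swap.
  have hcancel : ∀ (K : Fin (m + 1) → (Fin (m + 1) → ℂ) → TensorSpace (d + 1) n) (u v : Fin (m + 1) → ℂ)
      (i j : Fin (m + 1)), Equivariant K u → v = u ∘ Equiv.swap i j → tauProd τ u = -tauProd τ v →
      tauProd τ u • K i u + tauProd τ v • K j v = 0 := by
    rintro K u v i j hK rfl hT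
    rw [hK, Equiv.swap_apply_right, hT, neg_smul, neg_add_cancel]
  have hKX : ∀ l, Equivariant (fun j u => lastCoeff N ψ y s j u • reducedVector N f y α j u)
      (latticePoint ut l) := fun l σ j => by
    change lastCoeff N ψ y s j _ • reducedVector N f y α j _ = _
    rw [lastCoeff_equivariant y s _ σ j,
      reducedVector_equivariant hN (hut.latticePoint l) (hyu l) (fun π => hf π l) α σ j]
  have hKY : ∀ l, Equivariant (fun j u => firstCoeff N ψ y s j u •
      reducedVector N f y α j (Function.update u j (u j + 2))) (latticePoint ut l) := fun l σ j => by
    change firstCoeff N ψ y s j _ • reducedVector N f y α j _ = _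
    rw [firstCoeff_equivariant y s _ σ j, update_comp_perm, Function.comp_apply,
      ← latticePoint_sub_single,
      reducedVector_equivariant hN (hut.latticePoint _) (hyu _) (fun π => hf π _) α σ j,
      latticePoint_sub_single]
  refine hasSum_zero_of_telescoping (fun j : Fin (m + 1) => (Pi.single j 1 : Fin (m + 1) → ℤ))
    {l | Function.Injective (latticePoint ut l)}
    (fun j l => tauProd τ (latticePoint ut l) • (fun j u => lastCoeff N ψ y s j u •
      reducedVector N f y α j u) j (latticePoint ut l))
    (fun j l => tauProd τ (latticePoint ut l) • (fun j u => firstCoeff N ψ y s j u •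
      reducedVector N f y α j (Function.update u j (u j + 2))) j (latticePoint ut l))
    _ (fun l hl => ?_) (fun l hl => ?_) (fun l j hl hl' => ?_) (fun l hl => ?_) (fun j => ?_)
    (fun j => ?_)
  · have hne : ∀ i j, i ≠ j → latticePoint ut l i - latticePoint ut l j ≠ 2 / N := fun i j h =>
      (hut.latticePoint l).sub_ne h
    rw [dressed_eq, dressed_eq, betheVector_smul, betheVector_smul, map_smul, map_smul,
      lastComponent_succ_betheVector hN y _ _ hl hne (hyu l) (hsu' l) f (fun π => hf π l) π hπl,
      auxComponent_succ_betheVector y _ _ hl hne (hyu l) (hsu l) f (fun π => hf π l) ρ hρ0,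
      Finset.sum_sub_distrib, Finset.smul_sum, Finset.smul_sum]
    congr 1
    · refine Finset.sum_congr rfl fun j _ => ?_
      simp only [hZ, smul_smul, lastCoeff]
      congr 1
      ring
    · refine Finset.sum_congr rfl fun j _ => ?_
      simp only [hZ', smul_smul, firstCoeff]
      congr 1
      ring
  · have := tauProd_eq_zero hN hτ (hut.latticePoint l) hl
    rw [dressed_eq, dressed_eq, this, mul_zero, mul_zero, zero_smul]
    have h0 : ∀ x : Fin (n + 1) → ℂ,
        betheVector N x (latticePoint ut l) (0 : TensorSpace d (m + 1)) = 0 := fun x => by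
      simp [betheVector]
    rw [h0, h0, map_zero, map_zero, sub_zero]
  · have := lastCoeff_mul_tauProd_update hψ hτ hut hx l hl j hl'
    simp only [smul_smul, this]
    rw [latticePoint_sub_single]
  -- If `u i = u j`, a unit shift can separate the parameters only in direction `i` or `j`, and it
  -- does so in both or in neither.
  · obtain ⟨i, j, hij, hne⟩ : ∃ i j, latticePoint ut l i = latticePoint ut l j ∧ i ≠ j := by
      simpa [Function.Injective] using hl
    have hs1 := fun e => update_eq_update_comp_swap hij e
    have hk : ∀ k e, k ≠ i → k ≠ j → ¬ Function.Injective (Function.update (latticePoint ut l) k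
        (latticePoint ut l k + e)) := fun k e hki hkj hinj => hne (hinj (by
      rw [Function.update_of_ne hki.symm, Function.update_of_ne hkj.symm, hij]))
    have hT := fun e he => tauProd_update hN hτ (hut.latticePoint l) hne hij (e := e) he
    simp only [Set.mem_ofPred_eq]
    refine ⟨i, j, hne, fun k hki hkj => ?_, ?_, ?_, ?_, ?_⟩
    · rw [latticePoint_sub_single, latticePoint_add_single]
      exact ⟨hk k 2 hki hkj, hk k (-2) hki hkj⟩
    · rw [latticePoint_sub_single, latticePoint_sub_single, hs1 2, Equiv.injective_comp]
    · rw [latticePoint_add_single, latticePoint_add_single, hs1 (-2), Equiv.injective_comp]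
    · refine hcancel (fun j u => lastCoeff N ψ y s j u • reducedVector N f y α j u) _ _ i j
        (hKX _) ?_ ?_
      · rw [latticePoint_sub_single, latticePoint_sub_single, hs1 2]
      · rw [latticePoint_sub_single, latticePoint_sub_single, hT 2 (Or.inl rfl)]
    · refine hcancel (fun j u => firstCoeff N ψ y s j u •
        reducedVector N f y α j (Function.update u j (u j + 2))) _ _ i j (hKY _) ?_ ?_
      · rw [latticePoint_add_single, latticePoint_add_single, hs1 (-2)]
      · rw [latticePoint_add_single, latticePoint_add_single, hT (-2) (Or.inr rfl)]
  · obtain ⟨C, hC, hb⟩ := exists_norm_lastCoeff_le N (s + 2) ut hs0' j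
    obtain ⟨C', hC', hb'⟩ := exists_norm_betheVector_tail_le (d := d) N y ut hy0 (ρ j)
    obtain ⟨C'', hC'', hb''⟩ := exists_norm_comp_perm_le hut hf (π j)
    refine ⟨_, h2.summable_norm.mul_left (C * C' * C''), fun l => by positivity, fun l hl => ?_⟩
    refine norm_boundaryTerm_le l j hC (hb l hl) ?_
    rw [hZ]
    have e : Fin.init (latticePoint ut l ∘ π j) = Fin.tail (latticePoint ut l ∘ ρ j) := by
      change _ = Fin.tail ((latticePoint ut l ∘ π j) ∘ (finRotate (m + 1)).symm)
      rw [comp_finRotate_symm, Fin.tail_cons]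
    rw [e]
    have := hb' l (lastComponent α (f (latticePoint ut l ∘ π j)))
    rw [hρ0] at this
    refine this.trans ?_
    gcongr
    exact (norm_lastComponent_le _ _).trans (hb'' l)
  · obtain ⟨C, hC, hb⟩ := exists_norm_firstCoeff_le N y s ut hs0 hy0 j
    obtain ⟨C', hC', hb'⟩ := exists_norm_betheVector_tail_le (d := d) N y ut hy0 (ρ j)
    obtain ⟨C'', hC'', hb''⟩ := exists_norm_comp_perm_le hut hf (ρ j)
    refine ⟨_, h1.summable_norm.mul_left (C * C' * C''), fun l => by positivity, fun l hl => ?_⟩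
    refine norm_boundaryTerm_le l j hC (hb l hl) ?_
    rw [hZ']
    have := hb' l (auxComponent α (f (latticePoint ut l ∘ ρ j)))
    rw [hρ0] at this
    refine this.trans ?_
    gcongr
    exact (norm_auxComponent_le _ _).trans (hb'' l)

end Cyclic

/-- The cyclicity property is inherited by the next level. -/
theorem levelSum_cyclicAt {N : ℕ} {ψ τ : ℂ → ℂ} {d n m : ℕ}
    {f : (Fin m → ℂ) → TensorSpace d m} (hN : N ≠ 0) (hψ : IsPsi N ψ) (hτ : IsTau N τ)
    {ut : Fin m → ℂ} (hut : RegularWithin N τ ut)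
    (hf : ∀ (π : Equiv.Perm (Fin m)) l, ExchangeAt N f (latticePoint ut l ∘ π))
    (hc : ∀ (π : Equiv.Perm (Fin m)) l, CyclicAt f (latticePoint ut l ∘ π))
    {x : Fin n → ℂ} (hx : RegularBetween N ψ x ut) (h1 : LevelConverges ψ τ f ut x)
    (h2 : ∀ p : Fin n, (p : ℕ) + 1 = n →
      LevelConverges ψ τ f ut (Function.update x p (x p + 2))) :
    CyclicAt (levelSum N ψ τ f ut : (Fin n → ℂ) → TensorSpace (d + 1) n) x := by
  intro p hp β
  obtain ⟨n, rfl⟩ : ∃ k, n = k + 1 := ⟨p, hp.symm⟩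
  obtain rfl : p = Fin.last n := Fin.ext (by simpa using hp)
  obtain ⟨y, s, rfl⟩ : ∃ (y : Fin n → ℂ) (s : ℂ), x = (Fin.snoc y s : Fin (n + 1) → ℂ) :=
    ⟨Fin.init x, x (Fin.last n), by simp⟩
  obtain ⟨δ, γ, rfl⟩ : ∃ (δ : Fin n → Fin (d + 1)) (γ : Fin (d + 1)),
    β = (Fin.snoc δ γ : Fin (n + 1) → Fin (d + 1)) := ⟨Fin.init β, β (Fin.last n), by simp⟩
  have h2 := h2 (Fin.last n) hp
  have h1 := h1.comp_perm (finRotate (n + 1)).symm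
  have hxc := hx.comp_perm (finRotate (n + 1)).symm
  rw [comp_finRotate_symm] at h1 hxc
  rw [comp_finRotate_symm, comp_finRotate_symm]
  simp only [Fin.snoc_last, Fin.init_snoc, Fin.update_snoc_last] at h1 h2 hxc ⊢
  have hx' : RegularBetween N ψ (Fin.snoc y (s + 2) : Fin (n + 1) → ℂ) ut := by
    intro i j l
    refine Fin.lastCases ?_ (fun i => ?_) i
    · have := hx (Fin.last n) j (l + 1)
      rw [Fin.snoc_last] at this ⊢
      rwa [show s - ut j + 2 * ((l + 1 : ℤ) : ℂ) = s + 2 - ut j + 2 * (l : ℂ) by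
        push_cast; ring] at this
    · have := hx i.castSucc j l
      rw [Fin.snoc_castSucc] at this ⊢
      exact this
  suffices lastComponent γ (levelSum N ψ τ f ut (Fin.snoc y (s + 2) : Fin (n + 1) → ℂ)) =
      auxComponent γ (levelSum N ψ τ f ut (Fin.cons s y : Fin (n + 1) → ℂ)) from congrFun this δ
  have e1 := (h2.hasSum hx').mapLinear (lastComponent γ)
  have e2 := (h1.hasSum hxc).mapLinear (auxComponent γ)
  refine Fin.cases (fun e1 e2 => ?_) (fun α e1 e2 => ?_) γ e1 e2
  -- For the first colour the sums agree termwise: the factors `b` from the last space turn `ψ` at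
  -- `s + 2` into `ψ` at `s`.
  · refine e1.unique ?_
    convert e2 using 2 with l
    have hsu' : ∀ j, s - latticePoint ut l j ≠ 2 / N := fun j => by simpa using hxc.sub_ne l 0 j
    rw [dressed_eq, dressed_eq, betheVector_smul, betheVector_smul, map_smul, map_smul,
      lastComponent_zero_betheVector, auxComponent_zero_betheVector _ _ (by simpa using hsu'),
      smul_smul, Fin.init_snoc, Fin.tail_cons, Fin.snoc_last]
    congr 1
    have hψs : ∀ j, ψ (s + 2 - latticePoint ut l j) * rb N (s + 2 - latticePoint ut l j) =
        ψ (s - latticePoint ut l j) := by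
      intro j
      have a1 := hx' (Fin.last n) j (l j)
      have a2 := hxc 0 j (l j)
      rw [Fin.snoc_last, ← sub_latticePoint] at a1
      rw [Fin.cons_zero, ← sub_latticePoint] at a2
      have e : s + 2 - latticePoint ut l j - 2 = s - latticePoint ut l j := by ring
      rw [mul_comm, hψ.eqn_apply a1.1 a1.2 (by rw [e]; exact a2.2), e]
    have hP : psiProd ψ (Fin.cons s y : Fin (n + 1) → ℂ) (latticePoint ut l) =
        psiProd ψ (Fin.snoc y (s + 2) : Fin (n + 1) → ℂ) (latticePoint ut l) *
          ∏ j, rb N (s + 2 - latticePoint ut l j) := by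
      unfold psiProd
      rw [Fin.prod_univ_succ, Fin.prod_univ_castSucc, mul_assoc]
      simp only [Fin.cons_zero, Fin.cons_succ, Fin.snoc_castSucc, Fin.snoc_last,
        ← Finset.prod_mul_distrib, hψs]
      ring
    rw [hP]
    ring
  -- For the other colours both components vanish if there are no parameters; otherwise only the
  -- whole sums agree, by telescoping.
  · cases m with
    | zero =>
      refine e1.unique ?_
      convert e2 using 2 with l
      simp [betheVector_zero, lastComponent_refState, refState_cons]
    | succ m =>
      have h := hasSum_boundaryTerms hN hψ hτ hut hxc hx' h1 h2 hf hc α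
      exact sub_eq_zero.1 ((e1.sub e2).unique h)

/-! ### From exchange and cyclicity to the difference equation -/

theorem filter_lt_finRange {n : ℕ} (i : Fin n) :
    (List.finRange n).filter (fun j => j < i) = (List.finRange n).take i := by
  conv_lhs => rw [← List.take_append_drop i (List.finRange n)]
  rw [List.filter_append, List.filter_eq_self.2, List.filter_eq_nil_iff.2, List.append_nil]
  · intro j hj
    obtain ⟨k, hk, rfl⟩ := List.mem_drop_iff_getElem.1 hj
    simp [Fin.lt_def]
  · intro j hj
    obtain ⟨k, hk, rfl⟩ := List.mem_take_iff_getElem.1 hj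
    have := (lt_min_iff.1 hk).1
    simpa [Fin.lt_def] using this

theorem filter_gt_finRange {n : ℕ} (i : Fin n) :
    (List.finRange n).filter (fun j => i < j) = (List.finRange n).drop (i + 1) := by
  conv_lhs => rw [← List.take_append_drop (i + 1) (List.finRange n)]
  rw [List.filter_append, List.filter_eq_nil_iff.2, List.filter_eq_self.2, List.nil_append]
  · intro j hj
    obtain ⟨k, hk, rfl⟩ := List.mem_drop_iff_getElem.1 hj
    simp [Fin.lt_def]
    omega
  · intro j hj
    obtain ⟨k, hk, rfl⟩ := List.mem_take_iff_getElem.1 hj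
    have := (lt_min_iff.1 hk).1
    simp [Fin.lt_def]
    omega

section Transport

variable {N d n : ℕ} {g : (Fin n → ℂ) → TensorSpace d n}

/-- The value of `g` at the permuted arguments `x ∘ π`, with the tensor factors permuted back. -/
def permutedValue (g : (Fin n → ℂ) → TensorSpace d n) (x : Fin n → ℂ) (π : Equiv.Perm (Fin n)) :
    TensorSpace d n :=
  fun β => g (x ∘ π) (β ∘ π)

/-- Permuting the factors back turns an exchange of neighbouring places into an R-matrix on the
original factors, as in the formula for `Q`. -/
theorem permutedValue_mul_swap {x : Fin n → ℂ} {π : Equiv.Perm (Fin n)}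
    (h : ExchangeAt N g (x ∘ π)) {p q : Fin n} (hpq : (q : ℕ) = p + 1)
    (hne : x (π p) - x (π q) ≠ 2 / N) :
    permutedValue g x (π * Equiv.swap p q) =
      rMatrix N (π p) (π q) (x (π p) - x (π q)) (permutedValue g x π) := by
  funext β
  have e : ∀ {X : Type} (v : Fin n → X),
      v ∘ (π * Equiv.swap p q : Equiv.Perm (Fin n)) = (v ∘ π) ∘ Equiv.swap p q := fun v => rfl
  have e' : (β ∘ Equiv.swap (π p) (π q)) ∘ π = (β ∘ π) ∘ Equiv.swap p q := by
    funext k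
    simp only [Function.comp_apply]
    rw [Equiv.swap_apply_apply]
    simp
  rw [rMatrix_apply, permutedValue, permutedValue, permutedValue, e, e, e', h p q hpq hne,
    permSites_apply, rMatrix_apply]
  congr 3
  · funext k
    simp
  · funext k
    simp

/-- Moving the argument `i` to the first place. -/
theorem exists_permutedValue_moveFirst {x : Fin n → ℂ}
    (h : ∀ π : Equiv.Perm (Fin n), ExchangeAt N g (x ∘ π)) (i : Fin n)
    (hne : ∀ j, j < i → x j - x i ≠ 2 / N) (k : ℕ) (hk : k ≤ i) :
    ∃ π : Equiv.Perm (Fin n), (∀ j : Fin n, (j : ℕ) < k ∨ i < j → π j = j) ∧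
      (∀ j : Fin n, (j : ℕ) = k → π j = i) ∧
      (∀ j : Fin n, k < (j : ℕ) → j ≤ i → (π j : ℕ) + 1 = j) ∧
      permutedValue g x π = ((((List.finRange n).take i).drop k).map
        fun j => rMatrix N j i (x j - x i)).prod (g x) := by
  induction hk using Nat.decreasingInduction with
  | self =>
    refine ⟨1, fun _ _ => rfl, fun j hj => Fin.ext hj, fun j h1 h2 => ?_, ?_⟩
    · exact absurd h1 (not_lt.2 h2)
    · rw [List.drop_eq_nil_of_le (by simp)]
      rfl
  | of_succ k hk ih =>
    obtain ⟨π, h1, h2, h3, h4⟩ := ih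
    have hkn : k < n := by omega
    have hkn' : k + 1 < n := by omega
    have hp : π ⟨k, hkn⟩ = ⟨k, hkn⟩ := h1 _ (Or.inl (by simp))
    have hq : π ⟨k + 1, hkn'⟩ = i := h2 _ rfl
    have hst := permutedValue_mul_swap (h π) (p := ⟨k, hkn⟩) (q := ⟨k + 1, hkn'⟩) rfl
      (by rw [hp, hq]; exact hne _ (Fin.lt_def.2 hk))
    refine ⟨π * Equiv.swap ⟨k, hkn⟩ ⟨k + 1, hkn'⟩, fun j hj => ?_, fun j hj => ?_,
      fun j hj hj' => ?_, ?_⟩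
    · rw [Equiv.Perm.mul_apply, Equiv.swap_apply_of_ne_of_ne]
      · exact h1 j (by omega)
      · simp only [ne_eq, Fin.ext_iff]; omega
      · simp only [ne_eq, Fin.ext_iff]; omega
    · obtain rfl : j = ⟨k, hkn⟩ := Fin.ext hj
      simpa using hq
    · rcases eq_or_ne (j : ℕ) (k + 1) with e | e
      · obtain rfl : j = ⟨k + 1, hkn'⟩ := Fin.ext e
        simp [hp]
      · rw [Equiv.Perm.mul_apply, Equiv.swap_apply_of_ne_of_ne]
        · exact h3 j (by omega) hj'
        · simp only [ne_eq, Fin.ext_iff]; omega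
        · simp only [ne_eq, Fin.ext_iff]; omega
    · rw [hst, h4, hp, hq, List.drop_eq_getElem_cons (i := k) (by simp; omega), List.map_cons,
        List.prod_cons, Module.End.mul_apply]
      simp

/-- Moving the argument `i` back from a later place. -/
theorem exists_permutedValue_moveBack {x : Fin n → ℂ}
    (h : ∀ π : Equiv.Perm (Fin n), ExchangeAt N g (x ∘ π)) (i : Fin n)
    (hne : ∀ j, i < j → x j - x i ≠ 2 / N) (t : ℕ) (ht : i + t < n) :
    ∃ σ : Equiv.Perm (Fin n), (∀ j : Fin n, j < i ∨ i + t < (j : ℕ) → σ j = j) ∧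
      (∀ j : Fin n, (j : ℕ) = i + t → σ j = i) ∧
      (∀ j : Fin n, i ≤ j → (j : ℕ) < i + t → (σ j : ℕ) = j + 1) ∧
      g x = ((((List.finRange n).drop (i + 1)).take t).map
        fun j => rMatrix N j i (x j - x i)).prod (permutedValue g x σ) := by
  induction t with
  | zero =>
    refine ⟨1, fun _ _ => rfl, fun j hj => Fin.ext hj, fun j h1 h2 => ?_, ?_⟩
    · exact absurd h2 (not_lt.2 h1)
    · rw [List.take_zero]
      rfl
  | succ t ih =>
    obtain ⟨σ, h1, h2, h3, h4⟩ := ih (by omega)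
    have hkn : i + t < n := by omega
    have hkn' : i + t + 1 < n := by omega
    have hp : σ ⟨i + t, hkn⟩ = i := h2 _ rfl
    have hq : σ ⟨i + t + 1, hkn'⟩ = ⟨i + t + 1, hkn'⟩ := h1 _ (Or.inr (by simp))
    set s := Equiv.swap (⟨i + t, hkn⟩ : Fin n) ⟨i + t + 1, hkn'⟩ with hs
    have hp' : (σ * s) ⟨i + t, hkn⟩ = ⟨i + t + 1, hkn'⟩ := by
      rw [Equiv.Perm.mul_apply, hs, Equiv.swap_apply_left, hq]
    have hq' : (σ * s) ⟨i + t + 1, hkn'⟩ = i := by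
      rw [Equiv.Perm.mul_apply, hs, Equiv.swap_apply_right, hp]
    -- The exchange is applied at `σ * s`, with `i` in the later place; since `s` is an involution
    -- this expresses the value at `σ`.
    have hst := permutedValue_mul_swap (h (σ * s)) (p := ⟨i + t, hkn⟩) (q := ⟨i + t + 1, hkn'⟩) rfl
      (by rw [hp', hq']; exact hne _ (Fin.lt_def.2 (by simp)))
    rw [hp', hq', ← hs, mul_assoc, hs, Equiv.swap_mul_self, mul_one] at hst
    refine ⟨σ * s, fun j hj => ?_, fun j hj => ?_, fun j hj hj' => ?_, ?_⟩
    · rw [Equiv.Perm.mul_apply, hs, Equiv.swap_apply_of_ne_of_ne]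
      · exact h1 j (by omega)
      · simp only [ne_eq, Fin.ext_iff]; omega
      · simp only [ne_eq, Fin.ext_iff]; omega
    · obtain rfl : j = ⟨i + t + 1, hkn'⟩ := Fin.ext hj
      exact hq'
    · rcases eq_or_ne (j : ℕ) (i + t) with e | e
      · obtain rfl : j = ⟨i + t, hkn⟩ := Fin.ext e
        rw [hp']
      · rw [Equiv.Perm.mul_apply, hs, Equiv.swap_apply_of_ne_of_ne]
        · exact h3 j hj (by omega)
        · simp only [ne_eq, Fin.ext_iff]; omega
        · simp only [ne_eq, Fin.ext_iff]; omega
    · rw [List.take_succ_eq_append_getElem (by simp; omega), List.map_append, List.prod_append,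
        Module.End.mul_apply, h4, hst]
      simp [hs, add_right_comm]

/-- The exchange and cyclicity properties imply the matrix difference equation. -/
theorem eq_qMatrix_of_exchangeAt_of_cyclicAt {x : Fin n → ℂ} (i : Fin n)
    (h : ∀ π : Equiv.Perm (Fin n), ExchangeAt N g (x ∘ π))
    (h' : ∀ π : Equiv.Perm (Fin n), ExchangeAt N g (Function.update x i (x i + 2) ∘ π))
    (hc : ∀ π : Equiv.Perm (Fin n), (∀ p : Fin n, (p : ℕ) + 1 = n → π p = i) → CyclicAt g (x ∘ π))
    (hQ₁ : ∀ j, j < i → x j - x i ≠ 2 / N) (hQ₂ : ∀ j, i < j → x j - (x i + 2) ≠ 2 / N) :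
    g (Function.update x i (x i + 2)) = qMatrix N x i (g x) := by
  obtain ⟨n, rfl⟩ : ∃ k, n = k + 1 := ⟨n - 1, by have := i.isLt; omega⟩
  set x' := Function.update x i (x i + 2) with hx'
  have hx'i : x' i = x i + 2 := by simp [hx']
  have hx'j : ∀ j, i < j → x' j = x j := fun j hj => by simp [hx', hj.ne']
  obtain ⟨π, a1, a2, a3, a4⟩ := exists_permutedValue_moveFirst h i hQ₁ 0 (Nat.zero_le _)
  obtain ⟨σ, b1, b2, b3, b4⟩ := exists_permutedValue_moveBack h' i
    (fun j hj => by rw [hx'i, hx'j j hj]; exact hQ₂ j hj) (n - i) (by omega)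
  -- `π` has `i` in the first place and `σ` has it in the last, with the others in their original
  -- order, so a rotation relates them and cyclicity applies.
  have hσ : σ = π * finRotate (n + 1) := by
    ext j
    rw [Equiv.Perm.mul_apply]
    refine Fin.lastCases ?_ (fun j => ?_) j
    · rw [finRotate_last, a2 0 rfl, b2 _ (by simp; omega)]
    · rw [finRotate_apply, Fin.coeSucc_eq_succ]
      rcases lt_or_ge (j : ℕ) i with hj | hj
      · have := a3 j.succ (by simp) (by rw [Fin.le_def]; simpa using hj)
        rw [b1 _ (Or.inl (by rw [Fin.lt_def]; simpa using hj))]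
        simp at this ⊢
        omega
      · rw [b3 _ (by rw [Fin.le_def]; simpa using hj) (by simp; omega),
          a1 _ (Or.inr (by rw [Fin.lt_def]; simp; omega))]
        simp
  have key : permutedValue g x' σ = permutedValue g x π := by
    funext β
    have hl : σ (Fin.last n) = i := b2 _ (by simp; omega)
    have e1 : x' ∘ σ = Function.update (x ∘ σ) (Fin.last n) ((x ∘ σ) (Fin.last n) + 2) := by
      rw [hx', ← hl, update_comp_perm]
      rfl
    have e2 : ∀ {X : Type} (v : Fin (n + 1) → X), (v ∘ σ) ∘ (finRotate (n + 1)).symm = v ∘ π := by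
      intro X v
      funext k
      simp [hσ]
    rw [permutedValue, permutedValue, e1, hc σ (fun p hp => b2 p (by omega)) (Fin.last n) (by simp), e2, e2]
  rw [b4, key, a4, qMatrix, Module.End.mul_apply, filter_lt_finRange, filter_gt_finRange,
    List.drop_zero, List.take_of_length_le (by simp)]
  congr 2
  refine List.map_congr_left fun j hj => ?_
  rw [← filter_gt_finRange, List.mem_filter] at hj
  rw [hx'i, hx'j j (by simpa using hj.2)]

end Transport

/-! ### Induction over the levels -/

theorem exchangeAt_refState (N d n : ℕ) (x : Fin n → ℂ) :
    ExchangeAt N (fun _ => refState d n) x :=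
  fun i j _ hne => (permSites_rMatrix_refState i j hne).symm

theorem cyclicAt_refState (d n : ℕ) (x : Fin n → ℂ) : CyclicAt (fun _ => refState d n) x :=
  fun _ _ β => (refState_comp_perm d n β (finRotate n).symm).symm

theorem update_latticePoint_comp_perm {m : ℕ} (ut : Fin m → ℂ) (l : Fin m → ℤ)
    (π : Equiv.Perm (Fin m)) (p : Fin m) :
    Function.update (latticePoint ut l ∘ π) p ((latticePoint ut l ∘ π) p + 2) =
      latticePoint ut (l - Pi.single (π p) 1) ∘ π := by
  rw [latticePoint_sub_single, update_comp_perm, Function.comp_apply]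

theorem RegularBetween.latticePoint {N : ℕ} {ψ : ℂ → ℂ} {n m : ℕ} {x : Fin n → ℂ} {ut : Fin m → ℂ}
    (h : RegularBetween N ψ x ut) (l : Fin n → ℤ) : RegularBetween N ψ (latticePoint x l) ut := by
  intro i j l'
  have := h i j (l' - l i)
  rwa [show x i - ut j + 2 * ((l' - l i : ℤ) : ℂ) = _root_.latticePoint x l i - ut j + 2 * (l' : ℂ) by
    simp only [_root_.latticePoint]; push_cast; ring] at this

theorem RegularBetween.update {N : ℕ} {ψ : ℂ → ℂ} {n m : ℕ} {x : Fin n → ℂ} {ut : Fin m → ℂ}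
    (h : RegularBetween N ψ x ut) (i : Fin n) :
    RegularBetween N ψ (Function.update x i (x i + 2)) ut := by
  have := h.latticePoint (0 - Pi.single i 1)
  rw [latticePoint_sub_single] at this
  rwa [show _root_.latticePoint x 0 = x by funext k; simp [_root_.latticePoint]] at this

section Levels

variable {N kmax : ℕ} {ψ τ : ℂ → ℂ} {n : ℕ → ℕ} {ut : ∀ k, Fin (n k) → ℂ}

theorem JacksonConverges.nestedBethe {k r d : ℕ} {x : Fin (n k) → ℂ}
    (h : JacksonConverges N kmax ψ τ n ut k x) (hr : r + 1 = kmax - 1 - k) (hd : d + 1 = N - k) :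
    LevelConverges ψ τ (nestedBethe N ψ τ n ut r d (k + 1)) (ut (k + 1)) x := by
  obtain rfl : r = kmax - 1 - (k + 1) := by omega
  obtain rfl : d = N - (k + 1) := by omega
  exact h

/-- Exchange is inherited termwise, so no property of the next level enters, in contrast to
cyclicity. -/
theorem levelFunction_exchangeAt {k : ℕ} {x : Fin (n k) → ℂ}
    (hx : RegularBetween N ψ x (ut (k + 1))) (h : JacksonConverges N kmax ψ τ n ut k x) :
    ExchangeAt N (levelFunction N kmax ψ τ n ut k) x := by
  unfold levelFunction
  generalize hr : kmax - 1 - k = r, hd : N - k = d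
  cases r with
  | zero => exact exchangeAt_refState N d (n k) x
  | succ r =>
    cases d with
    | zero => exact fun i j _ _ => by simp [_root_.nestedBethe]
    | succ d => exact levelSum_exchangeAt (h.nestedBethe hr.symm hd.symm) hx

theorem levelFunction_cyclicAt (hN : N ≠ 0) (hψ : IsPsi N ψ) (hτ : IsTau N τ) {k : ℕ}
    (hut : RegularWithin N τ (ut (k + 1)))
    (hf : ∀ (π : Equiv.Perm (Fin (n (k + 1)))) l,
      ExchangeAt N (levelFunction N kmax ψ τ n ut (k + 1)) (latticePoint (ut (k + 1)) l ∘ π))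
    (hc : ∀ (π : Equiv.Perm (Fin (n (k + 1)))) l,
      CyclicAt (levelFunction N kmax ψ τ n ut (k + 1)) (latticePoint (ut (k + 1)) l ∘ π))
    {x : Fin (n k) → ℂ} (hx : RegularBetween N ψ x (ut (k + 1)))
    (h1 : JacksonConverges N kmax ψ τ n ut k x)
    (h2 : ∀ p : Fin (n k), (p : ℕ) + 1 = n k →
      JacksonConverges N kmax ψ τ n ut k (Function.update x p (x p + 2))) :
    CyclicAt (levelFunction N kmax ψ τ n ut k) x := by
  unfold levelFunction
  generalize hr : kmax - 1 - k = r, hd : N - k = d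
  cases r with
  | zero => exact cyclicAt_refState d (n k) x
  | succ r =>
    cases d with
    | zero => exact fun _ _ _ => rfl
    | succ d =>
      refine levelSum_cyclicAt hN hψ hτ hut (fun π l => ?_) (fun π l => ?_) hx
        (h1.nestedBethe hr.symm hd.symm) fun p hp => (h2 p hp).nestedBethe hr.symm hd.symm
      · obtain rfl : r = kmax - 1 - (k + 1) := by omega
        obtain rfl : d = N - (k + 1) := by omega
        exact hf π l
      · obtain rfl : r = kmax - 1 - (k + 1) := by omega
        obtain rfl : d = N - (k + 1) := by omega
        exact hc π l

theorem JacksonConverges.comp_perm {k : ℕ} {x : Fin (n k) → ℂ}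
    (h : JacksonConverges N kmax ψ τ n ut k x) (π : Equiv.Perm (Fin (n k))) :
    JacksonConverges N kmax ψ τ n ut k (x ∘ π) :=
  LevelConverges.comp_perm (f := levelFunction N kmax ψ τ n ut (k + 1)) h π

/-- On their lattices the functions of the nested Bethe Ansatz have the cyclicity property. -/
theorem levelFunction_cyclicAt_latticePoint (hN : N ≠ 0) (hψ : IsPsi N ψ) (hτ : IsTau N τ)
    (hwithin : ∀ k, 1 ≤ k → RegularWithin N τ (ut k))
    (hbetween : ∀ k, 1 ≤ k → RegularBetween N ψ (ut k) (ut (k + 1)))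
    (hconv : ∀ k, 1 ≤ k → ∀ l : Fin (n k) → ℤ,
      JacksonConverges N kmax ψ τ n ut k (latticePoint (ut k) l))
    (k : ℕ) (hk : 1 ≤ k) (π : Equiv.Perm (Fin (n k))) (l : Fin (n k) → ℤ) :
    CyclicAt (levelFunction N kmax ψ τ n ut k) (latticePoint (ut k) l ∘ π) := by
  rcases Nat.eq_zero_or_pos (kmax - 1 - k) with h | h
  · unfold levelFunction
    rw [h]
    exact cyclicAt_refState _ _ _
  · have hx := fun l => (hbetween k hk).latticePoint l
    refine levelFunction_cyclicAt hN hψ hτ (hwithin (k + 1) (by omega)) (fun σ l' => ?_)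
      (levelFunction_cyclicAt_latticePoint hN hψ hτ hwithin hbetween hconv (k + 1) (by omega))
      ((hx l).comp_perm π) ((hconv k hk l).comp_perm π) fun p _ => ?_
    · exact levelFunction_exchangeAt
        (((hbetween (k + 1) (by omega)).latticePoint l').comp_perm σ)
        ((hconv (k + 1) (by omega) l').comp_perm σ)
    -- The shift stays within the lattice, up to the permutation, so convergence is available there.
    · rw [update_latticePoint_comp_perm]
      exact (hconv k hk _).comp_perm π
termination_by kmax - 1 - k

end Levels

end

/-- The nested generalized Bethe Ansatz solves the system of `SU(N)` matrix difference equations. -/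
theorem corollary3p2 (N kmax : ℕ) (hkmax : 1 ≤ kmax) (hkmaxN : kmax ≤ N)
    (ψ τ : ℂ → ℂ) (hψ : IsPsi N ψ) (hτ : IsTau N τ)
    (n : ℕ → ℕ) (hn : ∀ k, kmax ≤ k → n k = 0)
    (ut : ∀ k, Fin (n k) → ℂ)
    (hwithin : ∀ k, 1 ≤ k → RegularWithin N τ (ut k))
    (hbetween : ∀ k, 1 ≤ k → RegularBetween N ψ (ut k) (ut (k + 1)))
    (hconv : ∀ k, 1 ≤ k → ∀ l : Fin (n k) → ℤ,
      JacksonConverges N kmax ψ τ n ut k (latticePoint (ut k) l))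
    (x : Fin (n 0) → ℂ)
    (hx : RegularBetween N ψ x (ut 1))
    (hxconv : JacksonConverges N kmax ψ τ n ut 0 x)
    (i : Fin (n 0))
    (hxi : JacksonConverges N kmax ψ τ n ut 0 (Function.update x i (x i + 2)))
    (hQ₁ : ∀ j, j < i → x j - x i ≠ 2 / N)
    (hQ₂ : ∀ j, i < j → x j - (x i + 2) ≠ 2 / N) :
    levelFunction N kmax ψ τ n ut 0 (Function.update x i (x i + 2)) =
      qMatrix N x i (levelFunction N kmax ψ τ n ut 0 x) := by
  have hN : N ≠ 0 := by omega
  refine eq_qMatrix_of_exchangeAt_of_cyclicAt i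
    (fun π => levelFunction_exchangeAt (hx.comp_perm π) (hxconv.comp_perm π))
    (fun π => levelFunction_exchangeAt ((hx.update i).comp_perm π) (hxi.comp_perm π))
    (fun π hπ => ?_) hQ₁ hQ₂
  refine levelFunction_cyclicAt hN hψ hτ (hwithin 1 le_rfl) (fun σ l => ?_)
    (levelFunction_cyclicAt_latticePoint hN hψ hτ hwithin hbetween hconv 1 le_rfl)
    (hx.comp_perm π) (hxconv.comp_perm π) fun p hp => ?_
  · exact levelFunction_exchangeAt (((hbetween 1 le_rfl).latticePoint l).comp_perm σ)
      ((hconv 1 le_rfl l).comp_perm σ)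
  -- `π` puts `i` last, so the only shifted point whose convergence is needed is a permutation of
  -- the one in `hxi`.
  · rw [update_comp_perm, Function.comp_apply, hπ p hp]
    exact hxi.comp_perm π
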